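/- Let $n,p,k\in\mathbb{R}$ with $n\neq 1$, $p\neq 0$, $k\neq 0$, and consider the radial nonlinear Schrödinger equation $$\mathrm{i}u_t=u_{rr}+\frac{n-1}{r}u_r+k|u|^pu,\qquad u=u(t,r)\in\mathbb{C},\ r>0 .$$ Let $U$ be a nonempty connected open set of points $(t,r,u)\in\mathbb{R}\times\mathbb{R}\times\mathbb{C}$ with $r>0$, $u\neq0$. A point symmetry over $U$ is a smooth real vector field $X=\tau\,\partial_t+\rho\,\partial_r+\eta\,\partial_u+\bar\eta\,\partial_{\bar u}$ on $U$ ($\tau,\rho$ real-valued and $\eta$ complex-valued functions of $(t,r,u,\bar u)$) whose second prolongation satisfies $$\mathrm{pr}X\Big(\mathrm{i}u_t-u_{rr}-\tfrac{n-1}{r}u_r-k|u|^pu\Big)=0$$ at every second-order jet over $U$ that satisfies the equation. Put $$X_{\rm phas}=\mathrm{i}u\,\partial_u-\mathrm{i}\bar u\,\partial_{\bar u},\qquad X_{\rm trans}=\partial_t,\qquad X_{\rm scal}=2t\,\partial_t+r\,\partial_r-\tfrac2p u\,\partial_u-\tfrac2p\bar u\,\partial_{\bar u},$$ $$X_{\rm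 inver}=t^2\partial_t+tr\,\partial_r-\big(\tfrac{2t}{p}+\tfrac{\mathrm{i}r^2}{4}\big)u\,\partial_u-\big(\tfrac{2t}{p}-\tfrac{\mathrm{i}r^2}{4}\big)\bar u\,\partial_{\bar u}.$$ 1. **Classification.** If $p\neq 4/n$, the point symmetries over $U$ are exactly the real linear combinations of $X_{\rm phas},X_{\rm trans},X_{\rm scal}$ (restricted to $U$). If $p=4/n$, they are exactly the real linear combinations of $X_{\rm phas},X_{\rm trans},X_{\rm scal},X_{\rm inver}$. The field $X_{\rm inver}$ is a point symmetry over $U$ if and only if $p=4/n$. 2. **No hidden symmetries.** If $n=d$ is an integer $d\ge2$, every point symmetry $X$ over $U$ is inherited from the equation $\mathrm{i}u_t=\Delta u+k|u|^pu$ in $\mathbb{R}^d$: with $\pi(t,x,u)=(t,|x|,u)$, there is a point symmetry $Y$ of the latter equation over $\pi^{-1}(U)$ that normalizes the Lie algebra $\mathfrak{so}(d)$ of infinitesimal rotations of $x$ (the commutator of $Y$ with an infinitesimal rotation is, on $\pi^{-1}(U)$, an infinitesimal rotation) and satisfies $d\pi(Y)=X\circ\pi$ on $\pi^{-1}(U)$.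 3. **Commutators.** $$[X_{\rm phas},X_{\rm trans}]=[X_{\rm phas},X_{\rm scal}]=[X_{\rm phas},X_{\rm inver}]=0,$$ $$[X_{\rm trans},X_{\rm scal}]=2X_{\rm trans},\quad [X_{\rm trans},X_{\rm inver}]=X_{\rm scal},\quad [X_{\rm scal},X_{\rm inver}]=2X_{\rm inver}.$$ 4. **Group actions on solutions.** Let $f$ be a $C^2$ solution on an open set $D$ of points $(t,r)$, $r>0$. The flows of these vector fields carry the graph of $f$ onto the graph of the function $u=g(t,r)$ below, and $g$ is again a $C^2$ solution on its domain, which consists of the $(t,r)$ at which the argument of $f$ lies in $D$: - $u=e^{\mathrm{i}\phi}f(t,r)$, the flow of $X_{\rm phas}$ at time $\phi\in\mathbb{R}$; - $u=f(t-\epsilon,r)$, the flow of $X_{\rm trans}$ at time $\epsilon\in\mathbb{R}$; - $u=\lambda^{-2/p}f(\lambda^{-2}t,\lambda^{-1}r)$, the flow of $X_{\rm scal}$ at time $\ln\lambda$, $\lambda>0$; - if $p=4/n$: $u=(1+\epsilon t)^{-2/p}\exp\!\Big(\!-\frac{\mathrm{i}\epsilon r^2}{4+4\epsilon t}\Big)f\Big(\frac{t}{1+\epsilon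 t},\frac{r}{1+\epsilon t}\Big)$, on the part where $1+\epsilon t>0$, the flow of $X_{\rm inver}$ at time $\epsilon\in\mathbb{R}$ (points of the graph from which the flow does not exist up to time $\epsilon$ being left out). Where $u=0$, the term $k|u|^pu$ is read as $0$. -/

import Mathlib

open scoped ContDiff

noncomputable section

namespace RadialNLS

section Jets

variable {ι : Type} [Fintype ι] [DecidableEq ι]

/-- The space of the independent variables `x = (x_i)` and one complex dependent variable `u`.
A map `X : Base ι → Base ι`, `X z = (ξ z, η z)`, is the real vector field
`∑ᵢ ξⁱ ∂/∂xᵢ + η ∂/∂u + η̄ ∂/∂ū`. -/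
abbrev Base (ι : Type) : Type := (ι → ℝ) × ℂ

/-- First-order jets `((x, u), (u_i))`. -/
abbrev Jet1 (ι : Type) : Type := Base ι × (ι → ℂ)

/-- Second-order jets `(((x, u), (u_i)), (u_ij))`; the actual jets are those with
`u_ij = u_ji`. -/
abbrev Jet2 (ι : Type) : Type := Jet1 ι × (ι → ι → ℂ)

/-- The partial derivative of `f` with respect to `x_i`. -/
def pderiv (f : (ι → ℝ) → ℂ) (i : ι) (x : ι → ℝ) : ℂ := fderiv ℝ f x (Pi.single i 1)

/-- The second-order jet of the function `f` at `x`. -/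
def jet2 (f : (ι → ℝ) → ℂ) (x : ι → ℝ) : Jet2 ι :=
  (((x, f x), fun i => pderiv f i x), fun i j => pderiv (pderiv f j) i x)

/-- The total derivative `D_i` of a function of `(x, u)`. -/
def totalD {F : Type} [NormedAddCommGroup F] [NormedSpace ℝ F] (G : Base ι → F) (i : ι)
    (j : Jet1 ι) : F :=
  fderiv ℝ G j.1 (Pi.single i 1, j.2 i)

/-- The total derivative `D_i` of a function of `(x, u, ∂u)`. -/
def totalD1 {F : Type} [NormedAddCommGroup F] [NormedSpace ℝ F] (G : Jet1 ι → F) (i : ι)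
    (j : Jet2 ι) : F :=
  fderiv ℝ G j.1 ((Pi.single i 1, j.1.2 i), j.2 i)

/-- First-order prolongation coefficients `η_i = D_i η - ∑ₗ u_l D_i ξˡ` of the vector field
`(ξ, η)`. -/
def prolongCoeff1 (X : Base ι → Base ι) (i : ι) (j : Jet1 ι) : ℂ :=
  totalD (fun z => (X z).2) i j - ∑ l, j.2 l * ((totalD (fun z => (X z).1 l) i j : ℝ) : ℂ)

/-- Second-order prolongation coefficients `η_im = D_i η_m - ∑ₗ u_lm D_i ξˡ`. -/
def prolongCoeff2 (X : Base ι → Base ι) (i m : ι) (j : Jet2 ι) : ℂ :=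
  totalD1 (prolongCoeff1 X m) i j
    - ∑ l, j.2 l m * ((totalD (fun z => (X z).1 l) i j.1 : ℝ) : ℂ)

/-- The second prolongation of `X`, as a vector field on the space of second-order jets. -/
def prolong (X : Base ι → Base ι) (j : Jet2 ι) : Jet2 ι :=
  ((X j.1.1, fun i => prolongCoeff1 X i j.1), fun i m => prolongCoeff2 X i m j)

/-- `X` is (the generator of) a point symmetry, over the open set `U` of points `(x, u)`, of the
second-order equation `E = 0`: it is smooth on `U` and `pr X (E) = 0` wherever `E = 0`. -/
def IsPointSymmetry (E : Jet2 ι → ℂ) (U : Set (Base ι)) (X : Base ι → Base ι) : Prop :=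
  ContDiffOn ℝ ∞ X U ∧
    ∀ j : Jet2 ι, j.1.1 ∈ U → (∀ i m, j.2 i m = j.2 m i) → E j = 0 →
      fderiv ℝ E j (prolong X j) = 0

/-- The flow of `X` (its local one-parameter group) carries `z` to `z'` in time `s`. -/
def FlowsTo (X : Base ι → Base ι) (s : ℝ) (z z' : Base ι) : Prop :=
  ∃ γ : ℝ → Base ι, γ 0 = z ∧ γ s = z' ∧ ∀ σ ∈ Set.uIcc 0 s, HasDerivAt γ (X (γ σ)) σ

/-- The graph of the function `f` over the set `D`. -/
def graphOn (D : Set (ι → ℝ)) (f : (ι → ℝ) → ℂ) : Set (Base ι) := {z | z.1 ∈ D ∧ z.2 = f z.1}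

/-- The time-`s` flow of `X` transforms the function `f` on `D` into the function `g` on `D'`:
it carries the graph of `f` (as far as the flow exists up to time `s`) onto the graph of `g`. -/
def Transforms (X : Base ι → Base ι) (s : ℝ) (D : Set (ι → ℝ)) (f : (ι → ℝ) → ℂ)
    (D' : Set (ι → ℝ)) (g : (ι → ℝ) → ℂ) : Prop :=
  {z' | ∃ z ∈ graphOn D f, FlowsTo X s z z'} = graphOn D' g

end Jets

/-! The radial equation: the independent variables are `x 0 = t` and `x 1 = r`. -/

/-- The radial equation `i u_t - u_rr - (n-1) r⁻¹ u_r - k |u|^p u = 0`. -/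
def radialEq (n p k : ℝ) (j : Jet2 (Fin 2)) : ℂ :=
  Complex.I * j.1.2 0 - j.2 1 1 - (((n - 1) / j.1.1.1 1 : ℝ) : ℂ) * j.1.2 1
    - ((k * ‖j.1.1.2‖ ^ p : ℝ) : ℂ) * j.1.1.2

/-- The points `(t, r, u)` with `r > 0` and `u ≠ 0`, where the radial equation is smooth. -/
def regularDomain : Set (Base (Fin 2)) := {z | 0 < z.1 1 ∧ z.2 ≠ 0}

/-- `f` is a classical solution of the radial equation on the open set `D` of points `(t, r)`
with `r > 0`. -/
def IsRadialSolution (n p k : ℝ) (D : Set (Fin 2 → ℝ)) (f : (Fin 2 → ℝ) → ℂ) : Prop :=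
  IsOpen D ∧ (∀ x ∈ D, 0 < x 1) ∧ ContDiffOn ℝ 2 f D ∧ ∀ x ∈ D, radialEq n p k (jet2 f x) = 0

/-- `i u ∂/∂u - i ū ∂/∂ū`. -/
def Xphas (z : Base (Fin 2)) : Base (Fin 2) := (![0, 0], Complex.I * z.2)

/-- `∂/∂t`. -/
def Xtrans (_ : Base (Fin 2)) : Base (Fin 2) := (![1, 0], 0)

/-- `2t ∂/∂t + r ∂/∂r - (2/p) u ∂/∂u - (2/p) ū ∂/∂ū`. -/
def Xscal (p : ℝ) (z : Base (Fin 2)) : Base (Fin 2) :=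
  (![2 * z.1 0, z.1 1], -((2 / p : ℝ) : ℂ) * z.2)

/-- `t² ∂/∂t + t r ∂/∂r - (2t/p + i r²/4) u ∂/∂u - (2t/p - i r²/4) ū ∂/∂ū`. -/
def Xinver (p : ℝ) (z : Base (Fin 2)) : Base (Fin 2) :=
  (![z.1 0 ^ 2, z.1 0 * z.1 1],
    -(((2 * z.1 0 / p : ℝ) : ℂ) + Complex.I * ((z.1 1 ^ 2 / 4 : ℝ) : ℂ)) * z.2)

/-! The equation in `ℝᵈ`: the independent variables are `x 0 = t` and `x 1, …, x d`, the
coordinates of the space variable. -/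

/-- The equation `i u_t - Δu - k |u|^p u = 0` in `ℝᵈ`. -/
def nlsEq (d : ℕ) (p k : ℝ) (j : Jet2 (Fin (d + 1))) : ℂ :=
  Complex.I * j.1.2 0 - ∑ i : Fin d, j.2 i.succ i.succ
    - ((k * ‖j.1.1.2‖ ^ p : ℝ) : ℂ) * j.1.1.2

/-- The radial reduction map `(t, x, u) ↦ (t, |x|, u)`. -/
def radialMap (d : ℕ) (z : Base (Fin (d + 1))) : Base (Fin 2) :=
  (![z.1 0, √(∑ i : Fin d, z.1 i.succ ^ 2)], z.2)

/-- The infinitesimal space rotation `(A x) · ∂/∂x` given by a skew-symmetric matrix `A`. -/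
def rotationField {d : ℕ} (A : Matrix (Fin d) (Fin d) ℝ) (z : Base (Fin (d + 1))) :
    Base (Fin (d + 1)) :=
  (Fin.cons 0 (A.mulVec fun i => z.1 i.succ), 0)

/-- The vector field `X` on `U` is inherited by radial reduction from a point symmetry `Y` of the
equation in `ℝᵈ`: `Y` normalizes the rotation algebra `so(d)` and projects to `X` under
`(t, x, u) ↦ (t, |x|, u)`. -/
def IsInherited (d : ℕ) (p k : ℝ) (U : Set (Base (Fin 2))) (X : Base (Fin 2) → Base (Fin 2)) :
    Prop :=
  ∃ Y : Base (Fin (d + 1)) → Base (Fin (d + 1)),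
    IsPointSymmetry (nlsEq d p k) (radialMap d ⁻¹' U) Y ∧
    (∀ A : Matrix (Fin d) (Fin d) ℝ, A.transpose = -A →
      ∃ B : Matrix (Fin d) (Fin d) ℝ, B.transpose = -B ∧
        Set.EqOn (VectorField.lieBracket ℝ Y (rotationField A)) (rotationField B)
          (radialMap d ⁻¹' U)) ∧
    ∀ z ∈ radialMap d ⁻¹' U, fderiv ℝ (radialMap d) z (Y z) = X (radialMap d z)

end RadialNLS

end

open RadialNLS

/-!
# Point symmetries of the radial nonlinear Schrödinger equation

**Classification.** Write a symmetry as `τ ∂_t + ρ ∂_r + η ∂_u + c.c.`. Eliminating `u_rr` by the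
equation, the symmetry condition becomes a polynomial identity in the free jet coordinates `u_t`,
`u_r`, `u_tr` (`determining_equation`). Its coefficients say successively that `τ` depends on `t`
only (`symmetry_tau`), that `ρ` does not depend on `u` (`symmetry_rho`), that `η_u` is complex
linear with `τ_t = 2 ρ_r` (`symmetry_eta`), and that `η` is affine in `u`, with a slope `A` whose
`r`-derivative is expressed by `ρ` (`symmetry_eta_coeff`). The part free of derivatives of `u` is a
relation between `1`, `u`, `|u|^p u` and the differential of `|u|^p u`; testing it on rotated and
dilated values of `u` (`nonlin_independent`) shows that `η = A u`, that `2 ρ_r + p Re A = 0`, and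
that `η` solves the linear equation (`symmetry_eta_linear`). Since `Re A` depends on `t` only and
`n ≠ 1`, this gives `ρ = r τ_t / 2`, then `A_r = -i r τ_tt / 4` and `A_t = -n τ_tt / 4`, so that
`τ_ttt = 0` by compatibility and `(n p - 4) τ_tt = 0` by comparison with `Re A = -τ_t / p`.
Integration over the connected domain leaves four real constants
(`exists_symField_of_isPointSymmetry`).

**Converse and radial reduction.** In any dimension `d`, the field with
`τ = a + 2bt + ct²`, `ξ = (b + ct) x` and `η = (iφ - 2(b + ct)/p - ic|x|²/4) u` has an explicit
second prolongation, and it maps the equation to a multiple of itself plus `ic (d/2 - 2/p) u`. The case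
`d = 1` of these formulas also serves the radial equation, with `n` in place of `d` after adding the
terms of the first derivative. The fields commute with rotations and project to the radial ones
under `(t, x, u) ↦ (t, |x|, u)`, hence no symmetry is hidden.

**Group actions.** The flows are found by solving linear equations: for the inversion through a
point with `t = t₀`, the function `t (1 - σ t₀) - t₀` of the flow time `σ` solves a homogeneous linear
equation, so it vanishes and the orbit exists exactly while `1 - σ t₀ > 0` (`flowsTo_Xinver_iff`).
All transformed solutions have the form `M(t, r) f(T(t), S(t) r)` and are treated together in
`isRadialSolution_transform`.
-/

noncomputable section

namespace RadialNLS

/-! ### Directional derivatives -/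

section DirectionalDerivative

variable {E F : Type} [NormedAddCommGroup E] [NormedSpace ℝ E] [NormedAddCommGroup F]
  [NormedSpace ℝ F]

/-- The derivative of `f` in the constant direction `v`, as a function of the base point. -/
def dirDeriv (v : E) (f : E → F) (z : E) : F := fderiv ℝ f z v

variable {U : Set E} {f g : E → F}

theorem dirDeriv_congr (hU : IsOpen U) (h : Set.EqOn f g U) (v : E) :
    Set.EqOn (dirDeriv v f) (dirDeriv v g) U := fun z hz => by
  have : f =ᶠ[nhds z] g := Filter.eventuallyEq_of_mem (hU.mem_nhds hz) h
  simp only [dirDeriv, this.fderiv_eq]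

theorem contDiffOn_dirDeriv (hU : IsOpen U) (hf : ContDiffOn ℝ ∞ f U) (v : E) :
    ContDiffOn ℝ ∞ (dirDeriv v f) U :=
  (hf.fderiv_of_isOpen hU (m := ∞) (by simp)).clm_apply contDiffOn_const

theorem differentiableAt_of_contDiffOn (hU : IsOpen U) (hf : ContDiffOn ℝ ∞ f U) {z : E}
    (hz : z ∈ U) : DifferentiableAt ℝ f z :=
  (hf.contDiffAt (hU.mem_nhds hz)).differentiableAt (by simp)

theorem dirDeriv_dirDeriv (hU : IsOpen U) (hf : ContDiffOn ℝ ∞ f U) {z : E} (hz : z ∈ U)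
    (v w : E) : dirDeriv v (dirDeriv w f) z = fderiv ℝ (fderiv ℝ f) z v w := by
  have h : DifferentiableAt ℝ (fderiv ℝ f) z :=
    differentiableAt_of_contDiffOn hU (hf.fderiv_of_isOpen hU (m := ∞) (by simp)) hz
  have := (h.hasFDerivAt.clm_apply (hasFDerivAt_const w z)).fderiv
  change fderiv ℝ (fun y => fderiv ℝ f y w) z v = _
  rw [this]
  simp

/-- Symmetry of the second derivative. -/
theorem dirDeriv_comm (hU : IsOpen U) (hf : ContDiffOn ℝ ∞ f U) {z : E} (hz : z ∈ U)
    (v w : E) : dirDeriv v (dirDeriv w f) z = dirDeriv w (dirDeriv v f) z := by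
  rw [dirDeriv_dirDeriv hU hf hz, dirDeriv_dirDeriv hU hf hz]
  exact ((hf.contDiffAt (hU.mem_nhds hz)).isSymmSndFDerivAt
    (by simpa using WithTop.coe_le_coe.2 (le_top : (2 : ℕ∞) ≤ ⊤))).eq v w

theorem dirDeriv_add_left (f : E → F) (v w z : E) :
    dirDeriv (v + w) f z = dirDeriv v f z + dirDeriv w f z := map_add _ _ _

theorem dirDeriv_smul_left (f : E → F) (c : ℝ) (v z : E) :
    dirDeriv (c • v) f z = c • dirDeriv v f z := map_smul _ _ _

end DirectionalDerivative

/-! ### Prolongation coefficients -/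

section Prolongation

variable {ι : Type} [Fintype ι] [DecidableEq ι]

/-- The second prolongation coefficient, written out: `η_im` is
`D_i D_m η - ∑ₗ (u_l D_i D_m ξˡ + u_il D_m ξˡ + u_lm D_i ξˡ)`, where `D_i D_m` is the second
derivative in the directions `(e_i, u_i)`, `(e_m, u_m)` plus the derivative in the direction
`(0, u_im)`. -/
theorem prolongCoeff2_eq {U : Set (Base ι)} (hU : IsOpen U) {X : Base ι → Base ι}
    (hX : ContDiffOn ℝ ∞ X U) (i m : ι) (j : Jet2 ι) (hj : j.1.1 ∈ U) :
    prolongCoeff2 X i m j =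
      (dirDeriv (Pi.single i 1, j.1.2 i) (dirDeriv (Pi.single m 1, j.1.2 m) fun z => (X z).2) j.1.1
        + dirDeriv (0, j.2 i m) (fun z => (X z).2) j.1.1)
      - ∑ l, (j.1.2 l * ((dirDeriv (Pi.single i 1, j.1.2 i)
              (dirDeriv (Pi.single m 1, j.1.2 m) fun z => (X z).1 l) j.1.1
            + dirDeriv (0, j.2 i m) (fun z => (X z).1 l) j.1.1 : ℝ) : ℂ)
          + j.2 i l * ((dirDeriv (Pi.single m 1, j.1.2 m) (fun z => (X z).1 l) j.1.1 : ℝ) : ℂ))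
      - ∑ l, j.2 l m *
          ((dirDeriv (Pi.single i 1, j.1.2 i) (fun z => (X z).1 l) j.1.1 : ℝ) : ℂ) := by
  have hη : ContDiffOn ℝ ∞ (fun z => (X z).2) U := hX.snd
  have hξ : ∀ l, ContDiffOn ℝ ∞ (fun z => (X z).1 l) U := fun l =>
    (contDiff_apply ℝ ℝ l).comp_contDiffOn hX.fst
  -- the derivative of a total derivative `D_m G` along a jet direction
  have key : ∀ {F : Type} [NormedAddCommGroup F] [NormedSpace ℝ F] (G : Base ι → F),
      ContDiffOn ℝ ∞ G U → ∃ L : Jet1 ι →L[ℝ] F, HasFDerivAt (totalD G m) L j.1 ∧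
        L ((Pi.single i 1, j.1.2 i), j.2 i) =
          dirDeriv (Pi.single i 1, j.1.2 i) (dirDeriv (Pi.single m 1, j.1.2 m) G) j.1.1
            + dirDeriv (0, j.2 i m) G j.1.1 := by
    intro F _ _ G hG
    have h1 : HasFDerivAt (fun J : Jet1 ι => fderiv ℝ G J.1)
        ((fderiv ℝ (fderiv ℝ G) j.1.1).comp (ContinuousLinearMap.fst ℝ _ _)) j.1 :=
      HasFDerivAt.comp j.1 (differentiableAt_of_contDiffOn hU
        (hG.fderiv_of_isOpen hU (m := ∞) (by simp)) hj).hasFDerivAt hasFDerivAt_fst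
    have h2 : HasFDerivAt (fun J : Jet1 ι => ((Pi.single m 1, J.2 m) : Base ι))
        ((0 : Jet1 ι →L[ℝ] (ι → ℝ)).prod
          ((ContinuousLinearMap.proj m).comp (ContinuousLinearMap.snd ℝ _ _))) j.1 :=
      (hasFDerivAt_const _ _).prodMk
        ((ContinuousLinearMap.proj (R := ℝ) (φ := fun _ : ι => ℂ) m).comp
          (ContinuousLinearMap.snd ℝ (Base ι) (ι → ℂ))).hasFDerivAt
    refine ⟨_, h1.clm_apply h2, ?_⟩
    rw [dirDeriv_dirDeriv hU hG hj]
    simp [dirDeriv, add_comm]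
  obtain ⟨Lη, hLη, eLη⟩ := key _ hη
  choose L hL eL using fun l => key _ (hξ l)
  have hu : ∀ l, HasFDerivAt (fun J : Jet1 ι => J.2 l)
      ((ContinuousLinearMap.proj (R := ℝ) (φ := fun _ : ι => ℂ) l).comp
          (ContinuousLinearMap.snd ℝ (Base ι) (ι → ℂ))) j.1 := fun l =>
    ((ContinuousLinearMap.proj (R := ℝ) (φ := fun _ : ι => ℂ) l).comp
          (ContinuousLinearMap.snd ℝ (Base ι) (ι → ℂ))).hasFDerivAt
  have hc : ∀ l, HasFDerivAt (fun J : Jet1 ι => ((totalD (fun z => (X z).1 l) m J : ℝ) : ℂ))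
      (Complex.ofRealCLM.comp (L l)) j.1 := fun l =>
    Complex.ofRealCLM.hasFDerivAt.comp j.1 (hL l)
  have hsum := HasFDerivAt.fun_sum (u := Finset.univ) fun l _ => (hu l).mul (hc l)
  have := (hLη.sub hsum).fderiv
  unfold prolongCoeff2
  congr 1
  unfold totalD1
  have e : prolongCoeff1 X m = fun J : Jet1 ι => totalD (fun z => (X z).2) m J -
      ∑ l, J.2 l * ((totalD (fun z => (X z).1 l) m J : ℝ) : ℂ) := rfl
  rw [e]
  erw [this]
  simp only [sub_apply, eLη, sum_apply]
  congr 1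
  refine Finset.sum_congr rfl fun l _ => ?_
  simp [eL, totalD, dirDeriv, mul_comm]

end Prolongation

/-! ### The differential of the nonlinear term -/

section Nonlinearity

/-- The differential of `u ↦ k |u|^p u` at `u ≠ 0`, applied to `v`. -/
def nonlinDeriv (k p : ℝ) (u v : ℂ) : ℂ :=
  ((k * ‖u‖ ^ p : ℝ) : ℂ) * (v + ((p * (v / u).re : ℝ) : ℂ) * u)

theorem hasFDerivAt_nonlin (k p : ℝ) {u : ℂ} (hu : u ≠ 0) :
    ∃ L : ℂ →L[ℝ] ℂ, HasFDerivAt (fun u : ℂ => ((k * ‖u‖ ^ p : ℝ) : ℂ) * u) L u ∧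
      ∀ v, L v = nonlinDeriv k p u v := by
  have hn : 0 < ‖u‖ := norm_pos_iff.2 hu
  have h1 : HasFDerivAt (fun u : ℂ => ‖u‖ ^ 2) (2 • (innerSL ℝ u)) u :=
    (hasStrictFDerivAt_norm_sq u).hasFDerivAt
  have h2 := h1.rpow_const (p := p / 2) (Or.inl (by positivity))
  have e : (fun u : ℂ => (‖u‖ ^ 2) ^ (p / 2)) = fun u : ℂ => ‖u‖ ^ p := by
    funext w
    rw [← Real.rpow_natCast, ← Real.rpow_mul (norm_nonneg _)]
    congr 1; push_cast; ring
  rw [e] at h2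
  have h3 := (Complex.ofRealCLM.hasFDerivAt.comp u (h2.const_mul k)).mul (hasFDerivAt_id u)
  refine ⟨_, h3, fun v => ?_⟩
  have e2 : (‖u‖ ^ 2) ^ (p / 2 - 1) = ‖u‖ ^ p / ‖u‖ ^ 2 := by
    rw [Real.rpow_sub (by positivity), Real.rpow_one, ← congrFun e u]
  have e3 : (v / u).re = inner ℝ u v / ‖u‖ ^ 2 := by
    rw [Complex.div_re, Complex.inner, ← Complex.normSq_eq_norm_sq]
    simp [Complex.mul_re]; ring
  simp [nonlinDeriv, e2, e3]
  ring

end Nonlinearity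

/-! ### The differential of the radial equation -/

section RadialDifferential

theorem fderiv_radialEq (n p k : ℝ) (j w : Jet2 (Fin 2)) (hr : 0 < j.1.1.1 1)
    (hu : j.1.1.2 ≠ 0) :
    fderiv ℝ (radialEq n p k) j w = Complex.I * w.1.2 0 - w.2 1 1
      + (((n - 1) / j.1.1.1 1 ^ 2 * w.1.1.1 1 : ℝ) : ℂ) * j.1.2 1
      - (((n - 1) / j.1.1.1 1 : ℝ) : ℂ) * w.1.2 1 - nonlinDeriv k p j.1.1.2 w.1.1.2 := by
  obtain ⟨L, hL, eL⟩ := hasFDerivAt_nonlin k p hu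
  let π1 : Jet2 (Fin 2) →L[ℝ] Jet1 (Fin 2) := ContinuousLinearMap.fst ℝ _ _
  let π2 : Jet2 (Fin 2) →L[ℝ] (Fin 2 → Fin 2 → ℂ) := ContinuousLinearMap.snd ℝ _ _
  let πv : Jet2 (Fin 2) →L[ℝ] (Fin 2 → ℂ) := (ContinuousLinearMap.snd ℝ _ _).comp π1
  let πz : Jet2 (Fin 2) →L[ℝ] Base (Fin 2) := (ContinuousLinearMap.fst ℝ _ _).comp π1
  let πu : Jet2 (Fin 2) →L[ℝ] ℂ := (ContinuousLinearMap.snd ℝ _ _).comp πz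
  let πr : Jet2 (Fin 2) →L[ℝ] ℝ :=
    (ContinuousLinearMap.proj 1).comp ((ContinuousLinearMap.fst ℝ _ _).comp πz)
  let v : Fin 2 → Jet2 (Fin 2) →L[ℝ] ℂ := fun i => (ContinuousLinearMap.proj i).comp πv
  let w11 : Jet2 (Fin 2) →L[ℝ] ℂ :=
    (ContinuousLinearMap.proj 1).comp ((ContinuousLinearMap.proj (R := ℝ)
      (φ := fun _ : Fin 2 => Fin 2 → ℂ) 1).comp π2)
  have hr' : HasFDerivAt (fun J : Jet2 (Fin 2) => (n - 1) / J.1.1.1 1)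
      ((-((n - 1) / j.1.1.1 1 ^ 2)) • πr) j := by
    have h1 : HasDerivAt (fun s : ℝ => (n - 1) / s) (-((n - 1) / j.1.1.1 1 ^ 2)) (j.1.1.1 1) := by
      simpa [div_eq_mul_inv] using (hasDerivAt_inv hr.ne').const_mul (n - 1)
    exact h1.comp_hasFDerivAt j πr.hasFDerivAt
  have hN : HasFDerivAt (fun J : Jet2 (Fin 2) => ((k * ‖J.1.1.2‖ ^ p : ℝ) : ℂ) * J.1.1.2)
      (L.comp πu) j := HasFDerivAt.comp j (f := πu) hL πu.hasFDerivAt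
  have h := ((((v 0).hasFDerivAt (x := j)).const_mul Complex.I).sub (w11.hasFDerivAt (x := j))
    |>.sub ((Complex.ofRealCLM.hasFDerivAt.comp j hr').mul ((v 1).hasFDerivAt (x := j)))).sub hN
  have e : fderiv ℝ (radialEq n p k) j = _ := HasFDerivAt.fderiv h
  rw [e]
  simp [eL, v, w11, πr, πu, πz, πv, π1, π2]
  ring

end RadialDifferential

/-! ### The determining equation -/

section Determining

/-- The determining equation before splitting it with respect to the derivatives of `u`. -/
theorem determining_equation {n p k : ℝ} {U : Set (Base (Fin 2))} (hU : IsOpen U)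
    (hreg : U ⊆ regularDomain) {τ ρ : Base (Fin 2) → ℝ} {η : Base (Fin 2) → ℂ}
    (hX : IsPointSymmetry (radialEq n p k) U fun z => (![τ z, ρ z], η z))
    {z : Base (Fin 2)} (hz : z ∈ U) (v₀ v₁ w₀ w : ℂ)
    (hw : w = Complex.I * v₀ - (((n - 1) / z.1 1 : ℝ) : ℂ) * v₁
      - ((k * ‖z.2‖ ^ p : ℝ) : ℂ) * z.2) :
    Complex.I * (dirDeriv (Pi.single 0 1, v₀) η z
        - v₀ * ((dirDeriv (Pi.single 0 1, v₀) τ z : ℝ) : ℂ)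
        - v₁ * ((dirDeriv (Pi.single 0 1, v₀) ρ z : ℝ) : ℂ))
      - (dirDeriv (Pi.single 1 1, v₁) (dirDeriv (Pi.single 1 1, v₁) η) z + dirDeriv (0, w) η z
        - v₀ * ((dirDeriv (Pi.single 1 1, v₁) (dirDeriv (Pi.single 1 1, v₁) τ) z
            + dirDeriv (0, w) τ z : ℝ) : ℂ)
        - v₁ * ((dirDeriv (Pi.single 1 1, v₁) (dirDeriv (Pi.single 1 1, v₁) ρ) z
            + dirDeriv (0, w) ρ z : ℝ) : ℂ)
        - 2 * w₀ * ((dirDeriv (Pi.single 1 1, v₁) τ z : ℝ) : ℂ)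
        - 2 * w * ((dirDeriv (Pi.single 1 1, v₁) ρ z : ℝ) : ℂ))
      + (((n - 1) / z.1 1 ^ 2 * ρ z : ℝ) : ℂ) * v₁
      - (((n - 1) / z.1 1 : ℝ) : ℂ) * (dirDeriv (Pi.single 1 1, v₁) η z
        - v₀ * ((dirDeriv (Pi.single 1 1, v₁) τ z : ℝ) : ℂ)
        - v₁ * ((dirDeriv (Pi.single 1 1, v₁) ρ z : ℝ) : ℂ))
      - nonlinDeriv k p z.2 (η z) = 0 := by
  have h := hX.2 ((z, ![v₀, v₁]), ![![0, w₀], ![w₀, w]]) hz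
    (by intro i m; fin_cases i <;> fin_cases m <;> rfl)
    (by simp [radialEq, hw]; ring)
  rw [fderiv_radialEq n p k _ _ (hreg hz).1 (hreg hz).2] at h
  simp only [prolong] at h
  rw [prolongCoeff2_eq hU hX.1 _ _ _ hz] at h
  simp only [prolongCoeff1, totalD, Fin.sum_univ_two, Matrix.cons_val_zero,
    Matrix.cons_val_one] at h
  rw [← h]
  simp only [dirDeriv]
  push_cast
  ring

end Determining

/-! ### Splitting with respect to the derivatives of `u`: the coefficients `τ` and `ρ` -/

section Splitting

/-- The coordinate direction `∂/∂t`. -/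
def eT : Base (Fin 2) := (Pi.single 0 1, 0)

/-- The coordinate direction `∂/∂r`. -/
def eR : Base (Fin 2) := (Pi.single 1 1, 0)

/-- The direction `v` in the plane of the dependent variable `u`. -/
def eU (v : ℂ) : Base (Fin 2) := (0, v)

theorem eT_add (v : ℂ) : (Pi.single 0 1, v) = eT + eU v := by simp [eT, eU]

theorem eR_add (v : ℂ) : (Pi.single 1 1, v) = eR + eU v := by simp [eR, eU]

theorem eU_sub (v w : ℂ) : eU (v - w) = eU v - eU w := by simp [eU]

theorem eU_eq (v : ℂ) : eU v = v.re • eU 1 + v.im • eU Complex.I := by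
  simp only [eU, Prod.smul_mk, Prod.mk_add_mk, smul_zero, add_zero]
  congr 1
  apply Complex.ext <;> simp

variable {F : Type} [NormedAddCommGroup F] [NormedSpace ℝ F] {U : Set (Base (Fin 2))}

theorem dirDeriv_eR_add_twice (hU : IsOpen U) {f : Base (Fin 2) → F} (hf : ContDiffOn ℝ ∞ f U)
    {z : Base (Fin 2)} (hz : z ∈ U) (v : ℂ) :
    dirDeriv (eR + eU v) (dirDeriv (eR + eU v) f) z = dirDeriv eR (dirDeriv eR f) z
      + (2 : ℝ) • dirDeriv eR (dirDeriv (eU v) f) z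
      + dirDeriv (eU v) (dirDeriv (eU v) f) z := by
  have h := dirDeriv_comm hU hf hz eR (eU v)
  rw [dirDeriv_dirDeriv hU hf hz, dirDeriv_dirDeriv hU hf hz] at h
  simp only [dirDeriv_dirDeriv hU hf hz, map_add, add_apply, two_smul, h]
  abel

theorem dirDeriv_eU_sub (f : Base (Fin 2) → F) (v w : ℂ) (z : Base (Fin 2)) :
    dirDeriv (eU (v - w)) f z = dirDeriv (eU v) f z - dirDeriv (eU w) f z := by
  rw [eU_sub]
  exact map_sub _ _ _

theorem dirDeriv_eU_zero (f : Base (Fin 2) → F) (z : Base (Fin 2)) :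
    dirDeriv (eU 0) f z = 0 := map_zero _

theorem dirDeriv_eq_zero_of_eqOn (hU : IsOpen U) {f : Base (Fin 2) → F} {c : F}
    (h : ∀ z ∈ U, f z = c) {z : Base (Fin 2)} (hz : z ∈ U) (v : Base (Fin 2)) :
    dirDeriv v f z = 0 := by
  rw [dirDeriv_congr hU (g := fun _ => c) (fun y hy => h y hy) v hz]
  simp [dirDeriv]

variable {n p k : ℝ} {τ ρ : Base (Fin 2) → ℝ} {η : Base (Fin 2) → ℂ}

/-- The terms of the determining equation with `u_tr`: `τ` depends on `t` only. -/
theorem symmetry_tau (hU : IsOpen U) (hreg : U ⊆ regularDomain)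
    (hX : IsPointSymmetry (radialEq n p k) U fun z => (![τ z, ρ z], η z))
    {z : Base (Fin 2)} (hz : z ∈ U) :
    dirDeriv eR τ z = 0 ∧ ∀ v, dirDeriv (eU v) τ z = 0 := by
  -- the jet coordinate `u_tr` enters only through the coefficient `2 (τ_r + τ_u u_r)`
  have key : ∀ v₁, dirDeriv eR τ z + dirDeriv (eU v₁) τ z = 0 := by
    intro v₁
    have h0 := determining_equation hU hreg hX hz 0 v₁ 0 _ rfl
    have h1 := determining_equation hU hreg hX hz 0 v₁ 1 _ rfl
    rw [← dirDeriv_add_left, ← eR_add, ← Complex.ofReal_eq_zero]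
    linear_combination (h1 - h0) / 2
  have h0 : dirDeriv eR τ z = 0 := by
    simpa [dirDeriv_eU_zero] using key 0
  exact ⟨h0, fun v => by simpa [h0] using key v⟩

theorem symmetry_tau_second (hU : IsOpen U) (hreg : U ⊆ regularDomain)
    (hX : IsPointSymmetry (radialEq n p k) U fun z => (![τ z, ρ z], η z))
    {z : Base (Fin 2)} (hz : z ∈ U) (a : Base (Fin 2)) (v : ℂ) :
    dirDeriv a (dirDeriv (eR + eU v) τ) z = 0 :=
  dirDeriv_eq_zero_of_eqOn hU (c := 0) (fun y hy => by
    have := symmetry_tau hU hreg hX hy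
    rw [dirDeriv_add_left, this.1, this.2, add_zero]) hz a

/-- The terms of the determining equation with `u_t u_r`: `ρ` does not depend on `u`. -/
theorem symmetry_rho (hU : IsOpen U) (hreg : U ⊆ regularDomain)
    (hX : IsPointSymmetry (radialEq n p k) U fun z => (![τ z, ρ z], η z))
    {z : Base (Fin 2)} (hz : z ∈ U) (v : ℂ) : dirDeriv (eU v) ρ z = 0 := by
  have hτ := symmetry_tau hU hreg hX hz
  have hτ2 := symmetry_tau_second hU hreg hX hz
  have h := fun v₀ v₁ => determining_equation hU hreg hX hz v₀ v₁ 0 _ rfl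
  have e0 : ∀ v : ℂ, ((0 : Fin 2 → ℝ), v) = eU v := fun _ => rfl
  simp only [eT_add, eR_add, e0] at h
  simp only [dirDeriv_add_left, hτ.1, hτ.2, hτ2, dirDeriv_eU_sub] at h
  -- the mixed difference in `(u_t, u_r)` isolates the bilinear part
  have h11 := h 1 1
  have h10 := h 1 0
  have h01 := h 0 1
  have h00 := h 0 0
  simp only [mul_zero, dirDeriv_eU_zero, mul_one, add_zero, zero_mul] at h11 h10 h01 h00
  have e : ((dirDeriv (eU Complex.I) ρ z : ℝ) : ℂ)
      + Complex.I * ((dirDeriv (eU 1) ρ z : ℝ) : ℂ) = 0 := by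
    push_cast at h11 h10 h01 h00
    linear_combination h11 - h10 - h01 + h00
  have e1 := congrArg Complex.re e
  have e2 := congrArg Complex.im e
  simp at e1 e2
  rw [eU_eq, dirDeriv_add_left, dirDeriv_smul_left, dirDeriv_smul_left, e1, e2]
  simp

/-- The determining equation after `τ = τ(t)` and `ρ = ρ(t, r)` are known. -/
theorem determining_equation_reduced (hU : IsOpen U) (hreg : U ⊆ regularDomain)
    (hX : IsPointSymmetry (radialEq n p k) U fun z => (![τ z, ρ z], η z))
    {z : Base (Fin 2)} (hz : z ∈ U) (v₀ v₁ : ℂ) :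
    Complex.I * (dirDeriv eT η z + dirDeriv (eU v₀) η z - v₀ * ((dirDeriv eT τ z : ℝ) : ℂ)
        - v₁ * ((dirDeriv eT ρ z : ℝ) : ℂ))
      - (dirDeriv eR (dirDeriv eR η) z + 2 * dirDeriv eR (dirDeriv (eU v₁) η) z
        + dirDeriv (eU v₁) (dirDeriv (eU v₁) η) z
        + dirDeriv (eU (Complex.I * v₀)) η z
        - dirDeriv (eU ((((n - 1) / z.1 1 : ℝ) : ℂ) * v₁)) η z
        - dirDeriv (eU (((k * ‖z.2‖ ^ p : ℝ) : ℂ) * z.2)) η z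
        - v₁ * ((dirDeriv eR (dirDeriv eR ρ) z : ℝ) : ℂ)
        - 2 * (Complex.I * v₀ - (((n - 1) / z.1 1 : ℝ) : ℂ) * v₁
          - ((k * ‖z.2‖ ^ p : ℝ) : ℂ) * z.2) * ((dirDeriv eR ρ z : ℝ) : ℂ))
      + (((n - 1) / z.1 1 ^ 2 * ρ z : ℝ) : ℂ) * v₁
      - (((n - 1) / z.1 1 : ℝ) : ℂ) * (dirDeriv eR η z + dirDeriv (eU v₁) η z
        - v₁ * ((dirDeriv eR ρ z : ℝ) : ℂ))
      - nonlinDeriv k p z.2 (η z) = 0 := by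
  have hη : ContDiffOn ℝ ∞ η U := hX.1.snd
  have hρ : ContDiffOn ℝ ∞ ρ U := (contDiff_apply ℝ ℝ (1 : Fin 2)).comp_contDiffOn hX.1.fst
  have hτ := symmetry_tau hU hreg hX hz
  have hτ2 := symmetry_tau_second hU hreg hX hz
  have hρ1 := symmetry_rho hU hreg hX hz
  have hρ2 : ∀ a v, dirDeriv a (dirDeriv (eU v) ρ) z = 0 := fun a v =>
    dirDeriv_eq_zero_of_eqOn hU (c := 0) (fun y hy => symmetry_rho hU hreg hX hy v) hz a
  have h := determining_equation hU hreg hX hz v₀ v₁ 0 _ rfl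
  simp only [eT_add, eR_add] at h
  have e0 : ∀ v : ℂ, ((0 : Fin 2 → ℝ), v) = eU v := fun _ => rfl
  simp only [hτ2, dirDeriv_eR_add_twice hU hη hz, dirDeriv_eR_add_twice hU hρ hz, e0,
    dirDeriv_add_left, hτ.1, hτ.2, hρ1, hρ2] at h
  simp only [dirDeriv_eU_sub] at h
  rw [← h]
  simp
  ring

end Splitting

/-! ### Splitting with respect to the derivatives of `u`: the coefficient `η` -/

section SplittingEta

theorem dirDeriv_eU_neg {F : Type} [NormedAddCommGroup F] [NormedSpace ℝ F]
    (f : Base (Fin 2) → F) (v : ℂ) (z : Base (Fin 2)) :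
    dirDeriv (eU (-v)) f z = -dirDeriv (eU v) f z := by
  have : eU (-v) = -eU v := by simp [eU]
  rw [this]
  exact map_neg _ _

theorem dirDeriv_const_mul {U : Set (Base (Fin 2))} (hU : IsOpen U) {f : Base (Fin 2) → ℂ}
    (hf : ContDiffOn ℝ ∞ f U) {z : Base (Fin 2)} (hz : z ∈ U) (a : Base (Fin 2)) (c : ℂ) :
    dirDeriv a (fun y => c * f y) z = c * dirDeriv a f z := by
  simp only [dirDeriv]
  rw [fderiv_const_mul (differentiableAt_of_contDiffOn hU hf hz)]
  simp

variable {n p k : ℝ} {U : Set (Base (Fin 2))} {τ ρ : Base (Fin 2) → ℝ} {η : Base (Fin 2) → ℂ}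

/-- The terms of the determining equation with `u_t`: `η` is complex differentiable in `u`, and
the scaling weights of `t` and `r` match. -/
theorem symmetry_eta (hU : IsOpen U) (hreg : U ⊆ regularDomain)
    (hX : IsPointSymmetry (radialEq n p k) U fun z => (![τ z, ρ z], η z))
    {z : Base (Fin 2)} (hz : z ∈ U) :
    dirDeriv eT τ z = 2 * dirDeriv eR ρ z ∧
      ∀ v, dirDeriv (eU v) η z = v * dirDeriv (eU 1) η z := by
  have h := fun v₀ => determining_equation_reduced hU hreg hX hz v₀ 0
  have h0 := h 0
  have h1 := h 1
  have hI := h Complex.I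
  simp only [mul_zero, dirDeriv_eU_zero, mul_one, Complex.I_mul_I, dirDeriv_eU_neg] at h0 h1 hI
  -- `u_t = 1` and `u_t = i` give two relations, whose compatibility forces `τ_t = 2 ρ_r`
  have a1 : dirDeriv (eU Complex.I) η z = Complex.I * (dirDeriv (eU 1) η z
      - (dirDeriv eT τ z : ℝ) + 2 * (dirDeriv eR ρ z : ℝ)) := by
    linear_combination h0 - h1
  have a2 : Complex.I * dirDeriv (eU Complex.I) η z = -dirDeriv (eU 1) η z
      - (dirDeriv eT τ z : ℝ) + 2 * (dirDeriv eR ρ z : ℝ) := by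
    linear_combination (hI - h0) + (dirDeriv eT τ z : ℝ) * Complex.I_sq
  have a3 : ((dirDeriv eT τ z : ℝ) : ℂ) = ((2 * dirDeriv eR ρ z : ℝ) : ℂ) := by
    push_cast
    linear_combination (1 / 2 : ℂ) * (a2 - Complex.I * a1) - (1 / 2 : ℂ) *
      (dirDeriv (eU 1) η z - (dirDeriv eT τ z : ℝ) + 2 * (dirDeriv eR ρ z : ℝ)) * Complex.I_sq
  refine ⟨by exact_mod_cast a3, fun v => ?_⟩
  have a4 : dirDeriv (eU Complex.I) η z = Complex.I * dirDeriv (eU 1) η z := by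
    rw [a1, a3]; push_cast; ring
  rw [eU_eq, dirDeriv_add_left, dirDeriv_smul_left, dirDeriv_smul_left, a4]
  nth_rw 3 [← Complex.re_add_im v]
  simp only [Complex.real_smul]
  ring

/-- The terms of the determining equation with `u_r`, together with the term free of derivatives
of `u`. -/
theorem symmetry_eta_coeff (hU : IsOpen U) (hreg : U ⊆ regularDomain)
    (hX : IsPointSymmetry (radialEq n p k) U fun z => (![τ z, ρ z], η z))
    {z : Base (Fin 2)} (hz : z ∈ U) :
    (∀ v, dirDeriv (eU v) (dirDeriv (eU 1) η) z = 0) ∧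
    2 * dirDeriv eR (dirDeriv (eU 1) η) z = -Complex.I * (dirDeriv eT ρ z : ℝ)
      + ((dirDeriv eR (dirDeriv eR ρ) z - (n - 1) / z.1 1 * dirDeriv eR ρ z
        + (n - 1) / z.1 1 ^ 2 * ρ z : ℝ) : ℂ) ∧
    Complex.I * dirDeriv eT η z - dirDeriv eR (dirDeriv eR η) z
      - (((n - 1) / z.1 1 : ℝ) : ℂ) * dirDeriv eR η z
      + (dirDeriv (eU 1) η z - 2 * (dirDeriv eR ρ z : ℝ)) * (((k * ‖z.2‖ ^ p : ℝ) : ℂ) * z.2)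
      - nonlinDeriv k p z.2 (η z) = 0 := by
  have hη : ContDiffOn ℝ ∞ η U := hX.1.snd
  have hA := contDiffOn_dirDeriv hU hη (eU 1)
  have hu := fun {y} (hy : y ∈ U) => symmetry_eta hU hreg hX hy
  obtain ⟨A, eA⟩ : ∃ A, A = dirDeriv (eU 1) η := ⟨_, rfl⟩
  rw [← eA] at hA hu ⊢
  have e1 : ∀ a v, dirDeriv a (dirDeriv (eU v) η) z = v * dirDeriv a A z := by
    intro a v
    rw [dirDeriv_congr hU (fun y hy => (hu hy).2 v) a hz, dirDeriv_const_mul hU hA hz]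
  have h := fun v₁ => determining_equation_reduced hU hreg hX hz 0 v₁
  have h0 := h 0
  have h1 := h 1
  have h1' := h (-1)
  have hI := h Complex.I
  have hI' := h (-Complex.I)
  simp only [mul_zero, zero_mul, dirDeriv_eU_zero, e1, dirDeriv_eU_neg] at h0 h1 h1' hI hI'
  simp only [(hu hz).2] at h0 h1 h1' hI hI'
  -- the part even in `u_r` is quadratic and gives `A_u = 0`; the odd part gives `A_r`
  have b1 : dirDeriv (eU 1) A z = 0 := by
    linear_combination (-1 / 2 : ℂ) * (h1 + h1' - 2 * h0)
  have b2 : dirDeriv (eU Complex.I) A z = 0 := by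
    have : Complex.I * dirDeriv (eU Complex.I) A z = 0 := by
      linear_combination (-1 / 2 : ℂ) * (hI + hI' - 2 * h0)
    simpa using this
  refine ⟨fun v => ?_, ?_, ?_⟩
  · rw [eU_eq, dirDeriv_add_left, dirDeriv_smul_left, dirDeriv_smul_left, b1, b2]
    simp
  · push_cast at h1 h1' ⊢
    linear_combination (-1 / 2 : ℂ) * (h1 - h1')
  · linear_combination h0

end SplittingEta

/-! ### Independence of the nonlinear terms -/

section Independence

open Filter Topology in
theorem trig_coeff_eq_zero {a b c : ℂ}
    (h : ∀ᶠ θ : ℝ in 𝓝 0, a + b * Complex.exp (Complex.I * θ)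
      + c * Complex.exp (Complex.I * θ) ^ 2 = 0) : b = 0 ∧ c = 0 := by
  have hE : ∀ θ : ℝ, HasDerivAt (fun θ : ℝ => Complex.exp (Complex.I * θ))
      (Complex.exp (Complex.I * θ) * Complex.I) θ := fun θ => by
    simpa using ((Complex.ofRealCLM.hasDerivAt (x := θ)).const_mul Complex.I).cexp
  have h1 : ∀ᶠ θ : ℝ in 𝓝 0, b + 2 * c * Complex.exp (Complex.I * θ) = 0 := by
    filter_upwards [h.eventually_nhds] with θ hθ
    have d1 := (((hE θ).const_mul b).const_add a).add (((hE θ).pow 2).const_mul c)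
    have d2 := (d1.congr_of_eventuallyEq (f₁ := fun _ => (0 : ℂ))
      (hθ.mono fun y hy => by simpa using hy.symm)).unique (hasDerivAt_const _ _)
    have d3 : Complex.exp (Complex.I * θ) * Complex.I *
        (b + 2 * c * Complex.exp (Complex.I * θ)) = 0 := by
      rw [← d2]; push_cast; ring
    simpa [Complex.exp_ne_zero] using d3
  have d1 := ((hE 0).const_mul (2 * c)).const_add b
  have d2 := (d1.congr_of_eventuallyEq (f₁ := fun _ => (0 : ℂ))
      (h1.mono fun y hy => by simpa using hy.symm)).unique (hasDerivAt_const _ _)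
  have hc : c = 0 := by simpa using d2
  refine ⟨?_, hc⟩
  simpa [hc] using h1.self_of_nhds

open Filter Topology in
/-- In a relation between `1`, `u`, `|u|^p u` and a directional derivative of `|u|^p u` that holds
near a point, the last two do not occur: the rotations `u ↦ e^{iθ} u` separate the terms by their
frequency in `θ`, and the dilations of `u` separate `u` from `|u|^p u`. -/
theorem nonlin_independent {k p : ℝ} (hk : k ≠ 0) (hp : p ≠ 0) {u₀ : ℂ} (hu₀ : u₀ ≠ 0)
    {c₀ c₁ c₂ b : ℂ}
    (h : ∀ᶠ u in 𝓝 u₀, c₀ + c₁ * u - c₂ * (((k * ‖u‖ ^ p : ℝ) : ℂ) * u)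
      - nonlinDeriv k p u b = 0) : b = 0 ∧ c₂ = 0 := by
  have key : ∀ᶠ u in 𝓝 u₀, c₁ * u - c₂ * (((k * ‖u‖ ^ p : ℝ) : ℂ) * u) = 0 ∧ b = 0 := by
    filter_upwards [h.eventually_nhds, eventually_ne_nhds hu₀] with u hu hu0
    have hrot : Tendsto (fun θ : ℝ => Complex.exp (Complex.I * θ) * u) (𝓝 0) (𝓝 u) := by
      have : Continuous fun θ : ℝ => Complex.exp (Complex.I * θ) * u := by fun_prop
      simpa using this.tendsto 0
    set K : ℂ := ((k * ‖u‖ ^ p : ℝ) : ℂ) with hK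
    have hK0 : K ≠ 0 := by
      rw [hK, Complex.ofReal_ne_zero]
      exact mul_ne_zero hk (Real.rpow_pos_of_pos (norm_pos_iff.2 hu0) _).ne'
    -- at `e^{iθ} u`, the derivative in the direction `b` has the frequencies `0` and `2`,
    -- the latter with a coefficient proportional to the conjugate of `b`
    have hθ := trig_coeff_eq_zero (a := c₀ - K * b * (1 + p / 2)) (b := c₁ * u - c₂ * (K * u))
      (c := -(K * (p / 2) * (starRingEnd ℂ (b / u) * u)))
      ((hrot.eventually hu).mono fun θ hθ => by
        rw [← hθ]
        have e1 : ‖Complex.exp (Complex.I * θ) * u‖ = ‖u‖ := by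
          rw [norm_mul, mul_comm Complex.I, Complex.norm_exp_ofReal_mul_I, one_mul]
        have e2 : starRingEnd ℂ (Complex.exp (Complex.I * θ))
            * Complex.exp (Complex.I * θ) = 1 := by
          rw [← Complex.exp_conj, ← Complex.exp_add]; simp
        have e3 : (((b / (Complex.exp (Complex.I * θ) * u)).re : ℝ) : ℂ) =
            (b / u * starRingEnd ℂ (Complex.exp (Complex.I * θ))
              + starRingEnd ℂ (b / u) * Complex.exp (Complex.I * θ)) / 2 := by
          have : b / (Complex.exp (Complex.I * θ) * u)
              = b / u * starRingEnd ℂ (Complex.exp (Complex.I * θ)) := by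
            field_simp
            linear_combination (-b) * e2
          rw [Complex.re_eq_add_conj, this]
          simp
        unfold nonlinDeriv
        rw [e1, ← hK]
        push_cast
        rw [e3]
        have e4 : b / u * u = b := div_mul_cancel₀ _ hu0
        linear_combination (K * p / 2 * (b / u * u)) * e2 + (K * p / 2) * e4)
    refine ⟨hθ.1, ?_⟩
    have := hθ.2
    simpa [hK0, hp, hu0] using this
  refine ⟨key.self_of_nhds.2, ?_⟩
  have hscal : Tendsto (fun s : ℝ => (s : ℂ) * u₀) (𝓝 1) (𝓝 u₀) := by
    have : Continuous fun s : ℝ => (s : ℂ) * u₀ := by fun_prop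
    simpa using this.tendsto 1
  have h1 : ∀ᶠ s : ℝ in 𝓝 1, c₁ - c₂ * (((k * ‖u₀‖ ^ p : ℝ) : ℂ) * ((s ^ p : ℝ) : ℂ)) = 0 := by
    filter_upwards [hscal.eventually key, lt_mem_nhds (zero_lt_one (α := ℝ))] with s hs hs0
    have e : ‖(s : ℂ) * u₀‖ ^ p = s ^ p * ‖u₀‖ ^ p := by
      rw [norm_mul, Complex.norm_real, Real.norm_of_nonneg hs0.le,
        Real.mul_rpow hs0.le (norm_nonneg _)]
    have h2 := hs.1
    rw [e] at h2
    have h3 : (s : ℂ) * u₀ ≠ 0 := mul_ne_zero (by exact_mod_cast hs0.ne') hu₀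
    apply mul_right_cancel₀ h3
    rw [zero_mul, ← h2]
    push_cast; ring
  have d0 : HasDerivAt (fun s : ℝ => s ^ p) p 1 := by
    simpa using Real.hasDerivAt_rpow_const (x := 1) (p := p) (Or.inl one_ne_zero)
  have d1 := ((d0.ofReal_comp.const_mul ((k * ‖u₀‖ ^ p : ℝ) : ℂ)).const_mul c₂).const_sub c₁
  have d2 := (d1.congr_of_eventuallyEq (f₁ := fun _ => (0 : ℂ))
      (h1.mono fun y hy => by simpa using hy.symm)).unique (hasDerivAt_const _ _)
  have hn : ‖u₀‖ ^ p ≠ 0 := (Real.rpow_pos_of_pos (norm_pos_iff.2 hu₀) _).ne'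
  simpa [hk, hp, hn] using d2

end Independence

/-! ### Functions that are affine in `u` -/

section FibreAffine

variable {U : Set (Base (Fin 2))}

open Filter Topology in
theorem eventually_const_in_u {F : Type} [NormedAddCommGroup F] [NormedSpace ℝ F]
    (hU : IsOpen U) {f : Base (Fin 2) → F}
    (hf : ContDiffOn ℝ ∞ f U) (h0 : ∀ z ∈ U, ∀ v, dirDeriv (eU v) f z = 0)
    {z : Base (Fin 2)} (hz : z ∈ U) : ∀ᶠ u in 𝓝 z.2, (z.1, u) ∈ U ∧ f (z.1, u) = f z := by
  have hV : IsOpen {u : ℂ | (z.1, u) ∈ U} := hU.preimage (by fun_prop)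
  obtain ⟨ε, hε, hB⟩ := Metric.isOpen_iff.1 hV z.2 hz
  filter_upwards [Metric.ball_mem_nhds z.2 hε] with u hu
  refine ⟨hB hu, ?_⟩
  have hd : ∀ w ∈ Metric.ball z.2 ε, HasFDerivAt (fun u => f (z.1, u))
      ((fderiv ℝ f (z.1, w)).comp (ContinuousLinearMap.inr ℝ (Fin 2 → ℝ) ℂ)) w := fun w hw =>
    (differentiableAt_of_contDiffOn hU hf (hB hw)).hasFDerivAt.comp w
      (hasFDerivAt_prodMk_right z.1 w)
  refine Metric.isOpen_ball.is_const_of_fderiv_eq_zero (𝕜 := ℝ)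
    (convex_ball z.2 ε).isPreconnected (f := fun u => f (z.1, u))
    (fun w hw => (hd w hw).differentiableAt.differentiableWithinAt) (fun w hw => ?_) hu
    (Metric.mem_ball_self hε)
  rw [(hd w hw).fderiv]
  ext1 v
  exact h0 _ (hB hw) v

/-- On `U`, the smooth function `g` is locally affine in the complex variable `u`, with slope `A`;
stated infinitesimally: `g_u = A` is complex linear and `A_u = 0`. -/
def AffineInU (U : Set (Base (Fin 2))) (g A : Base (Fin 2) → ℂ) : Prop :=
  ContDiffOn ℝ ∞ g U ∧ ContDiffOn ℝ ∞ A U ∧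
    ∀ z ∈ U, ∀ v, dirDeriv (eU v) g z = v * A z ∧ dirDeriv (eU v) A z = 0

/-- Derivatives of functions affine in `u` are affine in `u`, as directional derivatives
commute. -/
theorem AffineInU.dirDeriv (hU : IsOpen U) {g A : Base (Fin 2) → ℂ} (h : AffineInU U g A)
    (a : Base (Fin 2)) : AffineInU U (dirDeriv a g) (dirDeriv a A) := by
  refine ⟨contDiffOn_dirDeriv hU h.1 a, contDiffOn_dirDeriv hU h.2.1 a, fun z hz v => ⟨?_, ?_⟩⟩
  · rw [dirDeriv_comm hU h.1 hz, dirDeriv_congr hU (fun y hy => (h.2.2 y hy v).1) a hz,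
      dirDeriv_const_mul hU h.2.1 hz]
  · rw [dirDeriv_comm hU h.2.1 hz,
      dirDeriv_eq_zero_of_eqOn hU (fun y hy => (h.2.2 y hy v).2) hz]

open Filter Topology in
theorem AffineInU.eventually_eq (hU : IsOpen U) {g A : Base (Fin 2) → ℂ} (h : AffineInU U g A)
    {z : Base (Fin 2)} (hz : z ∈ U) :
    ∀ᶠ u in 𝓝 z.2, g (z.1, u) = (g z - A z * z.2) + A z * u := by
  have hA := eventually_const_in_u hU h.2.1 (fun z hz v => (h.2.2 z hz v).2) hz
  have hs : ContDiffOn ℝ ∞ (fun y : Base (Fin 2) => g y - A y * y.2) U :=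
    h.1.sub (h.2.1.mul contDiffOn_snd)
  have hg := eventually_const_in_u hU hs (fun y hy v => by
    have dg := (differentiableAt_of_contDiffOn hU h.1 hy).hasFDerivAt
    have dA := (differentiableAt_of_contDiffOn hU h.2.1 hy).hasFDerivAt
    have d := (dg.sub (dA.mul (hasFDerivAt_snd (𝕜 := ℝ) (p := y)))).fderiv
    have h1 := (h.2.2 y hy v).1
    have h2 := (h.2.2 y hy v).2
    simp only [RadialNLS.dirDeriv] at h1 h2 ⊢
    erw [d]
    have h3 : (eU v).2 = v := rfl
    simp [h1, h2, h3]
    ring) hz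
  filter_upwards [hA, hg] with u h1 h2
  have := h2.2
  simp only [h1.2] at this
  linear_combination this

end FibreAffine

/-! ### Splitting with respect to `u` -/

section FibreLinear

variable {n p k : ℝ} {U : Set (Base (Fin 2))} {τ ρ : Base (Fin 2) → ℝ} {η : Base (Fin 2) → ℂ}

/-- The terms of the determining equation free of derivatives of `u`, split with respect to `u`
itself: `η` is linear in `u`, its slope is a multiple of the rate at which `r` is rescaled,
and the linear part of the equation holds for `η`. -/
theorem symmetry_eta_linear (hk : k ≠ 0) (hp : p ≠ 0) (hU : IsOpen U) (hreg : U ⊆ regularDomain)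
    (hX : IsPointSymmetry (radialEq n p k) U fun z => (![τ z, ρ z], η z))
    {z : Base (Fin 2)} (hz : z ∈ U) :
    η z = dirDeriv (eU 1) η z * z.2 ∧ 2 * dirDeriv eR ρ z + p * (dirDeriv (eU 1) η z).re = 0 ∧
    Complex.I * dirDeriv eT η z - dirDeriv eR (dirDeriv eR η) z
      - (((n - 1) / z.1 1 : ℝ) : ℂ) * dirDeriv eR η z = 0 := by
  have hη : ContDiffOn ℝ ∞ η U := hX.1.snd
  have hρ : ContDiffOn ℝ ∞ ρ U := (contDiff_apply ℝ ℝ (1 : Fin 2)).comp_contDiffOn hX.1.fst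
  have hA := contDiffOn_dirDeriv hU hη (eU 1)
  have hG := fun {y} (hy : y ∈ U) => (symmetry_eta_coeff hU hreg hX hy).2.2
  have haff : AffineInU U η (dirDeriv (eU 1) η) := ⟨hη, hA, fun y hy v =>
    ⟨(symmetry_eta hU hreg hX hy).2 v, (symmetry_eta_coeff hU hreg hX hy).1 v⟩⟩
  have hT := haff.dirDeriv hU eT
  have hR := haff.dirDeriv hU eR
  have hRR := hR.dirDeriv hU eR
  have hρR := eventually_const_in_u hU (contDiffOn_dirDeriv hU hρ eR) (fun y hy v => by
    rw [dirDeriv_comm hU hρ hy,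
      dirDeriv_eq_zero_of_eqOn hU (fun x hx => symmetry_rho hU hreg hX hx v) hy]) hz
  have hAc := eventually_const_in_u hU hA (fun y hy v => (haff.2.2 y hy v).2) hz
  set A := dirDeriv (eU 1) η with eA
  have hu0 : z.2 ≠ 0 := (hreg hz).2
  have hind := nonlin_independent hk hp hu0 (b := η z - A z * z.2)
    (c₂ := ((2 * dirDeriv eR ρ z + p * (A z).re : ℝ) : ℂ))
    (c₀ := Complex.I * (dirDeriv eT η z - dirDeriv eT A z * z.2)
      - (dirDeriv eR (dirDeriv eR η) z - dirDeriv eR (dirDeriv eR A) z * z.2)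
      - (((n - 1) / z.1 1 : ℝ) : ℂ) * (dirDeriv eR η z - dirDeriv eR A z * z.2))
    (c₁ := Complex.I * dirDeriv eT A z - dirDeriv eR (dirDeriv eR A) z
      - (((n - 1) / z.1 1 : ℝ) : ℂ) * dirDeriv eR A z)
    (by
      filter_upwards [haff.eventually_eq hU hz, hT.eventually_eq hU hz, hR.eventually_eq hU hz,
        hRR.eventually_eq hU hz, hρR, hAc, eventually_ne_nhds hu0] with u h1 h2 h3 h4 h5 h6 hu
      have h7 := hG h5.1
      simp only [h1, h2, h3, h4, h5.2, h6.2] at h7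
      rw [← h7]
      have e : ((η z - A z * z.2 + A z * u) / u).re = ((η z - A z * z.2) / u).re + (A z).re := by
        rw [add_div, mul_div_cancel_right₀ _ hu, Complex.add_re]
      simp only [nonlinDeriv, e]
      push_cast
      ring)
  have h1 : η z = A z * z.2 := sub_eq_zero.1 hind.1
  have h2 : 2 * dirDeriv eR ρ z + p * (A z).re = 0 := by exact_mod_cast hind.2
  refine ⟨h1, h2, ?_⟩
  have h3 := hG hz
  have e : (A z * z.2 / z.2).re = (A z).re := by rw [mul_div_cancel_right₀ _ hu0]
  rw [h1] at h3
  simp only [nonlinDeriv, e] at h3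
  have h4 := hind.2
  push_cast at h3 h4
  push_cast
  linear_combination h3 + k * (‖z.2‖ ^ p : ℝ) * z.2 * h4

end FibreLinear

/-! ### Calculus of directional derivatives -/

section Rules

variable {E : Type} [NormedAddCommGroup E] [NormedSpace ℝ E] {z a : E}

theorem dirDeriv_add_fun {F : Type} [NormedAddCommGroup F] [NormedSpace ℝ F]
    {f g : E → F} (hf : DifferentiableAt ℝ f z)
    (hg : DifferentiableAt ℝ g z) :
    dirDeriv a (fun y => f y + g y) z = dirDeriv a f z + dirDeriv a g z := by
  simp [dirDeriv, fderiv_fun_add hf hg]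

theorem dirDeriv_sub_fun {F : Type} [NormedAddCommGroup F] [NormedSpace ℝ F]
    {f g : E → F} (hf : DifferentiableAt ℝ f z)
    (hg : DifferentiableAt ℝ g z) :
    dirDeriv a (fun y => f y - g y) z = dirDeriv a f z - dirDeriv a g z := by
  simp [dirDeriv, fderiv_fun_sub hf hg]

theorem dirDeriv_mul_fun {𝔸 : Type} [NormedCommRing 𝔸] [NormedAlgebra ℝ 𝔸]
    {f g : E → 𝔸} (hf : DifferentiableAt ℝ f z) (hg : DifferentiableAt ℝ g z) :
    dirDeriv a (fun y => f y * g y) z = f z * dirDeriv a g z + g z * dirDeriv a f z := by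
  simp [dirDeriv, fderiv_fun_mul hf hg]

theorem dirDeriv_const_fun {F : Type} [NormedAddCommGroup F] [NormedSpace ℝ F] (c : F) :
    dirDeriv a (fun _ : E => c) z = 0 := by
  simp [dirDeriv]

theorem dirDeriv_clm {F : Type} [NormedAddCommGroup F] [NormedSpace ℝ F] (L : E →L[ℝ] F) :
    dirDeriv a (fun y => L y) z = L a := by
  simp [dirDeriv]

theorem dirDeriv_coord {ι : Type} [Fintype ι] {z a : Base ι} (i : ι) :
    dirDeriv a (fun y : Base ι => y.1 i) z = a.1 i :=
  dirDeriv_clm ((ContinuousLinearMap.proj i).comp (ContinuousLinearMap.fst ℝ (ι → ℝ) ℂ))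

theorem dirDeriv_dependent {ι : Type} [Fintype ι] {z a : Base ι} :
    dirDeriv a (fun y : Base ι => y.2) z = a.2 :=
  dirDeriv_clm (ContinuousLinearMap.snd ℝ (ι → ℝ) ℂ)

theorem differentiableAt_ofReal {f : E → ℝ} (hf : DifferentiableAt ℝ f z) :
    DifferentiableAt ℝ (fun y => (f y : ℂ)) z :=
  Complex.ofRealCLM.differentiableAt.comp z hf

theorem dirDeriv_ofReal {f : E → ℝ} (hf : DifferentiableAt ℝ f z) :
    dirDeriv a (fun y => (f y : ℂ)) z = ((dirDeriv a f z : ℝ) : ℂ) := by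
  have := (Complex.ofRealCLM.hasFDerivAt.comp z hf.hasFDerivAt).fderiv
  simp only [dirDeriv]
  change fderiv ℝ (Complex.ofRealCLM ∘ f) z a = _
  rw [this]
  rfl

theorem dirDeriv_re {f : E → ℂ} (hf : DifferentiableAt ℝ f z) :
    dirDeriv a (fun y => (f y).re) z = (dirDeriv a f z).re := by
  have := (Complex.reCLM.hasFDerivAt.comp z hf.hasFDerivAt).fderiv
  simp only [dirDeriv]
  change fderiv ℝ (Complex.reCLM ∘ f) z a = _
  rw [this]
  rfl

theorem dirDeriv_sum_fun {F : Type} [NormedAddCommGroup F] [NormedSpace ℝ F] {κ : Type}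
    [Fintype κ] {f : κ → E → F} (hf : ∀ i, DifferentiableAt ℝ (f i) z) :
    dirDeriv a (fun y => ∑ i, f i y) z = ∑ i, dirDeriv a (f i) z := by
  simp [dirDeriv, fderiv_fun_sum fun i _ => hf i]

theorem eq_const_of_dirDeriv {F : Type} [NormedAddCommGroup F] [NormedSpace ℝ F]
    {U : Set (Base (Fin 2))} (hU : IsOpen U) (hc : IsConnected U) {f : Base (Fin 2) → F}
    (hf : ContDiffOn ℝ ∞ f U) (hT : ∀ z ∈ U, dirDeriv eT f z = 0)
    (hR : ∀ z ∈ U, dirDeriv eR f z = 0) (hu : ∀ z ∈ U, ∀ v, dirDeriv (eU v) f z = 0) :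
    ∃ c, ∀ z ∈ U, f z = c := by
  obtain ⟨z₀, hz₀⟩ := hc.nonempty
  refine ⟨f z₀, fun z hz => hU.is_const_of_fderiv_eq_zero (𝕜 := ℝ) hc.isPreconnected
    (hf.differentiableOn (by simp)) (fun y hy => ?_) hz hz₀⟩
  refine ContinuousLinearMap.ext fun v => ?_
  have e : v = v.1 0 • eT + (v.1 1 • eR + eU v.2) := by
    refine Prod.ext ?_ ?_
    · funext i
      fin_cases i <;> simp [eT, eR, eU]
    · simp [eT, eR, eU]
  change dirDeriv v f y = 0
  rw [e]
  simp only [dirDeriv_add_left, dirDeriv_smul_left, hT y hy, hR y hy, hu y hy, smul_zero,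
    add_zero]

end Rules

/-! ### Integration of the determining equations -/

section Integration

/-- The general linear combination of `∂/∂t`, the scaling, the inversion and the phase rotation,
with coefficients `a`, `b`, `c`, `φ`; thus `τ = a + 2bt + ct²`, `ρ = τ' r / 2`, and `η` is a
multiple of `u`. -/
def symField (p a b c φ : ℝ) (z : Base (Fin 2)) : Base (Fin 2) :=
  (![a + 2 * b * z.1 0 + c * z.1 0 ^ 2, (b + c * z.1 0) * z.1 1],
    (Complex.I * φ - ((2 * (b + c * z.1 0) / p : ℝ) : ℂ)
      - Complex.I * ((c * z.1 1 ^ 2 / 4 : ℝ) : ℂ)) * z.2)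

theorem symField_eq (p a b c φ : ℝ) :
    symField p a b c φ = φ • Xphas + a • Xtrans + b • Xscal p + c • Xinver p := by
  funext z
  refine Prod.ext ?_ ?_
  · funext i
    fin_cases i <;> simp [symField, Xphas, Xtrans, Xscal, Xinver] <;> ring
  · simp [symField, Xphas, Xtrans, Xscal, Xinver]
    ring

variable {n p k : ℝ} {U : Set (Base (Fin 2))}

/-- Every point symmetry is a combination of the known ones; the inversion can occur only at the
critical power. -/
theorem exists_symField_of_isPointSymmetry (hn : n ≠ 1) (hp : p ≠ 0) (hk : k ≠ 0)
    (hU : IsOpen U) (hc : IsConnected U) (hreg : U ⊆ regularDomain)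
    {X : Base (Fin 2) → Base (Fin 2)} (hX : IsPointSymmetry (radialEq n p k) U X) :
    ∃ a b c φ : ℝ, c * (n * p - 4) = 0 ∧ Set.EqOn X (symField p a b c φ) U := by
  obtain ⟨τ, hτdef⟩ : ∃ τ : Base (Fin 2) → ℝ, τ = fun z => (X z).1 0 := ⟨_, rfl⟩
  obtain ⟨ρ, hρdef⟩ : ∃ ρ : Base (Fin 2) → ℝ, ρ = fun z => (X z).1 1 := ⟨_, rfl⟩
  obtain ⟨η, hηdef⟩ : ∃ η : Base (Fin 2) → ℂ, η = fun z => (X z).2 := ⟨_, rfl⟩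
  have hXe : X = fun z => (![τ z, ρ z], η z) := by
    funext z
    refine Prod.ext ?_ ?_
    · funext i
      fin_cases i <;> simp [hτdef, hρdef]
    · simp [hηdef]
  clear hτdef hρdef hηdef
  subst hXe
  have hη : ContDiffOn ℝ ∞ η U := hX.1.snd
  have hρ : ContDiffOn ℝ ∞ ρ U := (contDiff_apply ℝ ℝ (1 : Fin 2)).comp_contDiffOn hX.1.fst
  have hτ : ContDiffOn ℝ ∞ τ U := (contDiff_apply ℝ ℝ (0 : Fin 2)).comp_contDiffOn hX.1.fst
  have dif : ∀ {F : Type} [NormedAddCommGroup F] [NormedSpace ℝ F] {f : Base (Fin 2) → F},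
      ContDiffOn ℝ ∞ f U → ∀ {z}, z ∈ U → DifferentiableAt ℝ f z :=
    fun hf _ hz => differentiableAt_of_contDiffOn hU hf hz
  have hct : ContDiffOn ℝ ∞ (fun y : Base (Fin 2) => y.1 0) U := by fun_prop
  have hcr : ContDiffOn ℝ ∞ (fun y : Base (Fin 2) => y.1 1) U := by fun_prop
  have hcu : ContDiffOn ℝ ∞ (fun y : Base (Fin 2) => y.2) U := by fun_prop
  have fT0 : eT.1 0 = 1 := by simp [eT]
  have fT1 : eT.1 1 = 0 := by simp [eT]
  have fR0 : eR.1 0 = 0 := by simp [eR]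
  have fR1 : eR.1 1 = 1 := by simp [eR]
  have fU : ∀ v i, (eU v).1 i = 0 := by simp [eU]
  -- the derivatives of `T1 = τ_t` and `T2 = τ_tt` with respect to `r` and `u` vanish
  have τR := fun z (hz : z ∈ U) => (symmetry_tau hU hreg hX hz).1
  have τU := fun z (hz : z ∈ U) => (symmetry_tau hU hreg hX hz).2
  obtain ⟨T1, eT1⟩ : ∃ T1, T1 = dirDeriv eT τ := ⟨_, rfl⟩
  have hT1 : ContDiffOn ℝ ∞ T1 U := eT1 ▸ contDiffOn_dirDeriv hU hτ _
  have T1R : ∀ z ∈ U, dirDeriv eR T1 z = 0 := fun z hz => by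
    rw [eT1, dirDeriv_comm hU hτ hz, dirDeriv_eq_zero_of_eqOn hU τR hz]
  have T1U : ∀ z ∈ U, ∀ v, dirDeriv (eU v) T1 z = 0 := fun z hz v => by
    rw [eT1, dirDeriv_comm hU hτ hz, dirDeriv_eq_zero_of_eqOn hU (fun y hy => τU y hy v) hz]
  obtain ⟨T2, eT2⟩ : ∃ T2, T2 = dirDeriv eT T1 := ⟨_, rfl⟩
  have hT2 : ContDiffOn ℝ ∞ T2 U := eT2 ▸ contDiffOn_dirDeriv hU hT1 _
  have T2R : ∀ z ∈ U, dirDeriv eR T2 z = 0 := fun z hz => by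
    rw [eT2, dirDeriv_comm hU hT1 hz, dirDeriv_eq_zero_of_eqOn hU T1R hz]
  have T2U : ∀ z ∈ U, ∀ v, dirDeriv (eU v) T2 z = 0 := fun z hz v => by
    rw [eT2, dirDeriv_comm hU hT1 hz, dirDeriv_eq_zero_of_eqOn hU (fun y hy => T1U y hy v) hz]
  -- with `A` the slope of `η` in `u`, all derivatives of `ρ` and `A` are expressed by `T1`, `T2`
  have ρR : ∀ z ∈ U, dirDeriv eR ρ z = 1 / 2 * T1 z := fun z hz => by
    have := (symmetry_eta hU hreg hX hz).1
    rw [eT1]; linarith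
  have ρRR : ∀ z ∈ U, dirDeriv eR (dirDeriv eR ρ) z = 0 := fun z hz => by
    rw [dirDeriv_congr hU ρR _ hz, dirDeriv_mul_fun (differentiableAt_const _) (dif hT1 hz),
      T1R z hz, dirDeriv_const_fun]
    simp
  have hco := fun z (hz : z ∈ U) => symmetry_eta_coeff hU hreg hX hz
  have hlin := fun z (hz : z ∈ U) => symmetry_eta_linear hk hp hU hreg hX hz
  have hA := contDiffOn_dirDeriv hU hη (eU 1)
  obtain ⟨A, eA⟩ : ∃ A, A = dirDeriv (eU 1) η := ⟨_, rfl⟩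
  rw [← eA] at hco hlin hA
  have ARe : ∀ z ∈ U, (A z).re = -1 / p * T1 z := fun z hz => by
    have h1 := (hlin z hz).2.1
    rw [ρR z hz] at h1
    field_simp
    linarith
  have dRe : ∀ z ∈ U, ∀ a, (dirDeriv a A z).re = -1 / p * dirDeriv a T1 z := fun z hz a => by
    rw [← dirDeriv_re (dif hA hz), dirDeriv_congr hU ARe a hz,
      dirDeriv_mul_fun (differentiableAt_const _) (dif hT1 hz), dirDeriv_const_fun]
    ring
  -- as `Re A` depends on `t` only, the real part of the equation for `A_r` is
  -- `(n - 1) (ρ / r)_r = 0`; here `n ≠ 1` excludes translations in `r`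
  have hρe : ∀ z ∈ U, ρ z = 1 / 2 * (z.1 1 * T1 z) := fun z hz => by
    have h1 := congrArg Complex.re (hco z hz).2.1
    have h2 := dRe z hz eR
    have hr : 0 < z.1 1 := (hreg hz).1
    rw [T1R z hz, mul_zero] at h2
    rw [ρRR z hz, ρR z hz] at h1
    simp only [Complex.mul_re, Complex.add_re, Complex.neg_re, Complex.neg_im,
      Complex.I_re, Complex.I_im, Complex.ofReal_re, Complex.ofReal_im, h2, Complex.re_ofNat,
      Complex.im_ofNat, mul_zero, zero_mul, neg_zero, sub_zero, zero_add, zero_sub] at h1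
    have h3 : (n - 1) * (ρ z - 1 / 2 * (z.1 1 * T1 z)) = 0 := by
      field_simp at h1
      linarith
    rcases mul_eq_zero.1 h3 with h4 | h4
    · exact absurd (sub_eq_zero.1 h4) hn
    · linarith
  have ρT : ∀ z ∈ U, dirDeriv eT ρ z = 1 / 2 * (z.1 1 * T2 z) := fun z hz => by
    rw [dirDeriv_congr hU hρe _ hz, dirDeriv_mul_fun (differentiableAt_const _)
      ((dif hcr hz).fun_mul (dif hT1 hz)), dirDeriv_mul_fun (dif hcr hz) (dif hT1 hz),
      dirDeriv_coord, dirDeriv_const_fun, fT1, eT2]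
    ring
  have AR : ∀ z ∈ U, dirDeriv eR A z = -Complex.I / 4 * ((z.1 1 * T2 z : ℝ) : ℂ) := fun z hz => by
    have h1 := (hco z hz).2.1
    have hr : 0 < z.1 1 := (hreg hz).1
    have e : dirDeriv eR (dirDeriv eR ρ) z - (n - 1) / z.1 1 * dirDeriv eR ρ z
        + (n - 1) / z.1 1 ^ 2 * ρ z = 0 := by
      rw [ρRR z hz, ρR z hz, hρe z hz]
      field_simp
      ring
    rw [e, ρT z hz] at h1
    push_cast at h1 ⊢
    linear_combination h1 / 2
  have ARR : ∀ z ∈ U, dirDeriv eR (dirDeriv eR A) z = -Complex.I / 4 * (T2 z : ℂ) := fun z hz => by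
    have hd : DifferentiableAt ℝ (fun y : Base (Fin 2) => y.1 1 * T2 y) z :=
      (dif hcr hz).fun_mul (dif hT2 hz)
    rw [dirDeriv_congr hU AR _ hz, dirDeriv_mul_fun (differentiableAt_const _)
      (differentiableAt_ofReal hd), dirDeriv_ofReal hd,
      dirDeriv_mul_fun (dif hcr hz) (dif hT2 hz), dirDeriv_coord, dirDeriv_const_fun, fR1,
      T2R z hz]
    push_cast
    ring
  have ηR : ∀ z ∈ U, dirDeriv eR η z = dirDeriv eR A z * z.2 := fun z hz => by
    rw [dirDeriv_congr hU (fun y hy => (hlin y hy).1) _ hz,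
      dirDeriv_mul_fun (dif hA hz) (dif hcu hz), dirDeriv_dependent]
    simp [eR, mul_comm]
  have ηT : ∀ z ∈ U, dirDeriv eT η z = dirDeriv eT A z * z.2 := fun z hz => by
    rw [dirDeriv_congr hU (fun y hy => (hlin y hy).1) _ hz,
      dirDeriv_mul_fun (dif hA hz) (dif hcu hz), dirDeriv_dependent]
    simp [eT, mul_comm]
  have ηRR : ∀ z ∈ U, dirDeriv eR (dirDeriv eR η) z = dirDeriv eR (dirDeriv eR A) z * z.2 :=
    fun z hz => by
    rw [dirDeriv_congr hU ηR _ hz, dirDeriv_mul_fun (dif (contDiffOn_dirDeriv hU hA _) hz)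
      (dif hcu hz), dirDeriv_dependent]
    simp [eR, mul_comm]
  have AT : ∀ z ∈ U, dirDeriv eT A z = ((-n / 4 * T2 z : ℝ) : ℂ) := fun z hz => by
    have h1 := (hlin z hz).2.2
    have hr : (z.1 1 : ℂ) ≠ 0 := by exact_mod_cast ((hreg hz).1).ne'
    rw [ηT z hz, ηR z hz, ηRR z hz, AR z hz, ARR z hz] at h1
    have h2 : Complex.I * z.2 * (dirDeriv eT A z - ((-n / 4 * T2 z : ℝ) : ℂ)) = 0 := by
      rw [← h1]
      push_cast
      field_simp
      ring
    have h3 := (hreg hz).2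
    simpa [h3, sub_eq_zero] using h2
  -- compatibility `A_rt = A_tr`
  have T2T : ∀ z ∈ U, dirDeriv eT T2 z = 0 := fun z hz => by
    have hd : DifferentiableAt ℝ (fun y : Base (Fin 2) => y.1 1 * T2 y) z :=
      (dif hcr hz).fun_mul (dif hT2 hz)
    have hd' : DifferentiableAt ℝ (fun y : Base (Fin 2) => -n / 4 * T2 y) z :=
      (dif hT2 hz).const_mul _
    have h1 := dirDeriv_comm hU hA hz eT eR
    rw [dirDeriv_congr hU AR _ hz, dirDeriv_congr hU AT _ hz, dirDeriv_mul_fun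
      (differentiableAt_const _) (differentiableAt_ofReal hd),
      dirDeriv_ofReal hd, dirDeriv_ofReal hd',
      dirDeriv_mul_fun (dif hcr hz) (dif hT2 hz), dirDeriv_mul_fun (differentiableAt_const _)
      (dif hT2 hz), dirDeriv_coord, dirDeriv_const_fun, dirDeriv_const_fun, fT1, T2R z hz] at h1
    have hr := ((hreg hz).1).ne'
    simpa [hr] using h1
  -- the two expressions for `Re A_t` agree only if `τ_tt = 0` or the power is critical
  have hcrit : ∀ z ∈ U, T2 z * (n * p - 4) = 0 := fun z hz => by
    have h1 := dRe z hz eT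
    rw [AT z hz, ← eT2, Complex.ofReal_re] at h1
    field_simp at h1
    linarith
  -- on the connected set `U`, the constants of integration of `τ_tt`, `τ_t`, `τ` and `A` are the
  -- coefficients `c`, `b`, `a` and `φ`
  obtain ⟨c', hc'⟩ := eq_const_of_dirDeriv hU hc hT2 T2T T2R T2U
  obtain ⟨c, rfl⟩ : ∃ c, c' = 2 * c := ⟨c' / 2, by ring⟩
  obtain ⟨b', hb'⟩ := eq_const_of_dirDeriv (f := fun y => T1 y - 2 * c * y.1 0) hU hc (by fun_prop)
    (fun z hz => by
      rw [dirDeriv_sub_fun (dif hT1 hz) ((dif hct hz).const_mul _),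
        dirDeriv_mul_fun (differentiableAt_const _) (dif hct hz), dirDeriv_coord,
        dirDeriv_const_fun, fT0, ← eT2, hc' z hz]
      ring)
    (fun z hz => by
      rw [dirDeriv_sub_fun (dif hT1 hz) ((dif hct hz).const_mul _),
        dirDeriv_mul_fun (differentiableAt_const _) (dif hct hz), dirDeriv_coord,
        dirDeriv_const_fun, fR0, T1R z hz]
      ring)
    (fun z hz v => by
      rw [dirDeriv_sub_fun (dif hT1 hz) ((dif hct hz).const_mul _),
        dirDeriv_mul_fun (differentiableAt_const _) (dif hct hz), dirDeriv_coord,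
        dirDeriv_const_fun, fU, T1U z hz]
      ring)
  obtain ⟨b, rfl⟩ : ∃ b, b' = 2 * b := ⟨b' / 2, by ring⟩
  have dpoly : ∀ z a, dirDeriv a (fun y : Base (Fin 2) => 2 * b * y.1 0 + c * (y.1 0 * y.1 0)) z
      = (2 * b + 2 * c * z.1 0) * a.1 0 := fun z a => by
    have h0 : DifferentiableAt ℝ (fun y : Base (Fin 2) => y.1 0) z := by fun_prop
    rw [dirDeriv_add_fun (h0.const_mul _) ((h0.fun_mul h0).const_mul _),
      dirDeriv_mul_fun (differentiableAt_const _) h0,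
      dirDeriv_mul_fun (differentiableAt_const _) (h0.fun_mul h0), dirDeriv_mul_fun h0 h0,
      dirDeriv_coord, dirDeriv_const_fun, dirDeriv_const_fun]
    ring
  obtain ⟨a, ha⟩ := eq_const_of_dirDeriv
    (f := fun y => τ y - (2 * b * y.1 0 + c * (y.1 0 * y.1 0))) hU hc (by fun_prop)
    (fun z hz => by
      rw [dirDeriv_sub_fun (dif hτ hz) (by fun_prop), dpoly, fT0, ← eT1]
      have := hb' z hz
      linarith)
    (fun z hz => by rw [dirDeriv_sub_fun (dif hτ hz) (by fun_prop), dpoly, fR0, τR z hz]; ring)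
    (fun z hz v => by rw [dirDeriv_sub_fun (dif hτ hz) (by fun_prop), dpoly, fU, τU z hz]; ring)
  have dquad : ∀ z a, dirDeriv a (fun y : Base (Fin 2) =>
      ((2 * c / p * y.1 0 : ℝ) : ℂ) + Complex.I * ((c / 4 * (y.1 1 * y.1 1) : ℝ) : ℂ)) z
      = ((2 * c / p * a.1 0 : ℝ) : ℂ) + Complex.I * ((c / 2 * z.1 1 * a.1 1 : ℝ) : ℂ) :=
    fun z a => by
    have h0 : DifferentiableAt ℝ (fun y : Base (Fin 2) => y.1 0) z := by fun_prop
    have h1 : DifferentiableAt ℝ (fun y : Base (Fin 2) => y.1 1) z := by fun_prop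
    have g0 := h0.const_mul (2 * c / p)
    have g1 := (h1.fun_mul h1).const_mul (c / 4)
    have g0' := differentiableAt_ofReal g0
    have g1' := differentiableAt_ofReal g1
    rw [dirDeriv_add_fun g0' (g1'.const_mul _), dirDeriv_mul_fun (differentiableAt_const _) g1',
      dirDeriv_ofReal g0, dirDeriv_ofReal g1, dirDeriv_mul_fun (differentiableAt_const _) h0,
      dirDeriv_mul_fun (differentiableAt_const _) (h1.fun_mul h1), dirDeriv_mul_fun h1 h1,
      dirDeriv_coord, dirDeriv_coord, dirDeriv_const_fun, dirDeriv_const_fun, dirDeriv_const_fun]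
    push_cast
    ring
  have hcq : ContDiffOn ℝ ∞ (fun y : Base (Fin 2) =>
      ((2 * c / p * y.1 0 : ℝ) : ℂ) + Complex.I * ((c / 4 * (y.1 1 * y.1 1) : ℝ) : ℂ)) U := by
    have h1 := Complex.ofRealCLM.contDiff.comp_contDiffOn (n := ∞)
      (contDiffOn_const (c := 2 * c / p) |>.mul hct)
    have h2 := Complex.ofRealCLM.contDiff.comp_contDiffOn (n := ∞)
      (contDiffOn_const (c := c / 4) |>.mul (hcr.mul hcr))
    exact h1.add (contDiffOn_const.mul h2)
  obtain ⟨z₀, hz₀⟩ := hc.nonempty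
  have hcc : c * (n * p - 4) = 0 := by
    have := hcrit z₀ hz₀
    rw [hc' z₀ hz₀] at this
    linarith
  obtain ⟨K, hK⟩ := eq_const_of_dirDeriv
    (f := fun y => A y + (((2 * c / p * y.1 0 : ℝ) : ℂ)
      + Complex.I * ((c / 4 * (y.1 1 * y.1 1) : ℝ) : ℂ))) hU hc (hA.add hcq)
    (fun z hz => by
      rw [dirDeriv_add_fun (dif hA hz) (dif hcq hz), dquad, fT0, fT1, AT z hz, hc' z hz]
      have : -n / 4 * (2 * c) + 2 * c / p = 0 := by
        field_simp
        linarith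
      rw [mul_zero, mul_one, Complex.ofReal_zero, mul_zero, add_zero, ← Complex.ofReal_add, this,
        Complex.ofReal_zero])
    (fun z hz => by
      rw [dirDeriv_add_fun (dif hA hz) (dif hcq hz), dquad, fR0, fR1, AR z hz, hc' z hz]
      push_cast
      ring)
    (fun z hz v => by
      rw [dirDeriv_add_fun (dif hA hz) (dif hcq hz), dquad, fU, fU, (hco z hz).1]
      simp)
  have hA' : ∀ z ∈ U, A z = K - (((2 * c / p * z.1 0 : ℝ) : ℂ)
      + Complex.I * ((c / 4 * (z.1 1 * z.1 1) : ℝ) : ℂ)) := fun z hz => by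
    rw [← hK z hz]; ring
  have hT1' : ∀ z ∈ U, T1 z = 2 * b + 2 * c * z.1 0 := fun z hz => by
    have := hb' z hz
    linarith
  have hKre : K.re = -(2 * b / p) := by
    have h1 := ARe z₀ hz₀
    rw [hA' z₀ hz₀, hT1' z₀ hz₀] at h1
    simp only [Complex.sub_re, Complex.add_re, Complex.ofReal_re, Complex.mul_re, Complex.I_re,
      Complex.I_im, Complex.ofReal_im] at h1
    field_simp at h1 ⊢
    linarith
  refine ⟨a, b, c, K.im, hcc, fun z hz => ?_⟩
  have hτ' := ha z hz
  refine Prod.ext ?_ ?_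
  · funext i
    fin_cases i
    · simp [symField]
      linarith
    · simp [symField, hρe z hz, hT1' z hz]
      ring
  · simp only [symField]
    have hKe : K = ((-(2 * b / p) : ℝ) : ℂ) + K.im * Complex.I := by
      rw [← hKre, Complex.re_add_im]
    rw [(hlin z hz).1, hA' z hz]
    generalize K.im = φ at hKe
    rw [hKe]
    push_cast
    ring

end Integration

/-! ### The symmetries in `d` space dimensions and their prolongation -/

section GeneralDimension

variable {d : ℕ} {p k a b c φ : ℝ}

/-- The slope in `u` of the symmetry with coefficients `b`, `c`, `φ` in `d` space dimensions. -/
def slope (d : ℕ) (p b c φ : ℝ) (z : Base (Fin (d + 1))) : ℂ :=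
  Complex.I * φ - ((2 * (b + c * z.1 0) / p : ℝ) : ℂ)
    - Complex.I * ((c * (∑ i : Fin d, z.1 i.succ ^ 2) / 4 : ℝ) : ℂ)

/-- The combination of `∂/∂t`, the scaling, the inversion and the phase rotation with
coefficients `a`, `b`, `c`, `φ`, in `d` space dimensions; for `d = 1` it is `symField`. -/
def symFieldD (d : ℕ) (p a b c φ : ℝ) (z : Base (Fin (d + 1))) : Base (Fin (d + 1)) :=
  (Fin.cons (a + 2 * b * z.1 0 + c * z.1 0 ^ 2) fun i => (b + c * z.1 0) * z.1 i.succ,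
    slope d p b c φ z * z.2)

theorem symFieldD_one : symFieldD 1 p a b c φ = symField p a b c φ := by
  funext z
  refine Prod.ext ?_ ?_
  · funext i
    fin_cases i <;> simp [symFieldD, symField]
  · simp [symFieldD, symField, slope]

theorem contDiff_slope : ContDiff ℝ ∞ (slope d p b c φ) := by
  have h1 : ContDiff ℝ ∞ fun z : Base (Fin (d + 1)) => 2 * (b + c * z.1 0) / p := by fun_prop
  have h2 : ContDiff ℝ ∞ fun z : Base (Fin (d + 1)) => c * (∑ i : Fin d, z.1 i.succ ^ 2) / 4 := by
    fun_prop
  exact (contDiff_const.sub (Complex.ofRealCLM.contDiff.comp h1)).sub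
    (contDiff_const.mul (Complex.ofRealCLM.contDiff.comp h2))

theorem contDiff_symFieldD : ContDiff ℝ ∞ (symFieldD d p a b c φ) := by
  refine ContDiff.prodMk (contDiff_pi.2 fun l => ?_) (contDiff_slope.mul contDiff_snd)
  refine Fin.cases ?_ (fun i => ?_) l
  · simp only [Fin.cons_zero]; fun_prop
  · simp only [Fin.cons_succ]; fun_prop

theorem dirDeriv_slope (v z : Base (Fin (d + 1))) :
    dirDeriv v (slope d p b c φ) z = -((2 * c / p * v.1 0 : ℝ) : ℂ)
      - Complex.I * ((c / 2 * ∑ i : Fin d, z.1 i.succ * v.1 i.succ : ℝ) : ℂ) := by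
  have hx : ∀ l, DifferentiableAt ℝ (fun y : Base (Fin (d + 1)) => y.1 l) z := fun l => by fun_prop
  have e : slope d p b c φ = fun z => (Complex.I * φ - ((2 * b / p + 2 * c / p * z.1 0 : ℝ) : ℂ))
      - Complex.I * ((c / 4 * ∑ i : Fin d, z.1 i.succ * z.1 i.succ : ℝ) : ℂ) := by
    funext z
    simp only [slope, pow_two]
    congr 3
    · ring
    · ring
  have h0 : DifferentiableAt ℝ (fun y : Base (Fin (d + 1)) => 2 * c / p * y.1 0) z :=
    (hx 0).const_mul _
  have h1 : DifferentiableAt ℝ (fun y : Base (Fin (d + 1)) => 2 * b / p + 2 * c / p * y.1 0) z :=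
    h0.const_add _
  have h2 : DifferentiableAt ℝ
      (fun y : Base (Fin (d + 1)) => ∑ i : Fin d, y.1 i.succ * y.1 i.succ) z := by fun_prop
  have h3 : DifferentiableAt ℝ
      (fun y : Base (Fin (d + 1)) => c / 4 * ∑ i : Fin d, y.1 i.succ * y.1 i.succ) z :=
    h2.const_mul _
  rw [e, dirDeriv_sub_fun ((differentiableAt_ofReal h1).const_sub _)
      ((differentiableAt_ofReal h3).const_mul _),
    dirDeriv_sub_fun (differentiableAt_const _) (differentiableAt_ofReal h1),
    dirDeriv_mul_fun (differentiableAt_const _) (differentiableAt_ofReal h3),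
    dirDeriv_ofReal h1, dirDeriv_ofReal h3, dirDeriv_add_fun (differentiableAt_const _) h0,
    dirDeriv_mul_fun (differentiableAt_const _) (hx 0),
    dirDeriv_mul_fun (differentiableAt_const _) h2,
    dirDeriv_sum_fun (fun i => (hx _).fun_mul (hx _))]
  simp only [dirDeriv_mul_fun (hx _) (hx _), dirDeriv_coord, dirDeriv_const_fun, ← two_mul,
    ← Finset.mul_sum]
  push_cast
  ring

theorem dirDeriv_symFieldD_snd (v z : Base (Fin (d + 1))) :
    dirDeriv v (fun z => (symFieldD d p a b c φ z).2) z
      = slope d p b c φ z * v.2 + z.2 * dirDeriv v (slope d p b c φ) z := by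
  have h : DifferentiableAt ℝ (slope d p b c φ) z := contDiff_slope.differentiable (by simp) z
  exact (dirDeriv_mul_fun h differentiableAt_snd).trans (by rw [dirDeriv_dependent])

theorem dirDeriv_symFieldD_zero (v z : Base (Fin (d + 1))) :
    dirDeriv v (fun z => (symFieldD d p a b c φ z).1 0) z = 2 * (b + c * z.1 0) * v.1 0 := by
  have hx : DifferentiableAt ℝ (fun y : Base (Fin (d + 1)) => y.1 0) z := by fun_prop
  simp only [symFieldD, Fin.cons_zero, pow_two]
  rw [dirDeriv_add_fun (by fun_prop) (by fun_prop), dirDeriv_add_fun (by fun_prop) (by fun_prop),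
    dirDeriv_const_fun, dirDeriv_mul_fun (by fun_prop) hx, dirDeriv_const_fun,
    dirDeriv_mul_fun (by fun_prop) (hx.fun_mul hx), dirDeriv_const_fun, dirDeriv_mul_fun hx hx,
    dirDeriv_coord]
  ring

theorem dirDeriv_symFieldD_succ (i : Fin d) (v z : Base (Fin (d + 1))) :
    dirDeriv v (fun z => (symFieldD d p a b c φ z).1 i.succ) z
      = (b + c * z.1 0) * v.1 i.succ + z.1 i.succ * (c * v.1 0) := by
  simp only [symFieldD, Fin.cons_succ]
  rw [dirDeriv_mul_fun (by fun_prop) (by fun_prop), dirDeriv_add_fun (by fun_prop) (by fun_prop),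
    dirDeriv_mul_fun (by fun_prop) (by fun_prop), dirDeriv_coord, dirDeriv_coord,
    dirDeriv_const_fun, dirDeriv_const_fun]
  ring

theorem prolongCoeff1_symFieldD_zero (J : Jet1 (Fin (d + 1))) :
    prolongCoeff1 (symFieldD d p a b c φ) 0 J =
      (slope d p b c φ J.1 - 2 * ((b + c * J.1.1 0 : ℝ) : ℂ)) * J.2 0
        - ((2 * c / p : ℝ) : ℂ) * J.1.2 - c * ∑ i : Fin d, J.2 i.succ * (J.1.1 i.succ : ℂ) := by
  unfold prolongCoeff1 totalD
  have e1 := dirDeriv_symFieldD_snd (p := p) (a := a) (b := b) (c := c) (φ := φ)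
    (Pi.single 0 1, J.2 0) J.1
  have e2 := dirDeriv_symFieldD_zero (p := p) (a := a) (b := b) (c := c) (φ := φ)
    (Pi.single 0 1, J.2 0) J.1
  have e3 := fun i => dirDeriv_symFieldD_succ (p := p) (a := a) (b := b) (c := c) (φ := φ) i
    (Pi.single 0 1, J.2 0) J.1
  rw [dirDeriv_slope] at e1
  simp only [dirDeriv] at e1 e2 e3
  rw [e1, Fin.sum_univ_succ, e2]
  simp only [e3, Pi.single_eq_same, Pi.single_eq_of_ne (Fin.succ_ne_zero _), mul_zero, mul_one,
    zero_add, Finset.sum_const_zero, Complex.ofReal_zero, sub_zero, Complex.ofReal_mul,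
    Finset.mul_sum]
  have : ∀ i : Fin d, J.2 i.succ * ((J.1.1 i.succ : ℂ) * (c : ℂ))
      = (c : ℂ) * (J.2 i.succ * (J.1.1 i.succ : ℂ)) := fun i => by ring
  simp only [this]
  push_cast
  ring

theorem prolongCoeff1_symFieldD_succ (i : Fin d) (J : Jet1 (Fin (d + 1))) :
    prolongCoeff1 (symFieldD d p a b c φ) i.succ J =
      (slope d p b c φ J.1 - ((b + c * J.1.1 0 : ℝ) : ℂ)) * J.2 i.succ
        - Complex.I * ((c / 2 * J.1.1 i.succ : ℝ) : ℂ) * J.1.2 := by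
  unfold prolongCoeff1 totalD
  have e1 := dirDeriv_symFieldD_snd (p := p) (a := a) (b := b) (c := c) (φ := φ)
    (Pi.single i.succ 1, J.2 i.succ) J.1
  have e2 := dirDeriv_symFieldD_zero (p := p) (a := a) (b := b) (c := c) (φ := φ)
    (Pi.single i.succ 1, J.2 i.succ) J.1
  have e3 := fun l => dirDeriv_symFieldD_succ (p := p) (a := a) (b := b) (c := c) (φ := φ) l
    (Pi.single i.succ 1, J.2 i.succ) J.1
  rw [dirDeriv_slope] at e1
  simp only [dirDeriv] at e1 e2 e3
  rw [e1, Fin.sum_univ_succ, e2]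
  simp only [e3, Pi.single_eq_of_ne (Fin.succ_ne_zero i).symm]
  simp [Pi.single_apply, apply_ite]
  ring

theorem prolongCoeff2_symFieldD_succ (i : Fin d) (J : Jet2 (Fin (d + 1))) :
    prolongCoeff2 (symFieldD d p a b c φ) i.succ i.succ J =
      (slope d p b c φ J.1.1 - 2 * ((b + c * J.1.1.1 0 : ℝ) : ℂ)) * J.2 i.succ i.succ
        - Complex.I * ((c * J.1.1.1 i.succ : ℝ) : ℂ) * J.1.2 i.succ
        - Complex.I * ((c / 2 : ℝ) : ℂ) * J.1.1.2 := by
  unfold prolongCoeff2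
  have e2 := dirDeriv_symFieldD_zero (p := p) (a := a) (b := b) (c := c) (φ := φ)
    (Pi.single i.succ 1, J.1.2 i.succ) J.1.1
  have e3 := fun l => dirDeriv_symFieldD_succ (p := p) (a := a) (b := b) (c := c) (φ := φ) l
    (Pi.single i.succ 1, J.1.2 i.succ) J.1.1
  have e1 : totalD1 (prolongCoeff1 (symFieldD d p a b c φ) i.succ) i.succ J =
      (slope d p b c φ J.1.1 - ((b + c * J.1.1.1 0 : ℝ) : ℂ)) * J.2 i.succ i.succ
        + J.1.2 i.succ * (-(Complex.I * ((c / 2 * J.1.1.1 i.succ : ℝ) : ℂ)))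
        - (Complex.I * ((c / 2 * J.1.1.1 i.succ : ℝ) : ℂ) * J.1.2 i.succ
          + J.1.1.2 * (Complex.I * ((c / 2 : ℝ) : ℂ))) := by
    have e : prolongCoeff1 (symFieldD d p a b c φ) i.succ = fun J => _ :=
      funext (prolongCoeff1_symFieldD_succ i)
    rw [e]
    change dirDeriv ((Pi.single i.succ 1, J.1.2 i.succ), J.2 i.succ) _ J.1 = _
    have hs : DifferentiableAt ℝ (fun J : Jet1 (Fin (d + 1)) => slope d p b c φ J.1) J.1 :=
      (contDiff_slope.comp contDiff_fst).differentiable (n := ∞) (by simp) _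
    have ds : ∀ v, dirDeriv v (fun J : Jet1 (Fin (d + 1)) => slope d p b c φ J.1) J.1
        = dirDeriv v.1 (slope d p b c φ) J.1.1 := fun v => by
      have := (((contDiff_slope (d := d) (p := p) (b := b) (c := c) (φ := φ)).differentiable
        (by simp) J.1.1).hasFDerivAt.comp J.1 hasFDerivAt_fst).fderiv
      change fderiv ℝ (slope d p b c φ ∘ Prod.fst) J.1 v = _
      rw [this]
      rfl
    have hb : DifferentiableAt ℝ (fun J : Jet1 (Fin (d + 1)) => b + c * J.1.1 0) J.1 := by
      fun_prop
    have hi : DifferentiableAt ℝ (fun J : Jet1 (Fin (d + 1)) => c / 2 * J.1.1 i.succ) J.1 := by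
      fun_prop
    have dx : ∀ (l : Fin (d + 1)) (v : Jet1 (Fin (d + 1))),
        dirDeriv v (fun J : Jet1 (Fin (d + 1)) => J.1.1 l) J.1 = v.1.1 l := fun l v =>
      dirDeriv_clm ((ContinuousLinearMap.proj l).comp ((ContinuousLinearMap.fst ℝ _ ℂ).comp
        (ContinuousLinearMap.fst ℝ (Base (Fin (d + 1))) (Fin (d + 1) → ℂ))))
    have du : ∀ v : Jet1 (Fin (d + 1)),
        dirDeriv v (fun J : Jet1 (Fin (d + 1)) => J.1.2) J.1 = v.1.2 := fun v =>
      dirDeriv_clm ((ContinuousLinearMap.snd ℝ _ ℂ).comp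
        (ContinuousLinearMap.fst ℝ (Base (Fin (d + 1))) (Fin (d + 1) → ℂ)))
    have dv : ∀ (l : Fin (d + 1)) (v : Jet1 (Fin (d + 1))),
        dirDeriv v (fun J : Jet1 (Fin (d + 1)) => J.2 l) J.1 = v.2 l := fun l v =>
      dirDeriv_clm ((ContinuousLinearMap.proj l).comp
        (ContinuousLinearMap.snd ℝ (Base (Fin (d + 1))) (Fin (d + 1) → ℂ)))
    have hb' := differentiableAt_ofReal hb
    have hi' := differentiableAt_ofReal hi
    rw [dirDeriv_sub_fun ((hs.fun_sub hb').fun_mul (by fun_prop))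
        ((hi'.const_mul _).fun_mul (by fun_prop)),
      dirDeriv_mul_fun (hs.fun_sub hb') (by fun_prop), dirDeriv_sub_fun hs hb',
      dirDeriv_mul_fun (hi'.const_mul _) (by fun_prop),
      dirDeriv_mul_fun (differentiableAt_const _) hi', dirDeriv_ofReal hb, dirDeriv_ofReal hi,
      dirDeriv_add_fun (by fun_prop) (by fun_prop),
      dirDeriv_mul_fun (by fun_prop) (by fun_prop), dirDeriv_mul_fun (by fun_prop) (by fun_prop),
      ds, dx, dx, du, dv, dirDeriv_slope, dirDeriv_const_fun, dirDeriv_const_fun,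
      dirDeriv_const_fun, dirDeriv_const_fun]
    simp [Pi.single_apply]
  rw [e1, Fin.sum_univ_succ]
  simp only [totalD]
  simp only [dirDeriv] at e2 e3
  rw [e2]
  simp only [e3, Pi.single_eq_of_ne (Fin.succ_ne_zero i).symm]
  simp [Pi.single_apply, apply_ite]
  ring

end GeneralDimension

/-! ### The known fields are symmetries -/

section Sufficiency

variable {n p k a b c φ : ℝ}

/-- The real part of the slope is `-2 (b + c t) / p`, which is what makes the nonlinear term scale
like the second derivatives. -/
theorem nonlinDeriv_slope (hp : p ≠ 0) {d : ℕ} {z : Base (Fin (d + 1))} (hu : z.2 ≠ 0) :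
    nonlinDeriv k p z.2 (slope d p b c φ z * z.2) =
      (slope d p b c φ z - 2 * ((b + c * z.1 0 : ℝ) : ℂ)) *
        (((k * ‖z.2‖ ^ p : ℝ) : ℂ) * z.2) := by
  have e : p * (slope d p b c φ z * z.2 / z.2).re = -(2 * (b + c * z.1 0)) := by
    rw [mul_div_cancel_right₀ _ hu]
    simp only [slope, Complex.sub_re, Complex.mul_re, Complex.ofReal_re, Complex.ofReal_im,
      Complex.I_re, Complex.I_im]
    field_simp
    ring
  rw [nonlinDeriv, e]
  push_cast
  ring

theorem fderiv_nlsEq (d : ℕ) (p k : ℝ) (j w : Jet2 (Fin (d + 1))) (hu : j.1.1.2 ≠ 0) :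
    fderiv ℝ (nlsEq d p k) j w = Complex.I * w.1.2 0 - ∑ i : Fin d, w.2 i.succ i.succ
      - nonlinDeriv k p j.1.1.2 w.1.1.2 := by
  obtain ⟨L, hL, eL⟩ := hasFDerivAt_nonlin k p hu
  let π1 : Jet2 (Fin (d + 1)) →L[ℝ] Jet1 (Fin (d + 1)) := ContinuousLinearMap.fst ℝ _ _
  let π2 : Jet2 (Fin (d + 1)) →L[ℝ] (Fin (d + 1) → Fin (d + 1) → ℂ) :=
    ContinuousLinearMap.snd ℝ _ _
  let v : Jet2 (Fin (d + 1)) →L[ℝ] ℂ :=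
    (ContinuousLinearMap.proj 0).comp ((ContinuousLinearMap.snd ℝ _ _).comp π1)
  let πu : Jet2 (Fin (d + 1)) →L[ℝ] ℂ :=
    (ContinuousLinearMap.snd ℝ _ _).comp ((ContinuousLinearMap.fst ℝ _ _).comp π1)
  let w2 : Fin (d + 1) → Jet2 (Fin (d + 1)) →L[ℝ] ℂ := fun i =>
    (ContinuousLinearMap.proj i).comp ((ContinuousLinearMap.proj (R := ℝ)
      (φ := fun _ : Fin (d + 1) => Fin (d + 1) → ℂ) i).comp π2)
  have hN : HasFDerivAt (fun J : Jet2 (Fin (d + 1)) => ((k * ‖J.1.1.2‖ ^ p : ℝ) : ℂ) * J.1.1.2)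
      (L.comp πu) j := HasFDerivAt.comp j (f := πu) hL πu.hasFDerivAt
  have h := (((v.hasFDerivAt (x := j)).const_mul Complex.I).sub
    (HasFDerivAt.fun_sum (u := Finset.univ)
      fun (i : Fin d) _ => (w2 i.succ).hasFDerivAt (x := j))).sub hN
  have e : fderiv ℝ (nlsEq d p k) j = _ := HasFDerivAt.fderiv h
  rw [e]
  simp [eL, v, w2, πu, π1, π2]

/-- The combinations of the known fields are point symmetries of the radial equation, the
inversion being admitted at the critical power only. -/
theorem isPointSymmetry_symField (hp : p ≠ 0) (hc : c * (n * p - 4) = 0)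
    {U : Set (Base (Fin 2))} (hreg : U ⊆ regularDomain) :
    IsPointSymmetry (radialEq n p k) U (symField p a b c φ) := by
  rw [← symFieldD_one]
  refine ⟨contDiff_symFieldD.contDiffOn, fun j hj _ hE => ?_⟩
  have hr : (j.1.1.1 1 : ℂ) ≠ 0 := by exact_mod_cast (hreg hj).1.ne'
  rw [fderiv_radialEq n p k _ _ (hreg hj).1 (hreg hj).2]
  have h0 := prolongCoeff1_symFieldD_zero (p := p) (a := a) (b := b) (c := c) (φ := φ) j.1
  have h1 := prolongCoeff1_symFieldD_succ (p := p) (a := a) (b := b) (c := c) (φ := φ) 0 j.1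
  have h2 := prolongCoeff2_symFieldD_succ (p := p) (a := a) (b := b) (c := c) (φ := φ) 0 j
  simp only [Finset.univ_unique, Finset.sum_singleton, Fin.default_eq_zero, Fin.succ_zero_eq_one,
    Fin.isValue] at h0 h1 h2
  have h3 : (symFieldD 1 p a b c φ j.1.1).1 1 = (b + c * j.1.1.1 0) * j.1.1.1 1 := rfl
  simp only [prolong]
  rw [h0, h1, h2, h3]
  change _ - nonlinDeriv k p j.1.1.2 (slope 1 p b c φ j.1.1 * j.1.1.2) = 0
  rw [nonlinDeriv_slope hp (hreg hj).2]
  unfold radialEq at hE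
  have hc' : (c : ℂ) * (n * p - 4) = 0 := by exact_mod_cast hc
  have hp' : (p : ℂ) ≠ 0 := by exact_mod_cast hp
  have hc2 : (c : ℂ) * n / 2 - 2 * c / p = 0 := by
    field_simp
    linear_combination hc'
  push_cast at hE ⊢
  have e1 : ((n : ℂ) - 1) / (j.1.1.1 1 : ℂ) * (c / 2 * (j.1.1.1 1 : ℂ)) = (n - 1) * (c / 2) := by
    field_simp
  have e2 : ((n : ℂ) - 1) / (j.1.1.1 1 : ℂ) ^ 2 * ((b + c * (j.1.1.1 0 : ℂ)) * (j.1.1.1 1 : ℂ))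
      = (n - 1) / (j.1.1.1 1 : ℂ) * (b + c * (j.1.1.1 0 : ℂ)) := by
    field_simp
  linear_combination (slope 1 p b c φ j.1.1 - 2 * (b + c * (j.1.1.1 0 : ℂ))) * hE
    + Complex.I * j.1.1.2 * hc2 + j.1.2 1 * e2 + Complex.I * j.1.1.2 * e1

theorem isPointSymmetry_symFieldD {d : ℕ} (hp : p ≠ 0) (hc : c * (d * p - 4) = 0)
    {V : Set (Base (Fin (d + 1)))} (hV : ∀ z ∈ V, z.2 ≠ 0) :
    IsPointSymmetry (nlsEq d p k) V (symFieldD d p a b c φ) := by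
  refine ⟨contDiff_symFieldD.contDiffOn, fun j hj _ hE => ?_⟩
  rw [fderiv_nlsEq _ _ _ _ _ (hV _ hj)]
  simp only [prolong, prolongCoeff1_symFieldD_zero, prolongCoeff2_symFieldD_succ]
  change _ - nonlinDeriv k p j.1.1.2 (slope d p b c φ j.1.1 * j.1.1.2) = 0
  rw [nonlinDeriv_slope hp (hV _ hj)]
  unfold nlsEq at hE
  have hc' : (c : ℂ) * (d * p - 4) = 0 := by exact_mod_cast hc
  have hp' : (p : ℂ) ≠ 0 := by exact_mod_cast hp
  have hc2 : (c : ℂ) * d / 2 - 2 * c / p = 0 := by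
    field_simp
    linear_combination hc'
  have es : ∑ i : Fin d, Complex.I * ((c * j.1.1.1 i.succ : ℝ) : ℂ) * j.1.2 i.succ
      = Complex.I * c * ∑ i : Fin d, j.1.2 i.succ * (j.1.1.1 i.succ : ℂ) := by
    rw [Finset.mul_sum]
    refine Finset.sum_congr rfl fun i _ => ?_
    push_cast
    ring
  rw [Finset.sum_sub_distrib, Finset.sum_sub_distrib, ← Finset.mul_sum, es, Finset.sum_const,
    Finset.card_univ, Fintype.card_fin, nsmul_eq_mul]
  push_cast at hE ⊢
  linear_combination (slope d p b c φ j.1.1 - 2 * (b + c * (j.1.1.1 0 : ℂ))) * hE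
    + Complex.I * j.1.1.2 * hc2

/-- The prolongation depends only on the germ of the field. -/
theorem isPointSymmetry_congr {ι : Type} [Fintype ι] [DecidableEq ι] {E : Jet2 ι → ℂ}
    {U : Set (Base ι)} (hU : IsOpen U) {X Y : Base ι → Base ι} (h : Set.EqOn X Y U)
    (hY : IsPointSymmetry E U Y) : IsPointSymmetry E U X := by
  have hX : ContDiffOn ℝ ∞ X U := hY.1.congr h
  refine ⟨hX, fun j hj hs hE => ?_⟩
  rw [← hY.2 j hj hs hE]
  congr 1
  have h1 : Set.EqOn (fun z => (X z).2) (fun z => (Y z).2) U := fun z hz => by simp only [h hz]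
  have h2 : ∀ l, Set.EqOn (fun z => (X z).1 l) (fun z => (Y z).1 l) U :=
    fun l z hz => by simp only [h hz]
  have g1 : ∀ v, dirDeriv v (fun z => (X z).2) j.1.1 = dirDeriv v (fun z => (Y z).2) j.1.1 :=
    fun v => dirDeriv_congr hU h1 v hj
  have g2 : ∀ l v, dirDeriv v (fun z => (X z).1 l) j.1.1 = dirDeriv v (fun z => (Y z).1 l) j.1.1 :=
    fun l v => dirDeriv_congr hU (h2 l) v hj
  have g3 : ∀ v w, dirDeriv v (dirDeriv w fun z => (X z).2) j.1.1
      = dirDeriv v (dirDeriv w fun z => (Y z).2) j.1.1 :=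
    fun v w => dirDeriv_congr hU (dirDeriv_congr hU h1 w) v hj
  have g4 : ∀ l v w, dirDeriv v (dirDeriv w fun z => (X z).1 l) j.1.1
      = dirDeriv v (dirDeriv w fun z => (Y z).1 l) j.1.1 :=
    fun l v w => dirDeriv_congr hU (dirDeriv_congr hU (h2 l) w) v hj
  refine Prod.ext (Prod.ext (h hj) ?_) ?_
  · funext i
    have g1' := g1 (Pi.single i 1, j.1.2 i)
    have g2' := fun l => g2 l (Pi.single i 1, j.1.2 i)
    simp only [dirDeriv] at g1' g2'
    simp only [prolong, prolongCoeff1, totalD, g1', g2']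
  · funext i m
    simp only [prolong]
    rw [prolongCoeff2_eq hU hX _ _ _ hj, prolongCoeff2_eq hU hY.1 _ _ _ hj]
    simp only [g1, g2, g3, g4]

end Sufficiency

/-! ### Components of derivatives -/

section Components

variable {ι κ : Type} [Fintype ι] [Fintype κ]

theorem fderiv_fst_apply {f : Base ι → Base κ} {z : Base ι} (hf : DifferentiableAt ℝ f z)
    (v : Base ι) (l : κ) : (fderiv ℝ f z v).1 l = dirDeriv v (fun y => (f y).1 l) z := by
  have := (((ContinuousLinearMap.proj (R := ℝ) (φ := fun _ : κ => ℝ) l).comp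
    (ContinuousLinearMap.fst ℝ (κ → ℝ) ℂ)).hasFDerivAt.comp z hf.hasFDerivAt).fderiv
  exact (congrArg (fun L => L v) this).symm

theorem fderiv_snd_apply {f : Base ι → Base κ} {z : Base ι} (hf : DifferentiableAt ℝ f z)
    (v : Base ι) : (fderiv ℝ f z v).2 = dirDeriv v (fun y => (f y).2) z := by
  have := ((ContinuousLinearMap.snd ℝ (κ → ℝ) ℂ).hasFDerivAt.comp z hf.hasFDerivAt).fderiv
  exact (congrArg (fun L => L v) this).symm

end Components

/-! ### Radial reduction -/

section Inheritance

variable {d : ℕ} {n p k a b c φ : ℝ}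

/-- Infinitesimal rotations are linear vector fields. -/
theorem exists_clm_rotationField (A : Matrix (Fin d) (Fin d) ℝ) :
    ∃ L : Base (Fin (d + 1)) →L[ℝ] Base (Fin (d + 1)), ∀ z, L z = rotationField A z := by
  let L : Base (Fin (d + 1)) →ₗ[ℝ] Base (Fin (d + 1)) :=
    { toFun := rotationField A
      map_add' := fun y z => by
        refine Prod.ext (funext fun l => ?_) (by simp [rotationField])
        refine Fin.cases (by simp [rotationField]) (fun i => ?_) l
        simp [rotationField, Matrix.mulVec, dotProduct, mul_add, Finset.sum_add_distrib]
      map_smul' := fun s z => by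
        refine Prod.ext (funext fun l => ?_) (by simp [rotationField])
        refine Fin.cases (by simp [rotationField]) (fun i => ?_) l
        simp [rotationField, Matrix.mulVec, dotProduct, Finset.mul_sum, mul_left_comm] }
  exact ⟨L.toContinuousLinearMap, fun z => rfl⟩

theorem skew_dotProduct_mulVec {A : Matrix (Fin d) (Fin d) ℝ} (hA : A.transpose = -A)
    (x : Fin d → ℝ) : ∑ i, x i * A.mulVec x i = 0 := by
  have h1 : dotProduct x (A.mulVec x) = dotProduct x (A.transpose.mulVec x) := by
    rw [Matrix.mulVec_transpose, Matrix.dotProduct_mulVec, dotProduct_comm]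
  rw [hA, Matrix.neg_mulVec, dotProduct_neg] at h1
  have : dotProduct x (A.mulVec x) = 0 := by linarith
  exact this

/-- The symmetries commute with the rotations, since their coefficients are rotation invariant. -/
theorem lieBracket_symFieldD_rotationField {A : Matrix (Fin d) (Fin d) ℝ}
    (hA : A.transpose = -A) (z : Base (Fin (d + 1))) :
    VectorField.lieBracket ℝ (symFieldD d p a b c φ) (rotationField A) z = 0 := by
  obtain ⟨L, hL⟩ := exists_clm_rotationField A
  have e : rotationField A = L := funext fun z => (hL z).symm
  have hd : DifferentiableAt ℝ (symFieldD d p a b c φ) z :=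
    contDiff_symFieldD.differentiable (by simp) z
  rw [VectorField.lieBracket]
  have e2 : fderiv ℝ (rotationField A) z (symFieldD d p a b c φ z)
      = rotationField A (symFieldD d p a b c φ z) := by
    rw [e]; simp
  rw [e2, sub_eq_zero]
  refine Prod.ext (funext fun l => ?_) ?_
  · rw [fderiv_fst_apply hd]
    refine Fin.cases ?_ (fun i => ?_) l
    · rw [dirDeriv_symFieldD_zero]
      simp [rotationField]
    · rw [dirDeriv_symFieldD_succ]
      simp [rotationField, symFieldD, Matrix.mulVec, dotProduct, Finset.mul_sum, mul_left_comm]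
  · rw [fderiv_snd_apply hd, dirDeriv_symFieldD_snd, dirDeriv_slope]
    have h0 : (rotationField A z).1 0 = 0 := rfl
    have h1 : ∀ i : Fin d, (rotationField A z).1 i.succ = A.mulVec (fun i => z.1 i.succ) i :=
      fun _ => rfl
    have h2 : ∀ y, (rotationField A y).2 = 0 := fun _ => rfl
    simp [h0, h1, h2, skew_dotProduct_mulVec hA]

theorem fderiv_radialMap_symFieldD {z : Base (Fin (d + 1))}
    (hz : 0 < (radialMap d z).1 1) :
    fderiv ℝ (radialMap d) z (symFieldD d p a b c φ z) = symField p a b c φ (radialMap d z) := by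
  have hs : 0 < ∑ i : Fin d, z.1 i.succ ^ 2 := Real.sqrt_pos.1 hz
  have hx : ∀ l, DifferentiableAt ℝ (fun y : Base (Fin (d + 1)) => y.1 l) z := fun l => by fun_prop
  have hq : DifferentiableAt ℝ (fun y : Base (Fin (d + 1)) => ∑ i : Fin d, y.1 i.succ ^ 2) z := by
    fun_prop
  have hq' : DifferentiableAt ℝ (fun y : Base (Fin (d + 1)) => √(∑ i : Fin d, y.1 i.succ ^ 2)) z :=
    hq.sqrt hs.ne'
  have hd : DifferentiableAt ℝ (radialMap d) z := by
    refine DifferentiableAt.prodMk (differentiableAt_pi.2 fun l => ?_) differentiableAt_snd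
    fin_cases l
    · exact hx 0
    · exact hq'
  have hsq : √(∑ i : Fin d, z.1 i.succ ^ 2) ^ 2 = ∑ i : Fin d, z.1 i.succ ^ 2 :=
    Real.sq_sqrt hs.le
  refine Prod.ext (funext fun l => ?_) ?_
  · rw [fderiv_fst_apply hd]
    fin_cases l
    · change dirDeriv _ (fun y : Base (Fin (d + 1)) => y.1 0) z = _
      rw [dirDeriv_coord]
      simp [symFieldD, symField, radialMap]
    · change dirDeriv _ (fun y : Base (Fin (d + 1)) => √(∑ i : Fin d, y.1 i.succ ^ 2)) z = _
      have e1 : dirDeriv (symFieldD d p a b c φ z)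
          (fun y : Base (Fin (d + 1)) => ∑ i : Fin d, y.1 i.succ ^ 2) z
          = 2 * (b + c * z.1 0) * ∑ i : Fin d, z.1 i.succ ^ 2 := by
        simp only [pow_two]
        rw [dirDeriv_sum_fun fun i => (hx _).fun_mul (hx _)]
        simp only [dirDeriv_mul_fun (hx _) (hx _), dirDeriv_coord, symFieldD, Fin.cons_succ,
          Finset.mul_sum]
        refine Finset.sum_congr rfl fun i _ => by ring
      have e2 := (hq.hasFDerivAt.sqrt hs.ne').fderiv
      simp only [dirDeriv] at e1 ⊢
      rw [e2, smul_apply, e1, smul_eq_mul]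
      have hz' : √(∑ i : Fin d, z.1 i.succ ^ 2) ≠ 0 := (Real.sqrt_pos.2 hs).ne'
      simp only [symField, radialMap, Matrix.cons_val_zero, Matrix.cons_val_one, Fin.mk_one,
        Matrix.cons_val_fin_one]
      rw [← hsq]
      field_simp
      rw [Real.sqrt_sq (Real.sqrt_nonneg _)]
  · rw [fderiv_snd_apply hd]
    change dirDeriv _ (fun y : Base (Fin (d + 1)) => y.2) z = _
    rw [dirDeriv_dependent]
    simp [symFieldD, symField, radialMap, slope, Real.sq_sqrt hs.le]

/-- The field with the same coefficients in `d` dimensions projects to the given symmetry. -/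
theorem isInherited_of_isPointSymmetry (hn : n ≠ 1) (hp : p ≠ 0) (hk : k ≠ 0)
    {U : Set (Base (Fin 2))} (hU : IsOpen U) (hc : IsConnected U) (hreg : U ⊆ regularDomain)
    (hd : n = d) {X : Base (Fin 2) → Base (Fin 2)} (hX : IsPointSymmetry (radialEq n p k) U X) :
    IsInherited d p k U X := by
  obtain ⟨a, b, c, φ, hcrit, hXe⟩ := exists_symField_of_isPointSymmetry hn hp hk hU hc hreg hX
  refine ⟨symFieldD d p a b c φ, isPointSymmetry_symFieldD hp (hd ▸ hcrit)
    (fun z hz => (hreg hz).2), fun A hA => ⟨0, by simp, fun z _ => ?_⟩, fun z hz => ?_⟩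
  · rw [lieBracket_symFieldD_rotationField hA]
    refine Prod.ext (funext fun l => ?_) rfl
    refine Fin.cases rfl (fun i => ?_) l
    simp [rotationField]
  · rw [fderiv_radialMap_symFieldD (hreg hz).1, hXe hz]

end Inheritance

/-! ### Classification -/

section Classification

variable {n p k : ℝ} {U : Set (Base (Fin 2))}

theorem isPointSymmetry_iff (hn : n ≠ 1) (hp : p ≠ 0) (hk : k ≠ 0)
    (hU : IsOpen U) (hc : IsConnected U) (hreg : U ⊆ regularDomain)
    {X : Base (Fin 2) → Base (Fin 2)} :
    IsPointSymmetry (radialEq n p k) U X ↔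
      ∃ a b c φ : ℝ, c * (n * p - 4) = 0 ∧ Set.EqOn X (symField p a b c φ) U :=
  ⟨exists_symField_of_isPointSymmetry hn hp hk hU hc hreg, fun ⟨_, _, _, _, h, hX⟩ =>
    isPointSymmetry_congr hU hX (isPointSymmetry_symField hp h hreg)⟩

/-- For `n = 0` the junk value `4 / 0 = 0` is harmless, as `p ≠ 0`. -/
theorem critical_iff (hp : p ≠ 0) : p = 4 / n ↔ n * p - 4 = 0 := by
  rcases eq_or_ne n 0 with rfl | hn
  · simp [hp]
  · rw [eq_div_iff hn, sub_eq_zero, mul_comm]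

/-- A combination of the known fields that agrees with the inversion on a nonempty open set
contains the inversion with coefficient `1`: compare the coefficients of `∂/∂t`. -/
theorem inversion_coeff_eq_one (hU : IsOpen U) (hne : U.Nonempty) {a b c φ : ℝ}
    (h : Set.EqOn (Xinver p) (symField p a b c φ) U) : c = 1 := by
  obtain ⟨z, hz⟩ := hne
  have hcoord : Set.EqOn (fun y : Base (Fin 2) => y.1 0 * y.1 0)
      (fun y => (symFieldD 1 p a b c φ y).1 0) U := fun y hy => by
    have h1 := congrArg (fun w => w.1 0) (h hy)
    rw [← symFieldD_one] at h1
    simpa [Xinver, pow_two] using h1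
  have hx : ∀ y : Base (Fin 2), DifferentiableAt ℝ (fun y : Base (Fin 2) => y.1 0) y :=
    fun y => by fun_prop
  have h1 : Set.EqOn (fun y : Base (Fin 2) => 2 * y.1 0)
      (fun y => 2 * b + 2 * c * y.1 0) U := fun y hy => by
    have h2 := dirDeriv_congr hU hcoord eT hy
    rw [dirDeriv_symFieldD_zero, dirDeriv_mul_fun (hx y) (hx y), dirDeriv_coord] at h2
    have h3 : eT.1 0 = 1 := by simp [eT]
    rw [h3] at h2
    simp only
    linarith
  have h2 := dirDeriv_congr hU h1 eT hz
  have h3 : eT.1 0 = 1 := by simp [eT]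
  rw [dirDeriv_add_fun (by fun_prop) (by fun_prop), dirDeriv_const_fun,
    dirDeriv_mul_fun (by fun_prop) (hx z), dirDeriv_mul_fun (by fun_prop) (hx z),
    dirDeriv_const_fun, dirDeriv_const_fun, dirDeriv_coord, h3] at h2
  linarith

theorem mem_span_three (Y : Base (Fin 2) → Base (Fin 2)) :
    Y ∈ Submodule.span ℝ {Xphas, Xtrans, Xscal p} ↔ ∃ a b φ, Y = symField p a b 0 φ := by
  simp only [Submodule.mem_span_insert, Submodule.mem_span_singleton, symField_eq]
  constructor
  · rintro ⟨φ, _, ⟨a, _, ⟨b, rfl⟩, rfl⟩, rfl⟩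
    exact ⟨a, b, φ, by module⟩
  · rintro ⟨a, b, φ, rfl⟩
    exact ⟨φ, _, ⟨a, _, ⟨b, rfl⟩, rfl⟩, by module⟩

theorem mem_span_four (Y : Base (Fin 2) → Base (Fin 2)) :
    Y ∈ Submodule.span ℝ {Xphas, Xtrans, Xscal p, Xinver p} ↔
      ∃ a b c φ, Y = symField p a b c φ := by
  simp only [Submodule.mem_span_insert, Submodule.mem_span_singleton, symField_eq]
  constructor
  · rintro ⟨φ, _, ⟨a, _, ⟨b, _, ⟨c, rfl⟩, rfl⟩, rfl⟩, rfl⟩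
    exact ⟨a, b, c, φ, by module⟩
  · rintro ⟨a, b, c, φ, rfl⟩
    exact ⟨φ, _, ⟨a, _, ⟨b, _, ⟨c, rfl⟩, rfl⟩, rfl⟩, by module⟩

theorem classification (hn : n ≠ 1) (hp : p ≠ 0) (hk : k ≠ 0)
    (hU : IsOpen U) (hc : IsConnected U) (hreg : U ⊆ regularDomain) :
    (p ≠ 4 / n → ∀ X : Base (Fin 2) → Base (Fin 2),
        IsPointSymmetry (radialEq n p k) U X ↔
          ∃ Y ∈ Submodule.span ℝ {Xphas, Xtrans, Xscal p}, Set.EqOn X Y U) ∧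
      (p = 4 / n → ∀ X : Base (Fin 2) → Base (Fin 2),
        IsPointSymmetry (radialEq n p k) U X ↔
          ∃ Y ∈ Submodule.span ℝ {Xphas, Xtrans, Xscal p, Xinver p}, Set.EqOn X Y U) ∧
      (IsPointSymmetry (radialEq n p k) U (Xinver p) ↔ p = 4 / n) := by
  refine ⟨fun hcrit X => ?_, fun hcrit X => ?_, fun h => ?_, fun hcrit => ?_⟩
  · rw [isPointSymmetry_iff hn hp hk hU hc hreg]
    rw [ne_eq, critical_iff hp] at hcrit
    constructor
    · rintro ⟨a, b, c, φ, h, hX⟩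
      obtain rfl := (mul_eq_zero.1 h).resolve_right hcrit
      exact ⟨_, (mem_span_three _).2 ⟨a, b, φ, rfl⟩, hX⟩
    · rintro ⟨Y, hY, hX⟩
      obtain ⟨a, b, φ, rfl⟩ := (mem_span_three Y).1 hY
      exact ⟨a, b, 0, φ, zero_mul _, hX⟩
  · rw [isPointSymmetry_iff hn hp hk hU hc hreg]
    rw [critical_iff hp] at hcrit
    constructor
    · rintro ⟨a, b, c, φ, -, hX⟩
      exact ⟨_, (mem_span_four _).2 ⟨a, b, c, φ, rfl⟩, hX⟩
    · rintro ⟨Y, hY, hX⟩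
      obtain ⟨a, b, c, φ, rfl⟩ := (mem_span_four Y).1 hY
      exact ⟨a, b, c, φ, by rw [hcrit, mul_zero], hX⟩
  · obtain ⟨a, b, c, φ, h1, h2⟩ := (isPointSymmetry_iff hn hp hk hU hc hreg).1 h
    rw [inversion_coeff_eq_one hU hc.nonempty h2, one_mul] at h1
    exact (critical_iff hp).2 h1
  · refine (isPointSymmetry_iff hn hp hk hU hc hreg).2 ⟨0, 0, 1, 0, ?_, fun z _ => ?_⟩
    · rw [(critical_iff hp).1 hcrit, mul_zero]
    · rw [symField_eq]
      simp

end Classification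

/-! ### Commutators -/

section Commutators

/-- The structure constants of the symmetry algebra: `sl(2)` in `a`, `b`, `c`, with the phase
rotation as a central summand. -/
theorem lieBracket_symField (p a b c φ a' b' c' φ' : ℝ) :
    VectorField.lieBracket ℝ (symField p a b c φ) (symField p a' b' c' φ') =
      symField p (2 * (a * b' - a' * b)) (a * c' - a' * c) (2 * (b * c' - b' * c)) 0 := by
  simp only [← symFieldD_one]
  funext z
  have hd : ∀ a b c φ, DifferentiableAt ℝ (symFieldD 1 p a b c φ) z := fun a b c φ =>
    contDiff_symFieldD.differentiable (by simp) z
  rw [VectorField.lieBracket]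
  refine Prod.ext (funext fun l => ?_) ?_
  · rw [Prod.fst_sub, Pi.sub_apply, fderiv_fst_apply (hd _ _ _ _), fderiv_fst_apply (hd _ _ _ _)]
    refine Fin.cases ?_ (fun i => ?_) l
    · simp only [dirDeriv_symFieldD_zero]
      simp only [symFieldD, Fin.cons_zero]
      ring
    · simp only [dirDeriv_symFieldD_succ]
      simp only [symFieldD, Fin.cons_succ, Fin.cons_zero]
      ring
  · rw [Prod.snd_sub, fderiv_snd_apply (hd _ _ _ _), fderiv_snd_apply (hd _ _ _ _),
      dirDeriv_symFieldD_snd, dirDeriv_symFieldD_snd, dirDeriv_slope, dirDeriv_slope]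
    simp [symFieldD, slope]
    ring

theorem Xphas_eq (p : ℝ) : Xphas = symField p 0 0 0 1 := by simp [symField_eq]

theorem Xtrans_eq (p : ℝ) : Xtrans = symField p 1 0 0 0 := by simp [symField_eq]

theorem Xscal_eq (p : ℝ) : Xscal p = symField p 0 1 0 0 := by simp [symField_eq]

theorem Xinver_eq (p : ℝ) : Xinver p = symField p 0 0 1 0 := by simp [symField_eq]

theorem commutators (p : ℝ) :
    VectorField.lieBracket ℝ Xphas Xtrans = 0 ∧
      VectorField.lieBracket ℝ Xphas (Xscal p) = 0 ∧
      VectorField.lieBracket ℝ Xphas (Xinver p) = 0 ∧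
      VectorField.lieBracket ℝ Xtrans (Xscal p) = (2 : ℝ) • Xtrans ∧
      VectorField.lieBracket ℝ Xtrans (Xinver p) = Xscal p ∧
      VectorField.lieBracket ℝ (Xscal p) (Xinver p) = (2 : ℝ) • Xinver p := by
  rw [Xphas_eq p, Xtrans_eq p, Xscal_eq p, Xinver_eq p]
  simp only [lieBracket_symField]
  simp [symField_eq]

end Commutators

/-! ### Flows of the symmetries -/

section Flows

theorem eq_zero_of_hasDerivAt_mul {y a : ℝ → ℂ} {s : ℝ}
    (ha : ContinuousOn a (Set.uIcc 0 s)) (h0 : y 0 = 0)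
    (hy : ∀ σ ∈ Set.uIcc 0 s, HasDerivAt y (a σ * y σ) σ) : y s = 0 := by
  -- the interval is rescaled to `[0, 1]`, which also covers negative `s`
  have hmem : ∀ x ∈ Set.Icc (0 : ℝ) 1, s * x ∈ Set.uIcc 0 s := fun x hx => by
    rcases le_total 0 s with h | h
    · rw [Set.uIcc_of_le h]
      exact ⟨by nlinarith [hx.1], by nlinarith [hx.2]⟩
    · rw [Set.uIcc_of_ge h]
      exact ⟨by nlinarith [hx.2], by nlinarith [hx.1]⟩
  obtain ⟨K, hK⟩ := isCompact_uIcc.exists_bound_of_continuousOn ha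
  have hd : ∀ x ∈ Set.Icc (0 : ℝ) 1,
      HasDerivAt (fun x => y (s * x)) (s • (a (s * x) * y (s * x))) x := fun x hx => by
    have h1 : HasDerivAt (fun x : ℝ => s * x) s x := by
      simpa using (hasDerivAt_id x).const_mul s
    exact (hy _ (hmem x hx)).scomp x h1
  have := eq_zero_of_abs_deriv_le_mul_abs_self_of_eq_zero_right (f := fun x => y (s * x))
    (f' := fun x => s • (a (s * x) * y (s * x))) (K := |s| * K) (a := 0) (b := 1)
    (fun x hx => (hd x hx).continuousAt.continuousWithinAt)
    (fun x hx => (hd x ⟨hx.1, hx.2.le⟩).hasDerivWithinAt) (by simpa using h0)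
    (fun x hx => by
      rw [norm_smul, norm_mul, Real.norm_eq_abs, mul_assoc]
      gcongr
      exact hK _ (hmem x ⟨hx.1, hx.2.le⟩)) 1 ⟨zero_le_one, le_rfl⟩
  simpa using this

/-- Uniqueness for linear scalar equations, on an interval of either orientation. -/
theorem eq_of_hasDerivAt_mul {x y a : ℝ → ℂ} {s : ℝ}
    (ha : ContinuousOn a (Set.uIcc 0 s)) (h0 : x 0 = y 0)
    (hx : ∀ σ ∈ Set.uIcc 0 s, HasDerivAt x (a σ * x σ) σ)
    (hy : ∀ σ ∈ Set.uIcc 0 s, HasDerivAt y (a σ * y σ) σ) : x s = y s := by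
  have := eq_zero_of_hasDerivAt_mul (y := fun σ => x σ - y σ) ha (by simp [h0])
    (fun σ hσ => ((hx σ hσ).sub (hy σ hσ)).congr_deriv (mul_sub _ _ _).symm)
  exact sub_eq_zero.1 this

theorem eq_of_hasDerivAt_eq {x y v : ℝ → ℝ} {s : ℝ} (h0 : x 0 = y 0)
    (hx : ∀ σ ∈ Set.uIcc 0 s, HasDerivAt x (v σ) σ)
    (hy : ∀ σ ∈ Set.uIcc 0 s, HasDerivAt y (v σ) σ) : x s = y s := by
  have := eq_zero_of_hasDerivAt_mul (y := fun σ => ((x σ - y σ : ℝ) : ℂ)) (a := fun _ => 0)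
    continuousOn_const (by simp [h0])
    (fun σ hσ => by simpa using ((hx σ hσ).sub (hy σ hσ)).ofReal_comp)
  exact sub_eq_zero.1 (by exact_mod_cast this)

theorem eq_of_hasDerivAt_mul_real {x y a : ℝ → ℝ} {s : ℝ}
    (ha : ContinuousOn a (Set.uIcc 0 s)) (h0 : x 0 = y 0)
    (hx : ∀ σ ∈ Set.uIcc 0 s, HasDerivAt x (a σ * x σ) σ)
    (hy : ∀ σ ∈ Set.uIcc 0 s, HasDerivAt y (a σ * y σ) σ) : x s = y s := by
  have := eq_of_hasDerivAt_mul (x := fun σ => (x σ : ℂ)) (y := fun σ => (y σ : ℂ))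
    (a := fun σ => (a σ : ℂ)) (Complex.continuous_ofReal.comp_continuousOn ha) (by simp [h0])
    (fun σ hσ => by simpa using (hx σ hσ).ofReal_comp)
    (fun σ hσ => by simpa using (hy σ hσ).ofReal_comp)
  exact_mod_cast this

theorem base_ext {z w : Base (Fin 2)} (h0 : z.1 0 = w.1 0) (h1 : z.1 1 = w.1 1)
    (h2 : z.2 = w.2) : z = w := by
  refine Prod.ext (funext fun i => ?_) h2
  fin_cases i
  · exact h0
  · exact h1

theorem hasDerivAt_base {γ : ℝ → Base (Fin 2)} {v : Base (Fin 2)} {σ : ℝ} :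
    HasDerivAt γ v σ ↔ HasDerivAt (fun s => (γ s).1 0) (v.1 0) σ ∧
      HasDerivAt (fun s => (γ s).1 1) (v.1 1) σ ∧ HasDerivAt (fun s => (γ s).2) v.2 σ := by
  constructor
  · intro h
    have h1 := hasDerivAt_pi.1 h.fst
    exact ⟨h1 0, h1 1, h.snd⟩
  · rintro ⟨h0, h1, h2⟩
    have h3 : HasDerivAt (fun s => (γ s).1) v.1 σ := by
      refine hasDerivAt_pi.2 fun i => ?_
      fin_cases i
      · exact h0
      · exact h1
    exact h3.prodMk h2

theorem flowsTo_Xphas_iff {φ : ℝ} {z z' : Base (Fin 2)} :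
    FlowsTo Xphas φ z z' ↔ z' = (z.1, Complex.exp (Complex.I * φ) * z.2) := by
  have hexp : ∀ σ : ℝ, HasDerivAt (fun σ : ℝ => Complex.exp (Complex.I * σ) * z.2)
      (Complex.I * (Complex.exp (Complex.I * σ) * z.2)) σ := fun σ => by
    have := (((Complex.ofRealCLM.hasDerivAt (x := σ)).const_mul Complex.I).cexp).mul_const z.2
    refine HasDerivAt.congr_deriv (this) ?_
    simp; ring
  constructor
  · rintro ⟨γ, h0, rfl, hγ⟩
    have h := fun σ hσ => hasDerivAt_base.1 (hγ σ hσ)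
    refine base_ext ?_ ?_ ?_
    · exact eq_of_hasDerivAt_eq (y := fun _ => z.1 0) (by simp [h0]) (fun σ hσ => (h σ hσ).1)
        (fun σ _ => hasDerivAt_const _ _)
    · exact eq_of_hasDerivAt_eq (y := fun _ => z.1 1) (by simp [h0]) (fun σ hσ => (h σ hσ).2.1)
        (fun σ _ => hasDerivAt_const _ _)
    · exact eq_of_hasDerivAt_mul (a := fun _ => Complex.I) continuousOn_const (by simp [h0])
        (fun σ hσ => (h σ hσ).2.2) (fun σ _ => hexp σ)
  · rintro rfl
    refine ⟨fun σ => (z.1, Complex.exp (Complex.I * σ) * z.2), by simp, rfl, fun σ _ => ?_⟩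
    exact hasDerivAt_base.2 ⟨hasDerivAt_const _ _, hasDerivAt_const _ _, hexp σ⟩

theorem flowsTo_Xtrans_iff {ε : ℝ} {z z' : Base (Fin 2)} :
    FlowsTo Xtrans ε z z' ↔ z' = (![z.1 0 + ε, z.1 1], z.2) := by
  constructor
  · rintro ⟨γ, h0, rfl, hγ⟩
    have h := fun σ hσ => hasDerivAt_base.1 (hγ σ hσ)
    refine base_ext ?_ ?_ ?_
    · exact eq_of_hasDerivAt_eq (y := fun σ => z.1 0 + σ) (by simp [h0]) (fun σ hσ => (h σ hσ).1)
        (fun σ _ => (hasDerivAt_id σ).const_add _)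
    · exact eq_of_hasDerivAt_eq (y := fun _ => z.1 1) (by simp [h0]) (fun σ hσ => (h σ hσ).2.1)
        (fun σ _ => hasDerivAt_const _ _)
    · exact eq_of_hasDerivAt_mul (a := fun _ => 0) (x := fun σ => (γ σ).2) (y := fun _ => z.2)
        continuousOn_const (by simp [h0]) (fun σ hσ => by simpa [Xtrans] using (h σ hσ).2.2)
        (fun σ _ => by simpa using hasDerivAt_const σ z.2)
  · rintro rfl
    refine ⟨fun σ => (![z.1 0 + σ, z.1 1], z.2), base_ext (by simp) (by simp) rfl, rfl,
      fun σ _ => ?_⟩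
    exact hasDerivAt_base.2 ⟨(hasDerivAt_id σ).const_add _, hasDerivAt_const _ _,
      hasDerivAt_const _ _⟩

theorem flowsTo_Xscal_iff {p s : ℝ} {z z' : Base (Fin 2)} :
    FlowsTo (Xscal p) s z z' ↔ z' = (![Real.exp (2 * s) * z.1 0, Real.exp s * z.1 1],
      ((Real.exp (-(2 / p) * s) : ℝ) : ℂ) * z.2) := by
  have hexp : ∀ q x σ : ℝ, HasDerivAt (fun σ : ℝ => Real.exp (q * σ) * x)
      (q * (Real.exp (q * σ) * x)) σ := fun q x σ => by
    have := (((hasDerivAt_id σ).const_mul q).exp).mul_const x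
    refine HasDerivAt.congr_deriv (this) ?_
    simp; ring
  have hexp1 : ∀ σ : ℝ, HasDerivAt (fun σ : ℝ => Real.exp σ * z.1 1)
      (1 * (Real.exp σ * z.1 1)) σ := fun σ => by
    simpa using (Real.hasDerivAt_exp σ).mul_const (z.1 1)
  have hexpc : ∀ σ : ℝ, HasDerivAt (fun σ : ℝ => ((Real.exp (-(2 / p) * σ) : ℝ) : ℂ) * z.2)
      (-((2 / p : ℝ) : ℂ) * (((Real.exp (-(2 / p) * σ) : ℝ) : ℂ) * z.2)) σ := fun σ => by
    have := ((hexp (-(2 / p)) 1 σ).ofReal_comp).mul_const z.2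
    simp only [mul_one] at this
    refine HasDerivAt.congr_deriv (this) ?_
    push_cast; ring
  constructor
  · rintro ⟨γ, h0, rfl, hγ⟩
    have h := fun σ hσ => hasDerivAt_base.1 (hγ σ hσ)
    refine base_ext ?_ ?_ ?_
    · exact eq_of_hasDerivAt_mul_real (a := fun _ => 2) continuousOn_const (by simp [h0])
        (fun σ hσ => (h σ hσ).1) (fun σ _ => hexp 2 (z.1 0) σ)
    · exact eq_of_hasDerivAt_mul_real (a := fun _ => 1) (x := fun σ => (γ σ).1 1)
        (y := fun σ => Real.exp σ * z.1 1) continuousOn_const (by simp [h0])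
        (fun σ hσ => by simpa [Xscal] using (h σ hσ).2.1) (fun σ _ => hexp1 σ)
    · exact eq_of_hasDerivAt_mul (a := fun _ => -((2 / p : ℝ) : ℂ)) continuousOn_const
        (by simp [h0]) (fun σ hσ => (h σ hσ).2.2) (fun σ _ => hexpc σ)
  · rintro rfl
    refine ⟨fun σ => (![Real.exp (2 * σ) * z.1 0, Real.exp σ * z.1 1],
      ((Real.exp (-(2 / p) * σ) : ℝ) : ℂ) * z.2), base_ext (by simp) (by simp) (by simp), rfl,
      fun σ _ => ?_⟩
    exact hasDerivAt_base.2 ⟨hexp 2 (z.1 0) σ, by simpa [Xscal] using hexp1 σ, hexpc σ⟩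

theorem one_sub_mul_pos_of_mem_uIcc {s x σ : ℝ} (hs : 0 < 1 - s * x) (hσ : σ ∈ Set.uIcc 0 s) :
    0 < 1 - σ * x := by
  rw [Set.mem_uIcc] at hσ
  rcases hσ with ⟨h1, h2⟩ | ⟨h1, h2⟩ <;> rcases le_total 0 x with h | h <;> nlinarith

/-- The orbit of the inversion through `z`; it exists as long as `1 - σ t > 0`. -/
def inversionOrbit (p : ℝ) (z : Base (Fin 2)) (σ : ℝ) : Base (Fin 2) :=
  (![z.1 0 / (1 - σ * z.1 0), z.1 1 / (1 - σ * z.1 0)],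
    (((1 - σ * z.1 0) ^ (2 / p) : ℝ) : ℂ) *
      Complex.exp (-Complex.I * ((σ * z.1 1 ^ 2 / (4 * (1 - σ * z.1 0)) : ℝ) : ℂ)) * z.2)

theorem hasDerivAt_inversionOrbit (p : ℝ) (z : Base (Fin 2)) {σ : ℝ} (h : 0 < 1 - σ * z.1 0) :
    HasDerivAt (inversionOrbit p z) (Xinver p (inversionOrbit p z σ)) σ := by
  have hq : HasDerivAt (fun σ : ℝ => 1 - σ * z.1 0) (-z.1 0) σ := by
    simpa using ((hasDerivAt_id σ).mul_const (z.1 0)).const_sub 1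
  have hinv : ∀ x : ℝ, HasDerivAt (fun σ : ℝ => x / (1 - σ * z.1 0))
      (x * z.1 0 / (1 - σ * z.1 0) ^ 2) σ := fun x => by
    have := (hasDerivAt_const σ x).div hq h.ne'
    refine HasDerivAt.congr_deriv (this) ?_
    ring
  refine hasDerivAt_base.2 ⟨?_, ?_, ?_⟩
  · refine HasDerivAt.congr_deriv (hinv (z.1 0)) ?_
    have h1 := h.ne'
    simp [inversionOrbit, Xinver]
    field_simp
  · refine HasDerivAt.congr_deriv (hinv (z.1 1)) ?_
    have h1 := h.ne'
    simp [inversionOrbit, Xinver]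
    field_simp
  · have h1 := (hq.rpow_const (p := 2 / p) (Or.inl h.ne')).ofReal_comp
    have h2 : HasDerivAt (fun σ : ℝ => σ * z.1 1 ^ 2 / (4 * (1 - σ * z.1 0)))
        (z.1 1 ^ 2 / (4 * (1 - σ * z.1 0) ^ 2)) σ := by
      have := ((hasDerivAt_id σ).mul_const (z.1 1 ^ 2)).div (hq.const_mul 4) (by positivity)
      refine HasDerivAt.congr_deriv (this) ?_
      field_simp
      simp
      ring
    have h3 := (h1.mul (h2.ofReal_comp.const_mul (-Complex.I)).cexp).mul_const z.2
    refine HasDerivAt.congr_deriv (h3) ?_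
    simp only [inversionOrbit, Xinver, Matrix.cons_val_zero, Matrix.cons_val_one,
      Matrix.cons_val_fin_one]
    rw [Real.rpow_sub_one h.ne']
    have h4 : ((1 - σ * z.1 0 : ℝ) : ℂ) ≠ 0 := by exact_mod_cast h.ne'
    push_cast at h4 ⊢
    field_simp
    ring

/-- The flow of the inversion through `z` exists up to time `s` exactly if `1 - s t > 0`. -/
theorem flowsTo_Xinver_iff {p s : ℝ} {z z' : Base (Fin 2)} :
    FlowsTo (Xinver p) s z z' ↔ 0 < 1 - s * z.1 0 ∧ z' = inversionOrbit p z s := by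
  have horb0 : inversionOrbit p z 0 = z := by
    refine base_ext ?_ ?_ ?_ <;> simp [inversionOrbit]
  constructor
  · rintro ⟨γ, h0, rfl, hγ⟩
    have h := fun σ hσ => hasDerivAt_base.1 (hγ σ hσ)
    have hcont : ContinuousOn γ (Set.uIcc 0 s) := fun σ hσ =>
      (hγ σ hσ).continuousAt.continuousWithinAt
    have hct : ContinuousOn (fun σ => (γ σ).1 0) (Set.uIcc 0 s) := by fun_prop
    -- `t (1 - σ t₀) - t₀` solves a homogeneous linear equation, hence vanishes
    have hq : ∀ σ, HasDerivAt (fun σ : ℝ => 1 - σ * z.1 0) (-z.1 0) σ := fun σ => by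
      simpa using ((hasDerivAt_id σ).mul_const (z.1 0)).const_sub 1
    have ht : ∀ σ ∈ Set.uIcc 0 s, (γ σ).1 0 * (1 - σ * z.1 0) = z.1 0 := by
      intro σ₁ hσ₁
      have hsub : Set.uIcc 0 σ₁ ⊆ Set.uIcc 0 s := Set.uIcc_subset_uIcc_left hσ₁
      have := eq_of_hasDerivAt_mul_real
        (x := fun σ => (γ σ).1 0 * (1 - σ * z.1 0) - z.1 0) (y := fun _ => 0)
        (a := fun σ => (γ σ).1 0) (hct.mono hsub) (by simp [h0])
        (fun σ hσ => by
          have h1 := (((h σ (hsub hσ)).1).mul (hq σ)).sub_const (z.1 0)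
          refine HasDerivAt.congr_deriv (h1) ?_
          simp [Xinver]
          ring)
        (fun σ _ => by simpa using hasDerivAt_const σ (0 : ℝ))
      exact sub_eq_zero.1 this
    -- otherwise `1 - σ t₀` would vanish somewhere, whence `t₀ = 0` by `ht` and `1 - σ t₀ = 1`
    have hpos : 0 < 1 - s * z.1 0 := by
      by_contra hneg
      have hmem : (0 : ℝ) ∈ (fun σ : ℝ => 1 - σ * z.1 0) '' Set.uIcc 0 s := by
        refine intermediate_value_uIcc (by fun_prop) ?_
        rw [Set.mem_uIcc]
        right
        simp only [zero_mul, sub_zero]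
        exact ⟨not_lt.1 hneg, zero_le_one⟩
      obtain ⟨σ, hσ, h1⟩ := hmem
      have h2 := ht σ hσ
      simp only at h1
      rw [h1, mul_zero] at h2
      rw [← h2] at h1
      norm_num at h1
    refine ⟨hpos, ?_⟩
    have hp' := fun σ (hσ : σ ∈ Set.uIcc 0 s) => one_sub_mul_pos_of_mem_uIcc hpos hσ
    have ho := fun σ (hσ : σ ∈ Set.uIcc 0 s) =>
      hasDerivAt_base.1 (hasDerivAt_inversionOrbit p z (hp' σ hσ))
    have ht' : ∀ σ ∈ Set.uIcc 0 s, (γ σ).1 0 = (inversionOrbit p z σ).1 0 := fun σ hσ => by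
      simp only [inversionOrbit, Matrix.cons_val_zero]
      rw [eq_div_iff (hp' σ hσ).ne']
      exact ht σ hσ
    have hr' : ∀ σ ∈ Set.uIcc 0 s, (γ σ).1 1 = (inversionOrbit p z σ).1 1 := by
      intro σ₁ hσ₁
      have hsub : Set.uIcc 0 σ₁ ⊆ Set.uIcc 0 s := Set.uIcc_subset_uIcc_left hσ₁
      exact eq_of_hasDerivAt_mul_real (a := fun σ => (γ σ).1 0)
        (y := fun σ => (inversionOrbit p z σ).1 1) (hct.mono hsub)
        (by rw [h0, horb0]) (fun σ hσ => (h σ (hsub hσ)).2.1)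
        (fun σ hσ => by rw [ht' σ (hsub hσ)]; exact (ho σ (hsub hσ)).2.1)
    refine base_ext (ht' s Set.right_mem_uIcc) (hr' s Set.right_mem_uIcc) ?_
    refine eq_of_hasDerivAt_mul (y := fun σ => (inversionOrbit p z σ).2)
      (a := fun σ => -(((2 * (γ σ).1 0 / p : ℝ) : ℂ)
        + Complex.I * (((γ σ).1 1 ^ 2 / 4 : ℝ) : ℂ))) ?_ (by rw [h0, horb0])
      (fun σ hσ => (h σ hσ).2.2)
      (fun σ hσ => by rw [ht' σ hσ, hr' σ hσ]; exact (ho σ hσ).2.2)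
    have hcr : ContinuousOn (fun σ => (γ σ).1 1) (Set.uIcc 0 s) := by fun_prop
    have c1 : ContinuousOn (fun σ => ((2 * (γ σ).1 0 / p : ℝ) : ℂ)) (Set.uIcc 0 s) :=
      Complex.continuous_ofReal.comp_continuousOn (by fun_prop)
    have c2 : ContinuousOn (fun σ => (((γ σ).1 1 ^ 2 / 4 : ℝ) : ℂ)) (Set.uIcc 0 s) :=
      Complex.continuous_ofReal.comp_continuousOn (by fun_prop)
    exact (c1.add (continuousOn_const.mul c2)).neg
  · rintro ⟨hpos, rfl⟩
    exact ⟨inversionOrbit p z, horb0, rfl, fun σ hσ =>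
      hasDerivAt_inversionOrbit p z (one_sub_mul_pos_of_mem_uIcc hpos hσ)⟩

end Flows

/-! ### Rescaled solutions -/

section Solutions

variable {n p k : ℝ} {D D' : Set (Fin 2 → ℝ)} {f g : (Fin 2 → ℝ) → ℂ}

theorem vec_eta (x : Fin 2 → ℝ) : ![x 0, x 1] = x := by
  funext i
  fin_cases i <;> rfl

theorem pderiv_eq_dirDeriv {ι : Type} [Fintype ι] [DecidableEq ι] (f : (ι → ℝ) → ℂ) (i : ι) :
    pderiv f i = dirDeriv (Pi.single i 1) f := rfl

theorem dirDeriv_pi_coord {ι : Type} [Fintype ι] (i : ι) (v x : ι → ℝ) :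
    dirDeriv v (fun y : ι → ℝ => y i) x = v i :=
  dirDeriv_clm (ContinuousLinearMap.proj (R := ℝ) (φ := fun _ : ι => ℝ) i)

/-- The chain rule for `(t, r) ↦ (T(t), S(t) r)`. -/
theorem dirDeriv_comp_rescaling {T S : ℝ → ℝ} {T' S' : ℝ} {x : Fin 2 → ℝ}
    (hT : HasDerivAt T T' (x 0)) (hS : HasDerivAt S S' (x 0)) {h : (Fin 2 → ℝ) → ℂ}
    (hh : DifferentiableAt ℝ h ![T (x 0), S (x 0) * x 1]) (v : Fin 2 → ℝ) :
    DifferentiableAt ℝ (fun y : Fin 2 → ℝ => h ![T (y 0), S (y 0) * y 1]) x ∧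
    dirDeriv v (fun y : Fin 2 → ℝ => h ![T (y 0), S (y 0) * y 1]) x =
      ((T' * v 0 : ℝ) : ℂ) * pderiv h 0 ![T (x 0), S (x 0) * x 1]
        + ((S' * v 0 * x 1 + S (x 0) * v 1 : ℝ) : ℂ) * pderiv h 1 ![T (x 0), S (x 0) * x 1] := by
  let π : Fin 2 → (Fin 2 → ℝ) →L[ℝ] ℝ := fun i =>
    ContinuousLinearMap.proj (R := ℝ) (φ := fun _ : Fin 2 => ℝ) i
  have h0 := hT.comp_hasFDerivAt x (π 0).hasFDerivAt
  have h1 := (hS.comp_hasFDerivAt x (π 0).hasFDerivAt).mul (π 1).hasFDerivAt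
  have hΦ : HasFDerivAt (fun y : Fin 2 → ℝ => ![T (y 0), S (y 0) * y 1])
      (ContinuousLinearMap.pi ![T' • π 0, S (x 0) • π 1 + x 1 • S' • π 0]) x := by
    refine hasFDerivAt_pi.2 fun i => ?_
    fin_cases i
    · exact h0
    · exact h1
  have hc : HasFDerivAt (fun y : Fin 2 → ℝ => h ![T (y 0), S (y 0) * y 1]) _ x :=
    HasFDerivAt.comp x hh.hasFDerivAt hΦ
  refine ⟨hc.differentiableAt, ?_⟩
  rw [dirDeriv, hc.fderiv]
  have e : (ContinuousLinearMap.pi ![T' • π 0, S (x 0) • π 1 + x 1 • S' • π 0] :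
      (Fin 2 → ℝ) →L[ℝ] (Fin 2 → ℝ)) v
      = (T' * v 0) • Pi.single 0 1 + (S' * v 0 * x 1 + S (x 0) * v 1) • Pi.single 1 1 := by
    funext i
    fin_cases i
    · simp [π]
    · simp [π]; ring
  rw [ContinuousLinearMap.comp_apply, e, map_add, map_smul, map_smul]
  simp [pderiv]

theorem contDiffOn_pderiv (hD : IsOpen D) (hf : ContDiffOn ℝ 2 f D) (i : Fin 2) :
    ContDiffOn ℝ 1 (pderiv f i) D :=
  (hf.fderiv_of_isOpen hD (m := 1) (by norm_num)).clm_apply contDiffOn_const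

/-- The functions `g(t, r) = M(t, r) f(T(t), S(t) r)` are solutions along with `f` whenever
`T' = S²`, `i S' r M = 2 S M_r`, the multiplier `M` solves the linear radial equation, and
`|M|^p = S²`: under these conditions, in this order, the terms with `f_t`, `f_r` and `f` and the
nonlinear term match. -/
theorem isRadialSolution_transform (hf : IsRadialSolution n p k D f) (hD' : IsOpen D')
    {T S S' : ℝ → ℝ} {M : (Fin 2 → ℝ) → ℂ}
    (hmem : ∀ x ∈ D', 0 < S (x 0) ∧ ![T (x 0), S (x 0) * x 1] ∈ D)
    (hT : ∀ x ∈ D', HasDerivAt T (S (x 0) ^ 2) (x 0))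
    (hS : ∀ x ∈ D', HasDerivAt S (S' (x 0)) (x 0))
    (hTc : ContDiffOn ℝ 2 (fun x : Fin 2 → ℝ => T (x 0)) D')
    (hSc : ContDiffOn ℝ 2 (fun x : Fin 2 → ℝ => S (x 0)) D') (hMc : ContDiffOn ℝ 2 M D')
    (hdrift : ∀ x ∈ D', Complex.I * M x * ((S' (x 0) * x 1 : ℝ) : ℂ)
      = 2 * pderiv M 1 x * (S (x 0) : ℂ))
    (hlin : ∀ x ∈ D', Complex.I * pderiv M 0 x - pderiv (pderiv M 1) 1 x
      - (((n - 1) / x 1 : ℝ) : ℂ) * pderiv M 1 x = 0)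
    (hpow : ∀ x ∈ D', ‖M x‖ ^ p = S (x 0) ^ 2)
    (hg : ∀ x ∈ D', g x = M x * f ![T (x 0), S (x 0) * x 1]) :
    IsRadialSolution n p k D' g := by
  obtain ⟨hD, hDr, hfc, hfe⟩ := hf
  have hr : ∀ x ∈ D', 0 < x 1 := fun x hx => by
    have h1 : 0 < S (x 0) * x 1 := by simpa using hDr _ (hmem x hx).2
    exact (mul_pos_iff_of_pos_left (hmem x hx).1).1 h1
  have hΦc : ContDiffOn ℝ 2 (fun x : Fin 2 → ℝ => ![T (x 0), S (x 0) * x 1]) D' := by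
    refine contDiffOn_pi.2 fun i => ?_
    fin_cases i
    · exact hTc
    · exact hSc.mul (contDiff_apply ℝ ℝ 1).contDiffOn
  have hgc : ContDiffOn ℝ 2 g D' :=
    (hMc.mul (hfc.comp hΦc fun x hx => (hmem x hx).2)).congr hg
  refine ⟨hD', hr, hgc, fun x hx => ?_⟩
  have hfd : ∀ y ∈ D, DifferentiableAt ℝ f y := fun y hy =>
    (hfc.contDiffAt (hD.mem_nhds hy)).differentiableAt (by norm_num)
  have hfd1 : ∀ y ∈ D, DifferentiableAt ℝ (pderiv f 1) y := fun y hy =>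
    ((contDiffOn_pderiv hD hfc 1).contDiffAt (hD.mem_nhds hy)).differentiableAt (by norm_num)
  have hMd : ∀ y ∈ D', DifferentiableAt ℝ M y := fun y hy =>
    (hMc.contDiffAt (hD'.mem_nhds hy)).differentiableAt (by norm_num)
  have hMd1 : DifferentiableAt ℝ (pderiv M 1) x :=
    ((contDiffOn_pderiv hD' hMc 1).contDiffAt (hD'.mem_nhds hx)).differentiableAt (by norm_num)
  have hSd : DifferentiableAt ℝ (fun y : Fin 2 → ℝ => S (y 0)) x :=
    (hSc.contDiffAt (hD'.mem_nhds hx)).differentiableAt (by norm_num)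
  have hc := fun {h} y (hy : y ∈ D') (hh : DifferentiableAt ℝ h _) =>
    dirDeriv_comp_rescaling (x := y) (h := h) (hT y hy) (hS y hy) hh
  have e0 : pderiv g 0 x = pderiv M 0 x * f ![T (x 0), S (x 0) * x 1]
      + M x * (((S (x 0) ^ 2 : ℝ) : ℂ) * pderiv f 0 ![T (x 0), S (x 0) * x 1]
        + ((S' (x 0) * x 1 : ℝ) : ℂ) * pderiv f 1 ![T (x 0), S (x 0) * x 1]) := by
    have h1 := hc x hx (hfd _ (hmem x hx).2) (Pi.single 0 1)
    rw [pderiv_eq_dirDeriv, dirDeriv_congr hD' hg _ hx, dirDeriv_mul_fun (hMd x hx) h1.1, h1.2,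
      pderiv_eq_dirDeriv M]
    simp
    ring
  have e1 : ∀ y ∈ D', pderiv g 1 y = pderiv M 1 y * f ![T (y 0), S (y 0) * y 1]
      + M y * ((S (y 0) : ℂ) * pderiv f 1 ![T (y 0), S (y 0) * y 1]) := fun y hy => by
    have h1 := hc y hy (hfd _ (hmem y hy).2) (Pi.single 1 1)
    rw [pderiv_eq_dirDeriv, dirDeriv_congr hD' hg _ hy, dirDeriv_mul_fun (hMd y hy) h1.1, h1.2,
      pderiv_eq_dirDeriv M]
    simp
    ring
  have e2 : pderiv (pderiv g 1) 1 x
      = pderiv (pderiv M 1) 1 x * f ![T (x 0), S (x 0) * x 1]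
        + 2 * pderiv M 1 x * ((S (x 0) : ℂ) * pderiv f 1 ![T (x 0), S (x 0) * x 1])
        + M x * ((S (x 0) : ℂ) ^ 2 * pderiv (pderiv f 1) 1 ![T (x 0), S (x 0) * x 1]) := by
    have h1 := hc x hx (hfd _ (hmem x hx).2) (Pi.single 1 1)
    have h2 := hc x hx (hfd1 _ (hmem x hx).2) (Pi.single 1 1)
    have hS0 : dirDeriv (Pi.single 1 1) (fun y : Fin 2 → ℝ => S (y 0)) x = 0 := by
      have h3 := (hS x hx).comp_hasFDerivAt x
        (ContinuousLinearMap.proj (R := ℝ) (φ := fun _ : Fin 2 => ℝ) 0).hasFDerivAt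
      have h4 : fderiv ℝ (fun y : Fin 2 → ℝ => S (y 0)) x = _ := h3.fderiv
      rw [dirDeriv, h4]
      simp
    have hSd' := differentiableAt_ofReal hSd
    rw [pderiv_eq_dirDeriv (pderiv g 1), dirDeriv_congr hD' e1 _ hx,
      dirDeriv_add_fun (hMd1.fun_mul h1.1) ((hMd x hx).fun_mul (hSd'.fun_mul h2.1)),
      dirDeriv_mul_fun hMd1 h1.1, dirDeriv_mul_fun (hMd x hx) (hSd'.fun_mul h2.1),
      dirDeriv_mul_fun hSd' h2.1, dirDeriv_ofReal hSd, hS0, h1.2, h2.2,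
      ← pderiv_eq_dirDeriv, ← pderiv_eq_dirDeriv]
    simp
    ring
  have hE := hfe _ (hmem x hx).2
  have hS0 : (S (x 0) : ℂ) ≠ 0 := by exact_mod_cast (hmem x hx).1.ne'
  have hx1 : (x 1 : ℂ) ≠ 0 := by exact_mod_cast (hr x hx).ne'
  have hl := hlin x hx
  have hd := hdrift x hx
  simp only [radialEq, jet2, Matrix.cons_val_one, Matrix.cons_val_fin_one] at hE ⊢
  rw [e0, e1 x hx, e2, hg x hx, norm_mul, Real.mul_rpow (norm_nonneg _) (norm_nonneg _),
    hpow x hx]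
  push_cast at hE hl hd ⊢
  have e3 : ((n : ℂ) - 1) / (x 1 : ℂ) * (S (x 0) : ℂ)
      = (S (x 0) : ℂ) ^ 2 * (((n : ℂ) - 1) / ((S (x 0) : ℂ) * (x 1 : ℂ))) := by
    field_simp
  linear_combination M x * (S (x 0) : ℂ) ^ 2 * hE + f ![T (x 0), S (x 0) * x 1] * hl
    + pderiv f 1 ![T (x 0), S (x 0) * x 1] * hd
    - M x * pderiv f 1 ![T (x 0), S (x 0) * x 1] * e3

theorem pderiv_const (c : ℂ) (i : Fin 2) : pderiv (fun _ : Fin 2 → ℝ => c) i = fun _ => 0 := by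
  funext x
  simp [pderiv]

end Solutions

/-! ### Group actions on solutions -/

section GroupActions

variable {n p k : ℝ} {D D' : Set (Fin 2 → ℝ)} {f g : (Fin 2 → ℝ) → ℂ}

theorem transforms_Xphas (hf : IsRadialSolution n p k D f) (φ : ℝ)
    (hg : ∀ t r : ℝ, ![t, r] ∈ D → g ![t, r] = Complex.exp (Complex.I * φ) * f ![t, r]) :
    Transforms Xphas φ D f D g ∧ IsRadialSolution n p k D g := by
  have hg' : ∀ x ∈ D, g x = Complex.exp (Complex.I * φ) * f x := fun x hx => by
    have := hg (x 0) (x 1)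
    rw [vec_eta] at this
    exact this hx
  constructor
  · ext z'
    simp only [flowsTo_Xphas_iff, graphOn, Set.mem_ofPred_eq]
    constructor
    · rintro ⟨z, ⟨hz, hzf⟩, rfl⟩
      exact ⟨hz, by simp only [hg' _ hz, hzf]⟩
    · rintro ⟨hz, hzg⟩
      exact ⟨(z'.1, f z'.1), ⟨hz, rfl⟩, Prod.ext rfl (by rw [hzg, hg' _ hz])⟩
  · refine isRadialSolution_transform hf hf.1 (T := fun t => t) (S := fun _ => 1)
      (S' := fun _ => 0) (M := fun _ => Complex.exp (Complex.I * φ))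
      (fun x hx => ⟨one_pos, by simpa [vec_eta] using hx⟩)
      (fun x _ => (hasDerivAt_id' (x 0)).congr_deriv (by simp)) (fun x _ => hasDerivAt_const _ _)
      (contDiff_apply ℝ ℝ 0).contDiffOn contDiffOn_const contDiffOn_const
      (fun x _ => by simp [pderiv_const]) (fun x _ => by simp [pderiv_const])
      (fun x _ => ?_) (fun x hx => ?_)
    · rw [mul_comm, Complex.norm_exp_ofReal_mul_I]
      simp
    · rw [hg' x hx, one_mul, vec_eta]

theorem transforms_Xtrans (hf : IsRadialSolution n p k D f) (ε : ℝ)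
    (hD' : ∀ t r : ℝ, ![t, r] ∈ D' ↔ ![t - ε, r] ∈ D)
    (hg : ∀ t r : ℝ, ![t, r] ∈ D' → g ![t, r] = f ![t - ε, r]) :
    Transforms Xtrans ε D f D' g ∧ IsRadialSolution n p k D' g := by
  have hmem : ∀ x : Fin 2 → ℝ, x ∈ D' ↔ ![x 0 - ε, x 1] ∈ D := fun x => by
    rw [← hD', vec_eta]
  have hg' : ∀ x ∈ D', g x = f ![x 0 - ε, x 1] := fun x hx => by
    have := hg (x 0) (x 1)
    rw [vec_eta] at this
    exact this hx
  constructor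
  · ext z'
    simp only [flowsTo_Xtrans_iff, graphOn, Set.mem_ofPred_eq]
    constructor
    · rintro ⟨z, ⟨hz, hzf⟩, rfl⟩
      have h : ![z.1 0 + ε, z.1 1] ∈ D' := by simpa [hmem, vec_eta] using hz
      exact ⟨h, by simp [hg' _ h, hzf, vec_eta]⟩
    · rintro ⟨hz, hzg⟩
      exact ⟨(![z'.1 0 - ε, z'.1 1], f ![z'.1 0 - ε, z'.1 1]), ⟨(hmem _).1 hz, rfl⟩,
        base_ext (by simp) (by simp) (by rw [hzg, hg' _ hz])⟩
  · have hopen : IsOpen D' := by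
      have : D' = (fun x : Fin 2 → ℝ => ![x 0 - ε, x 1]) ⁻¹' D := Set.ext hmem
      rw [this]
      refine hf.1.preimage (continuous_pi fun i => ?_)
      fin_cases i
      · exact (continuous_apply 0).sub continuous_const
      · exact continuous_apply 1
    refine isRadialSolution_transform hf hopen (T := fun t => t - ε) (S := fun _ => 1)
      (S' := fun _ => 0) (M := fun _ => 1)
      (fun x hx => ⟨one_pos, by simpa using (hmem x).1 hx⟩)
      (fun x _ => by simpa using (hasDerivAt_id (x 0)).sub_const ε)
      (fun x _ => hasDerivAt_const _ _)
      ((contDiff_apply ℝ ℝ 0).sub contDiff_const).contDiffOn contDiffOn_const contDiffOn_const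
      (fun x _ => by simp [pderiv_const]) (fun x _ => by simp [pderiv_const])
      (fun x _ => by simp) (fun x hx => by rw [hg' x hx, one_mul, one_mul])

theorem transforms_Xscal (hp : p ≠ 0) (hf : IsRadialSolution n p k D f) {l : ℝ} (hl : 0 < l)
    (hD' : ∀ t r : ℝ, ![t, r] ∈ D' ↔ ![(l ^ 2)⁻¹ * t, l⁻¹ * r] ∈ D)
    (hg : ∀ t r : ℝ, ![t, r] ∈ D' →
      g ![t, r] = ((l ^ (-2 / p) : ℝ) : ℂ) * f ![(l ^ 2)⁻¹ * t, l⁻¹ * r]) :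
    Transforms (Xscal p) (Real.log l) D f D' g ∧ IsRadialSolution n p k D' g := by
  have hmem : ∀ x : Fin 2 → ℝ, x ∈ D' ↔ ![(l ^ 2)⁻¹ * x 0, l⁻¹ * x 1] ∈ D := fun x => by
    rw [← hD', vec_eta]
  have hg' : ∀ x ∈ D', g x = ((l ^ (-2 / p) : ℝ) : ℂ) * f ![(l ^ 2)⁻¹ * x 0, l⁻¹ * x 1] :=
    fun x hx => by
    have := hg (x 0) (x 1)
    rw [vec_eta] at this
    exact this hx
  have e2 : Real.exp (2 * Real.log l) = l ^ 2 := by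
    rw [two_mul, Real.exp_add, Real.exp_log hl, pow_two]
  have e1 : Real.exp (Real.log l) = l := Real.exp_log hl
  have e3 : Real.exp (-(2 / p) * Real.log l) = l ^ (-2 / p) := by
    rw [Real.rpow_def_of_pos hl]
    congr 1
    ring
  have hl0 := hl.ne'
  constructor
  · ext z'
    simp only [flowsTo_Xscal_iff, graphOn, Set.mem_ofPred_eq, e1, e2, e3]
    have inv : ∀ x : Fin 2 → ℝ, ![(l ^ 2)⁻¹ * (![l ^ 2 * x 0, l * x 1] : Fin 2 → ℝ) 0,
        l⁻¹ * (![l ^ 2 * x 0, l * x 1] : Fin 2 → ℝ) 1] = x := fun x => by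
      funext i
      fin_cases i
      · simp [hl0]
      · simp [hl0]
    constructor
    · rintro ⟨z, ⟨hz, hzf⟩, rfl⟩
      have h : ![l ^ 2 * z.1 0, l * z.1 1] ∈ D' := by rwa [hmem, inv]
      exact ⟨h, by simp only [hg' _ h, inv, hzf]⟩
    · rintro ⟨hz, hzg⟩
      refine ⟨(![(l ^ 2)⁻¹ * z'.1 0, l⁻¹ * z'.1 1], f ![(l ^ 2)⁻¹ * z'.1 0, l⁻¹ * z'.1 1]),
        ⟨(hmem _).1 hz, rfl⟩, base_ext ?_ ?_ (by rw [hzg, hg' _ hz])⟩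
      · simp [hl0]
      · simp [hl0]
  · have hopen : IsOpen D' := by
      have : D' = (fun x : Fin 2 → ℝ => ![(l ^ 2)⁻¹ * x 0, l⁻¹ * x 1]) ⁻¹' D := Set.ext hmem
      rw [this]
      refine hf.1.preimage (continuous_pi fun i => ?_)
      fin_cases i
      · exact continuous_const.mul (continuous_apply 0)
      · exact continuous_const.mul (continuous_apply 1)
    refine isRadialSolution_transform hf hopen (T := fun t => (l ^ 2)⁻¹ * t) (S := fun _ => l⁻¹)
      (S' := fun _ => 0) (M := fun _ => ((l ^ (-2 / p) : ℝ) : ℂ))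
      (fun x hx => ⟨inv_pos.2 hl, (hmem x).1 hx⟩)
      (fun x _ => by simpa using (hasDerivAt_id (x 0)).const_mul (l ^ 2)⁻¹)
      (fun x _ => hasDerivAt_const _ _)
      (contDiff_const.mul (contDiff_apply ℝ ℝ 0)).contDiffOn contDiffOn_const contDiffOn_const
      (fun x _ => by simp [pderiv_const]) (fun x _ => by simp [pderiv_const])
      (fun x _ => ?_) hg'
    rw [Complex.norm_real, Real.norm_of_nonneg (Real.rpow_nonneg hl.le _), ← Real.rpow_mul hl.le,
      div_mul_cancel₀ _ hp, Real.rpow_neg hl.le, inv_pow, ← Real.rpow_natCast]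
    norm_num

/-- The multiplier in the action of the inversion on solutions. -/
def inversionMultiplier (p ε : ℝ) (x : Fin 2 → ℝ) : ℂ :=
  (((1 + ε * x 0) ^ (-2 / p) : ℝ) : ℂ) *
    Complex.exp (-Complex.I * ((ε * x 1 ^ 2 / (4 + 4 * ε * x 0) : ℝ) : ℂ))

theorem dirDeriv_cexp {E : Type} [NormedAddCommGroup E] [NormedSpace ℝ E] {F : E → ℂ} {x : E}
    (hF : DifferentiableAt ℝ F x) (v : E) :
    dirDeriv v (fun y => Complex.exp (F y)) x = Complex.exp (F x) * dirDeriv v F x := by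
  simp [dirDeriv, hF.hasFDerivAt.cexp.fderiv]

theorem dirDeriv_comp_time {R : ℝ → ℝ} {R' : ℝ} {x : Fin 2 → ℝ} (hR : HasDerivAt R R' (x 0))
    (v : Fin 2 → ℝ) : DifferentiableAt ℝ (fun y : Fin 2 → ℝ => R (y 0)) x ∧
      dirDeriv v (fun y : Fin 2 → ℝ => R (y 0)) x = R' * v 0 := by
  have h3 : HasFDerivAt (fun y : Fin 2 → ℝ => R (y 0)) _ x := hR.comp_hasFDerivAt x
    (ContinuousLinearMap.proj (R := ℝ) (φ := fun _ : Fin 2 => ℝ) 0).hasFDerivAt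
  refine ⟨h3.differentiableAt, ?_⟩
  rw [dirDeriv, h3.fderiv]
  simp

theorem dirDeriv_inversionMultiplier {ε : ℝ} {x : Fin 2 → ℝ} (hx : 0 < 1 + ε * x 0)
    (v : Fin 2 → ℝ) :
    dirDeriv v (inversionMultiplier p ε) x = inversionMultiplier p ε x *
      (((-2 / p * ε / (1 + ε * x 0) * v 0 : ℝ) : ℂ)
        + Complex.I * ((ε ^ 2 * x 1 ^ 2 / (4 * (1 + ε * x 0) ^ 2) * v 0
          - ε * x 1 / (2 * (1 + ε * x 0)) * v 1 : ℝ) : ℂ)) := by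
  have hq : HasDerivAt (fun t : ℝ => 1 + ε * t) ε (x 0) := by
    simpa using ((hasDerivAt_id (x 0)).const_mul ε).const_add 1
  have h1 := dirDeriv_comp_time (hq.rpow_const (p := -2 / p) (Or.inl hx.ne')) v
  have hQ : HasDerivAt (fun t : ℝ => ε / (4 * (1 + ε * t)))
      (-(ε ^ 2 / (4 * (1 + ε * x 0) ^ 2))) (x 0) := by
    refine ((hasDerivAt_const (x 0) ε).div (hq.const_mul 4) (by positivity)).congr_deriv ?_
    field_simp
    ring
  have h2 := dirDeriv_comp_time hQ v
  have hx1 : DifferentiableAt ℝ (fun y : Fin 2 → ℝ => y 1) x := by fun_prop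
  have hW := h2.1.fun_mul (hx1.fun_mul hx1)
  have hW' := differentiableAt_ofReal hW
  have e : inversionMultiplier p ε = fun y : Fin 2 → ℝ => (((1 + ε * y 0) ^ (-2 / p) : ℝ) : ℂ) *
      Complex.exp (-Complex.I * ((ε / (4 * (1 + ε * y 0)) * (y 1 * y 1) : ℝ) : ℂ)) := by
    funext y
    simp only [inversionMultiplier]
    congr 4
    ring
  rw [e, dirDeriv_mul_fun (differentiableAt_ofReal h1.1) (hW'.const_mul _).cexp,
    dirDeriv_cexp (hW'.const_mul _), dirDeriv_mul_fun (differentiableAt_const _) hW',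
    dirDeriv_const_fun, dirDeriv_ofReal hW, dirDeriv_ofReal h1.1, h1.2,
    dirDeriv_mul_fun h2.1 (hx1.fun_mul hx1), h2.2, dirDeriv_mul_fun hx1 hx1, dirDeriv_pi_coord,
    Real.rpow_sub_one hx.ne']
  have hx' : (1 + ε * x 0 : ℂ) ≠ 0 := by exact_mod_cast hx.ne'
  push_cast
  field_simp
  ring

theorem contDiffOn_inversionMultiplier (ε : ℝ) {V : Set (Fin 2 → ℝ)}
    (hV : ∀ x ∈ V, 0 < 1 + ε * x 0) : ContDiffOn ℝ 2 (inversionMultiplier p ε) V := by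
  have h0 : ContDiffOn ℝ 2 (fun x : Fin 2 → ℝ => 1 + ε * x 0) V := by fun_prop
  have h1 : ContDiffOn ℝ 2 (fun x : Fin 2 → ℝ => (1 + ε * x 0) ^ (-2 / p)) V :=
    h0.rpow_const_of_ne fun x hx => (hV x hx).ne'
  have h2 : ContDiffOn ℝ 2 (fun x : Fin 2 → ℝ => ε * x 1 ^ 2 / (4 + 4 * ε * x 0)) V :=
    ContDiffOn.div (by fun_prop) (by fun_prop) fun x hx => by
      have := hV x hx
      intro h
      linarith
  exact (Complex.ofRealCLM.contDiff.comp_contDiffOn h1).mul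
    (contDiffOn_const.mul (Complex.ofRealCLM.contDiff.comp_contDiffOn h2)).cexp

theorem transforms_Xinver (hp : p ≠ 0) (hcrit : p = 4 / n) (hf : IsRadialSolution n p k D f)
    (ε : ℝ)
    (hD' : ∀ t r : ℝ, ![t, r] ∈ D' ↔
      0 < 1 + ε * t ∧ ![t / (1 + ε * t), r / (1 + ε * t)] ∈ D)
    (hg : ∀ t r : ℝ, ![t, r] ∈ D' → g ![t, r] = (((1 + ε * t) ^ (-2 / p) : ℝ) : ℂ) *
      Complex.exp (-Complex.I * ((ε * r ^ 2 / (4 + 4 * ε * t) : ℝ) : ℂ)) *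
        f ![t / (1 + ε * t), r / (1 + ε * t)]) :
    Transforms (Xinver p) ε D f D' g ∧ IsRadialSolution n p k D' g := by
  have hmem : ∀ x : Fin 2 → ℝ, x ∈ D' ↔
      0 < 1 + ε * x 0 ∧ ![x 0 / (1 + ε * x 0), x 1 / (1 + ε * x 0)] ∈ D := fun x => by
    rw [← hD', vec_eta]
  have hg' : ∀ x ∈ D', g x = inversionMultiplier p ε x *
      f ![x 0 / (1 + ε * x 0), x 1 / (1 + ε * x 0)] := fun x hx => by
    have := hg (x 0) (x 1)
    rw [vec_eta] at this
    exact this hx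
  constructor
  · ext z'
    simp only [flowsTo_Xinver_iff, graphOn, Set.mem_ofPred_eq]
    constructor
    · rintro ⟨z, ⟨hz, hzf⟩, hpos, rfl⟩
      have h0 : (inversionOrbit p z ε).1 0 = z.1 0 / (1 - ε * z.1 0) := rfl
      have h1 : (inversionOrbit p z ε).1 1 = z.1 1 / (1 - ε * z.1 0) := rfl
      have hq : 1 + ε * (inversionOrbit p z ε).1 0 = (1 - ε * z.1 0)⁻¹ := by
        rw [h0]; field_simp; ring
      have hback : ![(inversionOrbit p z ε).1 0 / (1 + ε * (inversionOrbit p z ε).1 0),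
          (inversionOrbit p z ε).1 1 / (1 + ε * (inversionOrbit p z ε).1 0)] = z.1 := by
        rw [hq, h0, h1, div_div, div_div, mul_inv_cancel₀ hpos.ne', div_one, div_one, vec_eta]
      have h : (inversionOrbit p z ε).1 ∈ D' := by
        rw [hmem, hback, hq]
        exact ⟨inv_pos.2 hpos, hz⟩
      refine ⟨h, ?_⟩
      rw [hg' _ h, hback, ← hzf, inversionMultiplier, hq]
      have e1 : (1 - ε * z.1 0)⁻¹ ^ (-2 / p) = (1 - ε * z.1 0) ^ (2 / p) := by
        rw [Real.inv_rpow hpos.le, ← Real.rpow_neg hpos.le, neg_div, neg_neg]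
      have e2 : ε * (inversionOrbit p z ε).1 1 ^ 2 / (4 + 4 * ε * (inversionOrbit p z ε).1 0)
          = ε * z.1 1 ^ 2 / (4 * (1 - ε * z.1 0)) := by
        have : 4 + 4 * ε * (inversionOrbit p z ε).1 0 = 4 * (1 - ε * z.1 0)⁻¹ := by
          rw [← hq]; ring
        rw [this, h1]
        field_simp
      rw [e1, e2]
      rfl
    · rintro ⟨hz, hzg⟩
      obtain ⟨hpos, hzD⟩ := (hmem _).1 hz
      have hq : 1 - ε * (z'.1 0 / (1 + ε * z'.1 0)) = (1 + ε * z'.1 0)⁻¹ := by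
        field_simp; ring
      refine ⟨(![z'.1 0 / (1 + ε * z'.1 0), z'.1 1 / (1 + ε * z'.1 0)],
        f ![z'.1 0 / (1 + ε * z'.1 0), z'.1 1 / (1 + ε * z'.1 0)]), ⟨hzD, rfl⟩, ?_, ?_⟩
      · change 0 < 1 - ε * (z'.1 0 / (1 + ε * z'.1 0))
        rw [hq]
        exact inv_pos.2 hpos
      · refine base_ext ?_ ?_ ?_
        · change z'.1 0 = z'.1 0 / (1 + ε * z'.1 0) / (1 - ε * (z'.1 0 / (1 + ε * z'.1 0)))
          rw [hq, div_div, mul_inv_cancel₀ hpos.ne', div_one]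
        · change z'.1 1 = z'.1 1 / (1 + ε * z'.1 0) / (1 - ε * (z'.1 0 / (1 + ε * z'.1 0)))
          rw [hq, div_div, mul_inv_cancel₀ hpos.ne', div_one]
        · rw [hzg, hg' _ hz, inversionMultiplier]
          simp only [inversionOrbit, Matrix.cons_val_zero, Matrix.cons_val_one,
            Matrix.cons_val_fin_one]
          rw [hq]
          have e1 : (1 + ε * z'.1 0)⁻¹ ^ (2 / p) = (1 + ε * z'.1 0) ^ (-2 / p) := by
            rw [Real.inv_rpow hpos.le, ← Real.rpow_neg hpos.le, neg_div]
          have e2 : ε * (z'.1 1 / (1 + ε * z'.1 0)) ^ 2 / (4 * (1 + ε * z'.1 0)⁻¹)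
              = ε * z'.1 1 ^ 2 / (4 + 4 * ε * z'.1 0) := by
            have : 4 + 4 * ε * z'.1 0 = 4 * (1 + ε * z'.1 0) := by ring
            rw [this]
            field_simp
          rw [e1, e2]
  · have hVo : IsOpen {x : Fin 2 → ℝ | 0 < 1 + ε * x 0} :=
      isOpen_lt continuous_const (by fun_prop)
    have hopen : IsOpen D' := by
      have : D' = {x : Fin 2 → ℝ | 0 < 1 + ε * x 0} ∩
          (fun x : Fin 2 → ℝ => ![x 0 / (1 + ε * x 0), x 1 / (1 + ε * x 0)]) ⁻¹' D := Set.ext hmem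
      rw [this]
      refine ContinuousOn.isOpen_inter_preimage (continuousOn_pi.2 fun i => ?_) hVo hf.1
      fin_cases i
      · exact ContinuousOn.div (by fun_prop) (by fun_prop) fun x hx => (ne_of_gt hx)
      · exact ContinuousOn.div (by fun_prop) (by fun_prop) fun x hx => (ne_of_gt hx)
    have hpos : ∀ x ∈ D', 0 < 1 + ε * x 0 := fun x hx => ((hmem x).1 hx).1
    have hM1 : ∀ x ∈ D', pderiv (inversionMultiplier p ε) 1 x = inversionMultiplier p ε x *
        (-Complex.I * ((ε / (2 * (1 + ε * x 0)) * x 1 : ℝ) : ℂ)) := fun x hx => by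
      have a0 : (Pi.single (1 : Fin 2) (1 : ℝ) : Fin 2 → ℝ) 0 = 0 := by simp
      have a1 : (Pi.single (1 : Fin 2) (1 : ℝ) : Fin 2 → ℝ) 1 = 1 := by simp
      rw [pderiv_eq_dirDeriv, dirDeriv_inversionMultiplier (hpos x hx), a0, a1]
      push_cast
      ring
    have hM0 : ∀ x ∈ D', pderiv (inversionMultiplier p ε) 0 x = inversionMultiplier p ε x *
        (((-2 / p * ε / (1 + ε * x 0) : ℝ) : ℂ)
          + Complex.I * ((ε ^ 2 * x 1 ^ 2 / (4 * (1 + ε * x 0) ^ 2) : ℝ) : ℂ)) := fun x hx => by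
      rw [pderiv_eq_dirDeriv, dirDeriv_inversionMultiplier (hpos x hx)]
      simp
    have hMc := contDiffOn_inversionMultiplier (p := p) ε hpos
    have hq : ∀ x ∈ D', HasDerivAt (fun t : ℝ => 1 + ε * t) ε (x 0) := fun x _ => by
      simpa using ((hasDerivAt_id (x 0)).const_mul ε).const_add 1
    have hM11 : ∀ x ∈ D', pderiv (pderiv (inversionMultiplier p ε) 1) 1 x =
        inversionMultiplier p ε x * ((-Complex.I * ((ε / (2 * (1 + ε * x 0)) * x 1 : ℝ) : ℂ)) ^ 2
          - Complex.I * ((ε / (2 * (1 + ε * x 0)) : ℝ) : ℂ)) := fun x hx => by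
      have hQ := dirDeriv_comp_time (x := x) ((hasDerivAt_const (x 0) ε).div
        ((hq x hx).const_mul 2) (mul_pos two_pos (hpos x hx)).ne') (Pi.single 1 1)
      have hQ1 : DifferentiableAt ℝ (fun y : Fin 2 → ℝ => ε / (2 * (1 + ε * y 0))) x := hQ.1
      have hQ2 : dirDeriv (Pi.single 1 1) (fun y : Fin 2 → ℝ => ε / (2 * (1 + ε * y 0))) x = 0 :=
        hQ.2.trans (by simp)
      have hx1 : DifferentiableAt ℝ (fun y : Fin 2 → ℝ => y 1) x := by fun_prop
      have hW := hQ1.fun_mul hx1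
      have hW' := differentiableAt_ofReal hW
      have hMd := (hMc.contDiffAt (hopen.mem_nhds hx)).differentiableAt (by norm_num)
      rw [pderiv_eq_dirDeriv (pderiv _ 1), dirDeriv_congr hopen hM1 _ hx,
        dirDeriv_mul_fun hMd (hW'.const_mul _), dirDeriv_mul_fun (differentiableAt_const _) hW',
        dirDeriv_const_fun, dirDeriv_ofReal hW, dirDeriv_mul_fun hQ1 hx1, hQ2, dirDeriv_pi_coord,
        ← pderiv_eq_dirDeriv, hM1 x hx]
      simp
      ring
    refine isRadialSolution_transform hf hopen (T := fun t => t / (1 + ε * t))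
      (S := fun t => 1 / (1 + ε * t)) (S' := fun t => -ε / (1 + ε * t) ^ 2)
      (M := inversionMultiplier p ε)
      (fun x hx => ⟨one_div_pos.2 (hpos x hx), ?_⟩) (fun x hx => ?_) (fun x hx => ?_)
      (ContDiffOn.div (by fun_prop) (by fun_prop) fun x hx => (hpos x hx).ne')
      (ContDiffOn.div (by fun_prop) (by fun_prop) fun x hx => (hpos x hx).ne')
      hMc (fun x hx => ?_) (fun x hx => ?_) (fun x hx => ?_) (fun x hx => ?_)
    · rw [one_div_mul_eq_div]
      exact ((hmem x).1 hx).2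
    · refine ((hasDerivAt_id (x 0)).div (hq x hx) (hpos x hx).ne').congr_deriv ?_
      have := (hpos x hx).ne'
      simp only [id]
      field_simp
      ring
    · refine ((hasDerivAt_const (x 0) (1 : ℝ)).div (hq x hx) (hpos x hx).ne').congr_deriv ?_
      simp
    · have := (hpos x hx).ne'
      have hx' : (1 + ε * x 0 : ℂ) ≠ 0 := by exact_mod_cast this
      rw [hM1 x hx]
      push_cast
      field_simp
    · have hr : (x 1 : ℂ) ≠ 0 := by
        have h1 := hf.2.1 _ ((hmem x).1 hx).2
        have h2 : 0 < x 1 := by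
          simpa [div_pos_iff_of_pos_right (hpos x hx)] using h1
        exact_mod_cast h2.ne'
      have hx' : (1 + ε * x 0 : ℂ) ≠ 0 := by exact_mod_cast (hpos x hx).ne'
      have hnp : (n : ℂ) * p - 4 = 0 := by exact_mod_cast (critical_iff hp).1 hcrit
      have hp' : (p : ℂ) ≠ 0 := by exact_mod_cast hp
      rw [hM0 x hx, hM1 x hx, hM11 x hx]
      push_cast
      field_simp
      ring_nf
      -- what remains of the linear equation is a multiple of `n p - 4`
      linear_combination 8 * Complex.I * inversionMultiplier p ε x * ε * (1 + ε * x 0) * hnp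
    · have e : -Complex.I * ((ε * x 1 ^ 2 / (4 + 4 * ε * x 0) : ℝ) : ℂ)
          = ((-(ε * x 1 ^ 2 / (4 + 4 * ε * x 0)) : ℝ) : ℂ) * Complex.I := by
        push_cast
        ring
      have hq0 := (hpos x hx).le
      rw [inversionMultiplier, e, norm_mul, Complex.norm_exp_ofReal_mul_I, mul_one,
        Complex.norm_real, Real.norm_of_nonneg (Real.rpow_nonneg hq0 _), ← Real.rpow_mul hq0,
        div_mul_cancel₀ _ hp, Real.rpow_neg hq0, one_div, inv_pow, ← Real.rpow_natCast]
      norm_num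
    · rw [hg' x hx, one_div_mul_eq_div]

end GroupActions

end RadialNLS

end

theorem mainTheorem6 (n p k : ℝ) (hn : n ≠ 1) (hp : p ≠ 0) (hk : k ≠ 0) :
    -- classification of the point symmetries, over any domain where the equation is smooth
    (∀ U : Set (Base (Fin 2)), IsOpen U → IsConnected U → U ⊆ regularDomain →
      (p ≠ 4 / n → ∀ X : Base (Fin 2) → Base (Fin 2),
        IsPointSymmetry (radialEq n p k) U X ↔
          ∃ Y ∈ Submodule.span ℝ {Xphas, Xtrans, Xscal p}, Set.EqOn X Y U) ∧
      (p = 4 / n → ∀ X : Base (Fin 2) → Base (Fin 2),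
        IsPointSymmetry (radialEq n p k) U X ↔
          ∃ Y ∈ Submodule.span ℝ {Xphas, Xtrans, Xscal p, Xinver p}, Set.EqOn X Y U) ∧
      (IsPointSymmetry (radialEq n p k) U (Xinver p) ↔ p = 4 / n) ∧
      -- no hidden point symmetries
      (∀ d : ℕ, 2 ≤ d → n = d → ∀ X : Base (Fin 2) → Base (Fin 2),
        IsPointSymmetry (radialEq n p k) U X → IsInherited d p k U X)) ∧
    -- commutators
    (VectorField.lieBracket ℝ Xphas Xtrans = 0 ∧
      VectorField.lieBracket ℝ Xphas (Xscal p) = 0 ∧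
      VectorField.lieBracket ℝ Xphas (Xinver p) = 0 ∧
      VectorField.lieBracket ℝ Xtrans (Xscal p) = (2 : ℝ) • Xtrans ∧
      VectorField.lieBracket ℝ Xtrans (Xinver p) = Xscal p ∧
      VectorField.lieBracket ℝ (Xscal p) (Xinver p) = (2 : ℝ) • Xinver p) ∧
    -- transformation groups acting on solutions
    (∀ (D : Set (Fin 2 → ℝ)) (f : (Fin 2 → ℝ) → ℂ), IsRadialSolution n p k D f →
      (∀ (φ : ℝ) (g : (Fin 2 → ℝ) → ℂ),
        (∀ t r : ℝ, ![t, r] ∈ D → g ![t, r] = Complex.exp (Complex.I * φ) * f ![t, r]) →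
        Transforms Xphas φ D f D g ∧ IsRadialSolution n p k D g) ∧
      (∀ (ε : ℝ) (D' : Set (Fin 2 → ℝ)) (g : (Fin 2 → ℝ) → ℂ),
        (∀ t r : ℝ, ![t, r] ∈ D' ↔ ![t - ε, r] ∈ D) →
        (∀ t r : ℝ, ![t, r] ∈ D' → g ![t, r] = f ![t - ε, r]) →
        Transforms Xtrans ε D f D' g ∧ IsRadialSolution n p k D' g) ∧
      (∀ (l : ℝ) (D' : Set (Fin 2 → ℝ)) (g : (Fin 2 → ℝ) → ℂ), 0 < l →
        (∀ t r : ℝ, ![t, r] ∈ D' ↔ ![(l ^ 2)⁻¹ * t, l⁻¹ * r] ∈ D) →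
        (∀ t r : ℝ, ![t, r] ∈ D' →
          g ![t, r] = ((l ^ (-2 / p) : ℝ) : ℂ) * f ![(l ^ 2)⁻¹ * t, l⁻¹ * r]) →
        Transforms (Xscal p) (Real.log l) D f D' g ∧ IsRadialSolution n p k D' g) ∧
      (p = 4 / n → ∀ (ε : ℝ) (D' : Set (Fin 2 → ℝ)) (g : (Fin 2 → ℝ) → ℂ),
        (∀ t r : ℝ, ![t, r] ∈ D' ↔
          0 < 1 + ε * t ∧ ![t / (1 + ε * t), r / (1 + ε * t)] ∈ D) →
        (∀ t r : ℝ, ![t, r] ∈ D' → g ![t, r] = (((1 + ε * t) ^ (-2 / p) : ℝ) : ℂ) *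
          Complex.exp (-Complex.I * ((ε * r ^ 2 / (4 + 4 * ε * t) : ℝ) : ℂ)) *
            f ![t / (1 + ε * t), r / (1 + ε * t)]) →
        Transforms (Xinver p) ε D f D' g ∧ IsRadialSolution n p k D' g)) := by
  refine ⟨fun U hU hc hreg => ?_, commutators p, fun D f hf => ?_⟩
  · obtain ⟨h1, h2, h3⟩ := classification hn hp hk hU hc hreg
    exact ⟨h1, h2, h3, fun d _ hd X hX =>
      isInherited_of_isPointSymmetry hn hp hk hU hc hreg hd hX⟩
  · exact ⟨fun φ g hg => transforms_Xphas hf φ hg,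
      fun ε D' g hD' hg => transforms_Xtrans hf ε hD' hg,
      fun l D' g hl hD' hg => transforms_Xscal hp hf hl hD' hg,
      fun hcrit ε D' g hD' hg => transforms_Xinver hp hcrit hf ε hD' hg⟩
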